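/- Let $N$ be a finite ground set with $n$ elements and let $f:2^N\to\mathbb R$ be monotone, submodular and non-negative. A probability distribution $\mathcal D$ on $\mathbb R$, not depending on $n$, has a *generalized exponential tail* if either (i) for some $x_0\ge 0$ it has on $(x_0,\infty)$ the density $e^{-g(x)}$ with $g(x)=\sum_i a_i x^{\alpha_i}$, $\alpha_0\ge\alpha_1\ge\dots$, where the leading exponent satisfies $\alpha_0\ge 1$ (terms of equal exponent being collected, and $a_0>0$); or (ii) it has bounded support and, at the supremum of the support, either an atom or a density that is continuous and non-zero there. Assume moreover that all moments of $\mathcal D$ are finite and that its mean is positive. The noisy oracle is $\widetilde f(S)=\xi_S f(S)$, where the multipliers $\xi_S$, $S\subseteq N$, are drawn independently from $\mathcal D$. For $S\subseteq N$ and a bundle $A\subseteq N\setminus S$ put $A_{ij}=(A\setminus\{i\})\cup\{j\}$ for $i\in A$, $j\notin S\cup A$, and let $\widetilde F(S\cup A)$ be the average of $\widetilde f(S\cup A_{ij})$ over all such $i,j$. The algorithm SM-Greedy with bundle size $c$ starts from $S=\emptyset$ and repeats $\lfloor k/c\rfloor$ times: choose $A\in\arg\max\{\widetilde F(S\cup B):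 B\subseteq N\setminus S,\ |B|=c\}$, and then replace $S$ by $S\cup\hat A$, where $\hat A\in\arg\max_{i\in A,\,j\notin S\cup A}\widetilde f(S\cup A_{ij})$; ties are broken by an arbitrary fixed deterministic rule. It returns the final $S$. Given $\epsilon>0$, it is run with $c=\lceil 80/\epsilon\rceil$ if $k>400/\epsilon^2$, and with $c=k$ (a single iteration) if $k\le 400/\epsilon^2$. **Theorem.** There is an absolute constant $C_1>0$ such that for every $\epsilon>0$ there is an integer $d$ (depending only on $\epsilon$) such that for every constant $C_2$ and every distribution $\mathcal D$ as above there is $n_0$ with the following property. For all $n\ge n_0$, all $k$ with $C_1/\epsilon\le k\le C_2\log\log n$, and every tie-breaking rule, SM-Greedy makes at most $n^d$ oracle evaluations and returns a set $S$ with $|S|\le k$, and for every monotone submodular non-negative $f$ on $N$, with probability at least $1-4/\log_2 n$ over the noise, $$f(S)\ \ge\ \Bigl(1-\tfrac1e-\epsilon\Bigr)\max_{T\subseteq N,\ |T|\le k}f(T).$$ -/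

import Mathlib

open MeasureTheory Set

noncomputable section

/-- A set function `f : 2^N → ℝ` is submodular if `f (S ∪ T) ≤ f S + f T - f (S ∩ T)`. -/
def Submodular {n : ℕ} (f : Finset (Fin n) → ℝ) : Prop :=
  ∀ S T : Finset (Fin n), f (S ∪ T) ≤ f S + f T - f (S ∩ T)

/-- The optimal value `max {f T : |T| ≤ k}`. -/
def optValue {n : ℕ} (f : Finset (Fin n) → ℝ) (k : ℕ) : ℝ :=
  (Finset.univ.filter fun T : Finset (Fin n) => T.card ≤ k).sup' ⟨∅, by simp⟩ f

/-- Generalized exponential tail.  Either, beyond some point `x₀`, the law `D` has the density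
`exp (-g x)` with `g x = ∑ i, a i * x ^ α i` (finitely many nonzero terms or a convergent series),
`α 0 ≥ α 1 ≥ …` and `α 0 ≥ 1`; or `D` has bounded support with supremum `χ`, and has an atom at `χ`
or, near `χ`, a density which is continuous and nonzero at `χ`.

Terms of equal exponent are collected, so that `α 0` is the exponent of the leading term of `g`;
its coefficient is positive because `exp (-g)` is integrable at infinity. -/
def HasGeneralizedExponentialTail (D : Measure ℝ) : Prop :=
  (∃ (x₀ : ℝ) (a α : ℕ → ℝ) (g : ℝ → ℝ), 0 ≤ x₀ ∧ Antitone α ∧ 1 ≤ α 0 ∧ 0 < a 0 ∧ α 1 < α 0 ∧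
    (∀ x > x₀, HasSum (fun i => a i * x ^ α i) (g x)) ∧
    D.restrict (Ioi x₀) =
      (volume.restrict (Ioi x₀)).withDensity fun x => ENNReal.ofReal (Real.exp (-g x))) ∨
  (∃ b χ : ℝ, D (Icc b χ)ᶜ = 0 ∧ (∀ y < χ, 0 < D (Ioc y χ)) ∧
    (0 < D {χ} ∨
      ∃ y < χ, ∃ p : ℝ → ℝ, Measurable p ∧
        D.restrict (Ioc y χ) =
          (volume.restrict (Ioc y χ)).withDensity (fun x => ENNReal.ofReal (p x)) ∧
        ContinuousWithinAt p (Iic χ) χ ∧ 0 < p χ))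

/-- The joint law of the noise multipliers `(ξ_S)`, `S ⊆ N`: independent draws from `D`. -/
def noiseLaw (D : Measure ℝ) (n : ℕ) : Measure (Finset (Fin n) → ℝ) :=
  Measure.pi fun _ => D

/-- The (consistent) noisy oracle `S ↦ ξ_S * f S`. -/
def noisyOracle {n : ℕ} (f ξ : Finset (Fin n) → ℝ) : Finset (Fin n) → ℝ :=
  fun S => ξ S * f S

/-- A deterministic rule which selects one member of every nonempty family of sets.  It is used to
break ties between maximizers. -/
structure TieBreak (n : ℕ) where
  pick : Finset (Finset (Fin n)) → Finset (Fin n)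
  pick_mem : ∀ C : Finset (Finset (Fin n)), C.Nonempty → pick C ∈ C

/-- The maximizer of `h` over the family `C` which is selected by `τ`. -/
def argmaxOver {n : ℕ} (τ : TieBreak n) (C : Finset (Finset (Fin n)))
    (h : Finset (Fin n) → ℝ) : Finset (Fin n) :=
  τ.pick (C.filter fun B => ∀ B' ∈ C, h B' ≤ h B)

/-- The bundles of size `c` that may be added to `S`. -/
def bundles {n : ℕ} (c : ℕ) (S : Finset (Fin n)) : Finset (Finset (Fin n)) :=
  Finset.powersetCard c Sᶜ

/-- The bundle `A_ij = (A \ {i}) ∪ {j}`. -/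
def swap {n : ℕ} (A : Finset (Fin n)) (i j : Fin n) : Finset (Fin n) :=
  insert j (A.erase i)

/-- All bundles `A_ij` with `i ∈ A` and `j ∉ S ∪ A`. -/
def swaps {n : ℕ} (S A : Finset (Fin n)) : Finset (Finset (Fin n)) :=
  (A ×ˢ (S ∪ A)ᶜ).image fun p => swap A p.1 p.2

/-- The mean value of `A` given `S`: the average of `g (S ∪ A_ij)` over all `i ∈ A`, `j ∉ S ∪ A`.
For `g` the noisy oracle this is the noisy mean value. -/
def meanValue {n : ℕ} (g : Finset (Fin n) → ℝ) (S A : Finset (Fin n)) : ℝ :=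
  (∑ i ∈ A, ∑ j ∈ (S ∪ A)ᶜ, g (S ∪ swap A i j)) / ((A.card * (S ∪ A)ᶜ.card : ℕ) : ℝ)

/-- State of the algorithm: the current solution, and the number of oracle evaluations made so far
(each evaluation comes with a bounded number of additions and comparisons). -/
structure GreedyState (n : ℕ) where
  sol : Finset (Fin n)
  evals : ℕ

/-- One iteration of SM-Greedy with oracle `g` and bundle size `c`: find the bundle `A` of largest
mean value (evaluating all `g (S ∪ B_ij)`, for every bundle `B`), then add to the solution the
bundle `A_ij` which maximizes `g (S ∪ A_ij)`. -/
def smStep {n : ℕ} (τ : TieBreak n) (g : Finset (Fin n) → ℝ) (c : ℕ) (s : GreedyState n) :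
    GreedyState n :=
  let A := argmaxOver τ (bundles c s.sol) (meanValue g s.sol)
  { sol := s.sol ∪ argmaxOver τ (swaps s.sol A) (fun B => g (s.sol ∪ B))
    evals := s.evals + ∑ B ∈ bundles c s.sol, B.card * (s.sol ∪ B)ᶜ.card
      + A.card * (s.sol ∪ A)ᶜ.card }

/-- SM-Greedy with oracle `g`, bundle size `c` and budget `k`: `⌊k / c⌋` iterations, starting from
the empty solution. -/
def smGreedy {n : ℕ} (τ : TieBreak n) (g : Finset (Fin n) → ℝ) (c k : ℕ) : GreedyState n :=
  (smStep τ g c)^[k / c] ⟨∅, 0⟩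

/-- The bundle size.  With `δ = ε / 5`, it is `16 / δ = 80 / ε` (rounded up) if
`k > 16 / δ ^ 2 = 400 / ε ^ 2`; for smaller `k` a single bundle of size `k` is used. -/
def bundleSize (ε : ℝ) (k : ℕ) : ℕ :=
  if (k : ℝ) ≤ 400 / ε ^ 2 then k else ⌈80 / ε⌉₊

end

/-! ### Averaging consequences of submodularity. -/

section Submodularity

variable {n : ℕ} {f : Finset (Fin n) → ℝ}

/-! Fix the current solution `S` and let `W` be the largest `f (S ∪ B)` over bundles `B` of size
`c`. By submodularity, removing an average element of the best bundle costs at most a `1 / c` share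
of its gain, so that bundle has mean value at least `W - v` with `v = (W - f S) / c`
(`Submodular.le_sum_neighbors`). A noisy mean averages about `c * n` independent terms, hence
concentrates (truncation and Hoeffding). So whichever bundle `A` wins has mean value at least `W - v
- 2 * η * W`, with `η = 1 / (log log n) ^ 2`, and by Markov half of its neighbors `S ∪ A_ij` have
value at least `W - 2 * v - 4 * η * W`. If one of these has multiplier above `M`, no neighbor of `A`
has multiplier above `M'`, and `(1 - η) * M' ≤ M`, then the neighbor of largest noisy value is truly
worth at least `W - 2 * v - 6 * η * W` (`SelectionSystem.badSelection_subset`). The tail condition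
supplies such thresholds: with `L = log n`, the mass above `M` is at least `L ^ 2 / n`, that above
`M'` is zero or at most `1 / (n * L ^ 3)`.

The difficulty is that `A` is selected by the same multipliers, and a union bound over all `n ^ c`
bundles cannot exclude a multiplier above `M'`. Instead, for fixed `A` and neighbor `T`, resetting
`ξ T` changes each total by at most `W * R`, where `R = n ^ (1/10)` truncates the noise. Up to
truncation errors, the event that `A` wins and `ξ T > M'` therefore has probability at most that of
`ξ T > M'` times that of `A` being a maximizer up to `2 * W * R`
(`SelectionSystem.real_inter_max_spike_le`). It remains to bound the sum over `A` of the latter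
probabilities.

This is an anti-concentration statement, proved by coupling. Attempt, with probability `ρ = n ^
(-3/4)` each, to raise multipliers of neighbors of `A` from below `a` to above `a + 1`. The score of
this change of measure has mean zero, so its cost is governed by `ρ ^ 2 * n`, which tends to zero;
the gain is of order `ρ * n = n ^ (1/4)`, far above `R`, and turns a near maximizer into the strict
one. Hence near maximality is at most `e` times as likely as strict maximality, up to small errors
(`SelectionSystem.real_nearMax_le`), and the strict events are disjoint.

Successive iterations see fresh noise: the solution after `t` iterations depends only on multipliers
of sets with at most `t * c` elements, the next one queries sets with exactly `(t + 1) * c`. Each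
fails with probability at most `1 / L ^ 2`. If none fails, the gap to the optimum contracts by `1 -
(c - 2) / k` per iteration with additive error `6 * η` times the optimum. The contraction leaves at
most `1 / e + ε / 2`, and the errors add up to `O(1 / log log n)` because `k = O(log log n)`. -/

theorem Submodular.sum_sub_erase_le (hf : Submodular f) (S X : Finset (Fin n))
    (hSX : Disjoint S X) :
    ∑ i ∈ X, (f (S ∪ X) - f (S ∪ X.erase i)) ≤ f (S ∪ X) - f S := by
  classical
  induction X using Finset.induction_on with
  | empty => simp
  | insert a Y ha ih =>
    have haS : a ∉ S := fun h => Finset.disjoint_left.1 hSX h (Finset.mem_insert_self _ _)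
    have hSY : Disjoint S Y := hSX.mono_right (Finset.subset_insert _ _)
    rw [Finset.sum_insert ha, Finset.erase_insert ha]
    have h : ∑ i ∈ Y, (f (S ∪ insert a Y) - f (S ∪ (insert a Y).erase i)) ≤
        ∑ i ∈ Y, (f (S ∪ Y) - f (S ∪ Y.erase i)) := by
      refine Finset.sum_le_sum fun i hi => ?_
      -- Diminishing returns: the marginal contribution of `i` does not grow when `a` is added.
      have h1 := hf (S ∪ Y) (S ∪ (insert a Y).erase i)
      have e1 : (S ∪ Y) ∪ (S ∪ (insert a Y).erase i) = S ∪ insert a Y := by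
        ext x
        simp only [Finset.mem_union, Finset.mem_erase, Finset.mem_insert]
        have : x = i → x ∈ Y := fun h => h ▸ hi
        tauto
      have e2 : (S ∪ Y) ∩ (S ∪ (insert a Y).erase i) = S ∪ Y.erase i := by
        ext x
        simp only [Finset.mem_union, Finset.mem_inter, Finset.mem_erase, Finset.mem_insert]
        have : x = a → x ∉ Y := fun h => h ▸ ha
        tauto
      rw [e1, e2] at h1
      linarith
    have := ih hSY
    linarith

/-- Deleting the element of least marginal contribution loses at most a `1 / |X|` share of the gain,
by `Submodular.sum_sub_erase_le`. So the ratio of gain to size does not decrease while elements are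
deleted one at a time until `c` are left. -/
theorem Submodular.exists_subset_card_eq (hf : Submodular f) (S : Finset (Fin n)) {c : ℕ}
    (hc : 0 < c) (X : Finset (Fin n)) (hSX : Disjoint S X) (hX : c ≤ X.card) :
    ∃ B ⊆ X, B.card = c ∧ (c : ℝ) * (f (S ∪ X) - f S) ≤ (X.card : ℝ) * (f (S ∪ B) - f S) := by
  classical
  induction X using Finset.strongInduction with
  | H X ih =>
    rcases hX.eq_or_lt with h | h
    · exact ⟨X, subset_rfl, h.symm, by rw [h]⟩
    · have hne : X.Nonempty := Finset.card_pos.1 (by omega)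
      have hsum := hf.sum_sub_erase_le S X hSX
      obtain ⟨i, hi, hle⟩ : ∃ i ∈ X, f (S ∪ X) - f (S ∪ X.erase i) ≤
          (f (S ∪ X) - f S) / X.card := by
        refine Finset.exists_le_of_sum_le hne (hsum.trans ?_)
        rw [Finset.sum_const, nsmul_eq_mul, mul_div_cancel₀]
        exact_mod_cast (Finset.card_pos.2 hne).ne'
      have hcard : (X.erase i).card = X.card - 1 := Finset.card_erase_of_mem hi
      obtain ⟨B, hBX, hBc, hB⟩ := ih (X.erase i) (Finset.erase_ssubset hi)
        (hSX.mono_right (Finset.erase_subset _ _)) (by omega)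
      refine ⟨B, hBX.trans (Finset.erase_subset _ _), hBc, ?_⟩
      have hx : (2 : ℝ) ≤ X.card := by exact_mod_cast (by omega : 2 ≤ X.card)
      rw [hcard, Nat.cast_sub (by omega), Nat.cast_one] at hB
      rw [le_div_iff₀ (by linarith)] at hle
      have hc' : (0 : ℝ) ≤ c := Nat.cast_nonneg c
      have h3 : (c : ℝ) * ((f (S ∪ X) - f S) * ((X.card : ℝ) - 1)) ≤
          c * (X.card * (f (S ∪ X.erase i) - f S)) :=
        mul_le_mul_of_nonneg_left (by nlinarith) hc'
      have h4 : ((X.card : ℝ) - 1) * ((c : ℝ) * (f (S ∪ X) - f S)) ≤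
          (X.card - 1) * (X.card * (f (S ∪ B) - f S)) := by
        nlinarith [mul_le_mul_of_nonneg_left hB (by linarith : (0 : ℝ) ≤ X.card)]
      exact le_of_mul_le_mul_left h4 (by linarith)

end Submodularity

/-! ### Counting the neighbors of a bundle and their overlaps. -/

section Swaps

variable {n : ℕ}

theorem mem_bundles {c : ℕ} {S A : Finset (Fin n)} :
    A ∈ bundles c S ↔ Disjoint S A ∧ A.card = c := by
  rw [bundles, Finset.mem_powersetCard, Finset.subset_compl_iff_disjoint_left]

/-- The queried sets `S ∪ A_ij`. -/
def neighbors (S A : Finset (Fin n)) : Finset (Finset (Fin n)) :=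
  (swaps S A).image (S ∪ ·)

theorem swap_mem_bundles {c : ℕ} {S A : Finset (Fin n)} (hA : A ∈ bundles c S) {i j : Fin n}
    (hi : i ∈ A) (hj : j ∈ (S ∪ A)ᶜ) : swap A i j ∈ bundles c S := by
  rw [mem_bundles] at hA ⊢
  rw [Finset.mem_compl, Finset.mem_union, not_or] at hj
  refine ⟨?_, ?_⟩
  · rw [swap, Finset.disjoint_insert_right]
    exact ⟨hj.1, hA.1.mono_right (Finset.erase_subset _ _)⟩
  · rw [swap, Finset.card_insert_of_notMem (fun h => hj.2 (Finset.mem_of_mem_erase h)),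
      Finset.card_erase_add_one hi, hA.2]

theorem swaps_subset_bundles {c : ℕ} {S A : Finset (Fin n)} (hA : A ∈ bundles c S) :
    swaps S A ⊆ bundles c S := by
  intro B hB
  obtain ⟨p, hp, rfl⟩ := Finset.mem_image.1 hB
  rw [Finset.mem_product] at hp
  exact swap_mem_bundles hA hp.1 hp.2

theorem card_union_of_mem_bundles {c : ℕ} {S A : Finset (Fin n)} (hA : A ∈ bundles c S) :
    (S ∪ A).card = S.card + c := by
  rw [mem_bundles] at hA
  rw [Finset.card_union_of_disjoint hA.1, hA.2]

theorem card_compl_union_of_mem_bundles {c : ℕ} {S A : Finset (Fin n)} (hA : A ∈ bundles c S) :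
    (S ∪ A)ᶜ.card = n - (S.card + c) := by
  rw [Finset.card_compl, Fintype.card_fin, card_union_of_mem_bundles hA]

theorem exists_of_mem_neighbors {c : ℕ} {S A T : Finset (Fin n)} (hA : A ∈ bundles c S)
    (hT : T ∈ neighbors S A) : ∃ B ∈ bundles c S, S ∪ B = T := by
  obtain ⟨B, hB, rfl⟩ := Finset.mem_image.1 hT
  exact ⟨B, swaps_subset_bundles hA hB, rfl⟩

theorem card_of_mem_neighbors {c : ℕ} {S A T : Finset (Fin n)} (hA : A ∈ bundles c S)
    (hT : T ∈ neighbors S A) : T.card = S.card + c := by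
  obtain ⟨B, hB, rfl⟩ := exists_of_mem_neighbors hA hT
  exact card_union_of_mem_bundles hB

theorem union_injOn_bundles {c : ℕ} {S B B' : Finset (Fin n)} (hB : B ∈ bundles c S)
    (hB' : B' ∈ bundles c S) (h : S ∪ B = S ∪ B') : B = B' := by
  rw [mem_bundles] at hB hB'
  have := congrArg (· \ S) h
  simpa [Finset.union_sdiff_left, Finset.sdiff_eq_self_of_disjoint hB.1.symm,
    Finset.sdiff_eq_self_of_disjoint hB'.1.symm] using this

theorem swap_injOn {S A : Finset (Fin n)} :
    Set.InjOn (fun p : Fin n × Fin n => swap A p.1 p.2) (A ×ˢ (S ∪ A)ᶜ : Finset _) := by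
  rintro ⟨i, j⟩ h ⟨i', j'⟩ h' heq
  simp only [Finset.coe_product, Set.mem_prod, Finset.mem_coe, Finset.mem_compl,
    Finset.mem_union, not_or] at h h'
  simp only [swap] at heq
  have hj : j = j' := by
    have : j ∈ insert j' (A.erase i') := heq ▸ Finset.mem_insert_self _ _
    rcases Finset.mem_insert.1 this with h1 | h1
    · exact h1
    · exact absurd (Finset.mem_of_mem_erase h1) h.2.2
  subst hj
  have hi : i = i' := by
    by_contra hne
    have h1 : i ∈ insert j (A.erase i') :=
      Finset.mem_insert_of_mem (Finset.mem_erase.2 ⟨hne, h.1⟩)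
    rw [← heq] at h1
    rcases Finset.mem_insert.1 h1 with h2 | h2
    · exact h.2.2 (h2 ▸ h.1)
    · exact (Finset.mem_erase.1 h2).1 rfl
  rw [hi]

theorem sum_neighbors {c : ℕ} {S A : Finset (Fin n)} (hA : A ∈ bundles c S)
    (g : Finset (Fin n) → ℝ) :
    ∑ T ∈ neighbors S A, g T = ∑ i ∈ A, ∑ j ∈ (S ∪ A)ᶜ, g (S ∪ swap A i j) := by
  rw [neighbors, Finset.sum_image, swaps, Finset.sum_image swap_injOn, Finset.sum_product]
  intro B hB B' hB' h
  exact union_injOn_bundles (swaps_subset_bundles hA hB) (swaps_subset_bundles hA hB') h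

theorem card_neighbors {c : ℕ} {S A : Finset (Fin n)} (hA : A ∈ bundles c S) :
    (neighbors S A).card = c * (n - (S.card + c)) := by
  rw [neighbors, Finset.card_image_of_injOn, swaps, Finset.card_image_of_injOn swap_injOn,
    Finset.card_product, card_compl_union_of_mem_bundles hA, (mem_bundles.1 hA).2]
  intro B hB B' hB' h
  exact union_injOn_bundles (swaps_subset_bundles hA hB) (swaps_subset_bundles hA hB') h

theorem meanValue_eq {c : ℕ} {S A : Finset (Fin n)} (hA : A ∈ bundles c S)
    (g : Finset (Fin n) → ℝ) :
    meanValue g S A = (∑ T ∈ neighbors S A, g T) / ((c * (n - (S.card + c)) : ℕ) : ℝ) := by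
  rw [meanValue, sum_neighbors hA, card_compl_union_of_mem_bundles hA, (mem_bundles.1 hA).2]

/-- Take `a ∈ A \ B`. If a common neighbor omits `a`, then `a` is the element removed from `A`; if
it contains `a`, then `a` is the element added to `B`. Either way one free choice remains, so the
overlap has order `n` against about `c * n` neighbors. -/
theorem card_neighbors_inter_le {c : ℕ} {S A B : Finset (Fin n)} (hA : A ∈ bundles c S)
    (hB : B ∈ bundles c S) (hAB : A ≠ B) :
    (neighbors S A ∩ neighbors S B).card ≤ (n - (S.card + c)) + c := by
  classical
  have hA' := mem_bundles.1 hA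
  have hB' := mem_bundles.1 hB
  obtain ⟨a, haA, haB⟩ : ∃ a ∈ A, a ∉ B := by
    by_contra! h
    exact hAB (Finset.eq_of_subset_of_card_le h (by rw [hA'.2, hB'.2]))
  have hsub : neighbors S A ∩ neighbors S B ⊆
      ((S ∪ A)ᶜ.image fun j => S ∪ swap A a j) ∪ (B.image fun i => S ∪ swap B i a) := by
    intro T hT
    obtain ⟨hTA, hTB⟩ := Finset.mem_inter.1 hT
    obtain ⟨T₁, h₁, rfl⟩ := Finset.mem_image.1 hTA
    obtain ⟨T₂, h₂, hT₂⟩ := Finset.mem_image.1 hTB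
    have := union_injOn_bundles (swaps_subset_bundles hB h₂) (swaps_subset_bundles hA h₁) hT₂
    subst this
    obtain ⟨⟨i, j⟩, hij, h₃⟩ := Finset.mem_image.1 h₁
    obtain ⟨⟨i', j'⟩, hij', h₄⟩ := Finset.mem_image.1 h₂
    rw [Finset.mem_product] at hij hij'
    simp only at hij hij' h₃ h₄
    rw [Finset.mem_union]
    by_cases ha : a ∈ T₂
    · right
      have : a = j' := by
        rw [← h₄, swap, Finset.mem_insert] at ha
        exact ha.resolve_right fun h => haB (Finset.mem_of_mem_erase h)
      exact Finset.mem_image.2 ⟨i', hij'.1, by rw [this, h₄]⟩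
    · left
      have : a = i := by
        by_contra hne
        exact ha (h₃ ▸ Finset.mem_insert_of_mem (Finset.mem_erase.2 ⟨hne, haA⟩))
      exact Finset.mem_image.2 ⟨j, hij.2, by rw [this, h₃]⟩
  calc _ ≤ _ := Finset.card_le_card hsub
    _ ≤ _ := Finset.card_union_le _ _
    _ ≤ (S ∪ A)ᶜ.card + B.card := Nat.add_le_add Finset.card_image_le Finset.card_image_le
    _ = _ := by rw [card_compl_union_of_mem_bundles hA, hB'.2]

/-- By monotonicity the added element `j` can be ignored; the losses from removing each `i` together
amount to at most one full gain `f (S ∪ A) - f S`, which is a `1 / c` share of it on average. -/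
theorem Submodular.le_sum_neighbors {f : Finset (Fin n) → ℝ} (hf : Submodular f)
    (hm : Monotone f) {c : ℕ} {S A : Finset (Fin n)} (hA : A ∈ bundles c S) :
    ((n - (S.card + c) : ℕ) : ℝ) * (c * f (S ∪ A) - (f (S ∪ A) - f S)) ≤
      ∑ T ∈ neighbors S A, f T := by
  rw [sum_neighbors hA]
  have h1 := hf.sum_sub_erase_le S A (mem_bundles.1 hA).1
  rw [Finset.sum_sub_distrib, Finset.sum_const, (mem_bundles.1 hA).2, nsmul_eq_mul] at h1
  calc _ ≤ ((n - (S.card + c) : ℕ) : ℝ) * ∑ i ∈ A, f (S ∪ A.erase i) :=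
        mul_le_mul_of_nonneg_left (by linarith) (Nat.cast_nonneg _)
    _ = ∑ i ∈ A, ∑ j ∈ (S ∪ A)ᶜ, f (S ∪ A.erase i) := by
        simp only [Finset.sum_const, nsmul_eq_mul, card_compl_union_of_mem_bundles hA,
          Finset.mul_sum]
    _ ≤ _ := Finset.sum_le_sum fun i _ => Finset.sum_le_sum fun j _ =>
        hm (Finset.union_subset_union_right (Finset.subset_insert _ _))

end Swaps

/-! ### Dynamics of the algorithm: maximizers, queried sets, measurability, evaluation count. -/

noncomputable section

section Argmax

variable {n : ℕ}

theorem argmaxOver_spec (τ : TieBreak n) {C : Finset (Finset (Fin n))} (hC : C.Nonempty)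
    (h : Finset (Fin n) → ℝ) :
    argmaxOver τ C h ∈ C ∧ ∀ B ∈ C, h B ≤ h (argmaxOver τ C h) := by
  obtain ⟨B, hB, hmax⟩ := C.exists_max_image h hC
  exact Finset.mem_filter.1 (τ.pick_mem _ ⟨B, Finset.mem_filter.2 ⟨hB, hmax⟩⟩)

theorem argmaxOver_congr (τ : TieBreak n) {C : Finset (Finset (Fin n))}
    {h h' : Finset (Fin n) → ℝ} (hh : ∀ B ∈ C, h B = h' B) :
    argmaxOver τ C h = argmaxOver τ C h' := by
  unfold argmaxOver
  congr 1
  refine Finset.filter_congr fun B hB => forall₂_congr fun B' hB' => ?_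
  rw [hh B hB, hh B' hB']

theorem measurableSet_argmaxOver_eq {Ω : Type*} [MeasurableSpace Ω] (τ : TieBreak n)
    (C : Finset (Finset (Fin n))) {h : Ω → Finset (Fin n) → ℝ}
    (hh : ∀ B, Measurable fun ω => h ω B) (A : Finset (Fin n)) :
    MeasurableSet {ω | argmaxOver τ C (h ω) = A} := by
  classical
  -- The set of maximizers takes finitely many values `C'`, and the event that it equals `C'` is
  -- given by finitely many inequalities.
  have key : {ω | argmaxOver τ C (h ω) = A} = ⋃ C' : Finset (Finset (Fin n)),
      {ω | τ.pick C' = A ∧ ∀ B, B ∈ C' ↔ (B ∈ C ∧ ∀ B' ∈ C, h ω B' ≤ h ω B)} := by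
    ext ω
    simp only [mem_ofPred_eq, mem_iUnion, argmaxOver]
    constructor
    · intro hA
      exact ⟨_, hA, fun B => Finset.mem_filter⟩
    · rintro ⟨C', hA, hC'⟩
      rw [← hA]
      congr 1
      ext B
      rw [hC', Finset.mem_filter]
  rw [key]
  refine MeasurableSet.iUnion fun C' => measurableSet_setOfPred.2 ?_
  refine Measurable.and measurable_const (Measurable.forall fun B => Measurable.iff
    measurable_const (Measurable.and measurable_const (Measurable.forall fun B' =>
      Measurable.imp measurable_const ?_)))
  exact measurableSet_setOfPred.1 (measurableSet_le (hh B') (hh B))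

end Argmax

section Algorithm

variable {n : ℕ}

/-- The solution after one iteration of SM-Greedy which starts from the solution `S`. -/
def stepSol (τ : TieBreak n) (g : Finset (Fin n) → ℝ) (c : ℕ) (S : Finset (Fin n)) :
    Finset (Fin n) :=
  S ∪ argmaxOver τ (swaps S (argmaxOver τ (bundles c S) (meanValue g S))) (fun B => g (S ∪ B))

theorem smStep_iterate_sol (τ : TieBreak n) (g : Finset (Fin n) → ℝ) (c t : ℕ) :
    ((smStep τ g c)^[t] ⟨∅, 0⟩).sol = (stepSol τ g c)^[t] ∅ := by
  induction t with
  | zero => rfl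
  | succ t ih => rw [Function.iterate_succ_apply', Function.iterate_succ_apply', ← ih]; rfl

theorem bundles_nonempty {c : ℕ} {S : Finset (Fin n)} (h : S.card + c ≤ n) :
    (bundles c S).Nonempty := by
  rw [bundles, Finset.powersetCard_nonempty, Finset.card_compl, Fintype.card_fin]
  omega

theorem swaps_nonempty {c : ℕ} (hc : 0 < c) {S A : Finset (Fin n)} (h : S.card + c < n)
    (hA : A ∈ bundles c S) : (swaps S A).Nonempty := by
  refine Finset.Nonempty.image (Finset.Nonempty.product ?_ ?_) _
  · rw [← Finset.card_pos, (mem_bundles.1 hA).2]; exact hc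
  · rw [← Finset.card_pos, card_compl_union_of_mem_bundles hA]; omega

theorem stepSol_spec (τ : TieBreak n) (g : Finset (Fin n) → ℝ) {c : ℕ} (hc : 0 < c)
    {S : Finset (Fin n)} (h : S.card + c < n) :
    ∃ A ∈ bundles c S, (∀ B ∈ bundles c S, meanValue g S B ≤ meanValue g S A) ∧
      stepSol τ g c S ∈ neighbors S A ∧ ∀ T ∈ neighbors S A, g T ≤ g (stepSol τ g c S) := by
  obtain ⟨hA, hmax⟩ := argmaxOver_spec τ (bundles_nonempty h.le) (meanValue g S)
  refine ⟨_, hA, hmax, ?_⟩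
  obtain ⟨hB, hmax'⟩ := argmaxOver_spec τ (swaps_nonempty hc h hA) (fun B => g (S ∪ B))
  refine ⟨Finset.mem_image_of_mem _ hB, fun T hT => ?_⟩
  obtain ⟨B, hB, rfl⟩ := Finset.mem_image.1 hT
  exact hmax' B hB

theorem card_stepSol (τ : TieBreak n) (g : Finset (Fin n) → ℝ) {c : ℕ} (hc : 0 < c)
    {S : Finset (Fin n)} (h : S.card + c < n) : (stepSol τ g c S).card = S.card + c := by
  obtain ⟨A, hA, -, hT, -⟩ := stepSol_spec τ g hc h
  exact card_of_mem_neighbors hA hT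

theorem card_iterate_stepSol (τ : TieBreak n) (g : Finset (Fin n) → ℝ) {c : ℕ} (hc : 0 < c)
    (t : ℕ) (h : t * c < n) : ((stepSol τ g c)^[t] ∅).card = t * c := by
  induction t with
  | zero => simp
  | succ t ih =>
    have h' : t * c + c < n := by rwa [← Nat.succ_mul]
    have := ih (by omega)
    rw [Function.iterate_succ_apply', card_stepSol τ g hc (by omega), this, Nat.succ_mul]

/-- A step from `S` queries sets of one cardinality only. This is the source of the independence
between a step and its starting point. -/
theorem stepSol_congr (τ : TieBreak n) {g g' : Finset (Fin n) → ℝ} {c : ℕ} {S : Finset (Fin n)}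
    (h : S.card + c ≤ n) (hg : ∀ T, T.card = S.card + c → g T = g' T) :
    stepSol τ g c S = stepSol τ g' c S := by
  have h1 : argmaxOver τ (bundles c S) (meanValue g S) =
      argmaxOver τ (bundles c S) (meanValue g' S) := by
    refine argmaxOver_congr τ fun B hB => ?_
    rw [meanValue_eq hB, meanValue_eq hB]
    congr 1
    exact Finset.sum_congr rfl fun T hT => hg T (card_of_mem_neighbors hB hT)
  have hA := (argmaxOver_spec τ (bundles_nonempty h) (meanValue g' S)).1
  rw [stepSol, stepSol, h1]
  congr 1
  exact argmaxOver_congr τ fun B hB =>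
    hg _ (card_union_of_mem_bundles (swaps_subset_bundles hA hB))

theorem iterate_stepSol_congr (τ : TieBreak n) {g g' : Finset (Fin n) → ℝ} {c : ℕ} (hc : 0 < c)
    (t : ℕ) (h : t * c < n) (hg : ∀ T, T.card ≤ t * c → g T = g' T) :
    (stepSol τ g c)^[t] ∅ = (stepSol τ g' c)^[t] ∅ := by
  induction t with
  | zero => simp only [Function.iterate_zero, id]
  | succ t ih =>
    have h' : t * c + c < n := by rwa [← Nat.succ_mul]
    rw [Nat.succ_mul] at hg
    have hcard := card_iterate_stepSol τ g' hc t (by omega)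
    have hS := ih (by omega) fun T hT => hg T (by omega)
    generalize hS' : (stepSol τ g' c)^[t] ∅ = S at hS hcard
    have e := stepSol_congr τ (S := S) (g := g) (g' := g') (c := c) (by omega)
      fun T hT => hg T (by omega)
    rw [Function.iterate_succ_apply', hS, e, Function.iterate_succ_apply', hS']

theorem measurable_meanValue {Ω : Type*} [MeasurableSpace Ω] {g : Ω → Finset (Fin n) → ℝ}
    (hg : ∀ T, Measurable fun ω => g ω T) (S A : Finset (Fin n)) :
    Measurable fun ω => meanValue (g ω) S A := by
  unfold meanValue
  exact (Finset.measurable_sum _ fun i _ => Finset.measurable_sum _ fun j _ => hg _).div_const _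

theorem measurableSet_iterate_stepSol_eq {Ω : Type*} [MeasurableSpace Ω] (τ : TieBreak n)
    {g : Ω → Finset (Fin n) → ℝ} (hg : ∀ T, Measurable fun ω => g ω T) (c t : ℕ)
    (S : Finset (Fin n)) : MeasurableSet {ω | (stepSol τ (g ω) c)^[t] ∅ = S} := by
  classical
  induction t generalizing S with
  | zero => simp
  | succ t ih =>
    have key : {ω | (stepSol τ (g ω) c)^[t + 1] ∅ = S} =
        ⋃ (S₀ : Finset (Fin n)) (A : Finset (Fin n)) (B : Finset (Fin n)) (_ : S₀ ∪ B = S),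
        {ω | (stepSol τ (g ω) c)^[t] ∅ = S₀} ∩
        {ω | argmaxOver τ (bundles c S₀) (meanValue (g ω) S₀) = A} ∩
        {ω | argmaxOver τ (swaps S₀ A) (fun B => g ω (S₀ ∪ B)) = B} := by
      ext ω
      simp only [mem_ofPred_eq, mem_iUnion, mem_inter_iff, Function.iterate_succ_apply',
        exists_prop]
      constructor
      · intro h
        exact ⟨_, _, _, h, ⟨rfl, rfl⟩, rfl⟩
      · rintro ⟨S₀, A, B, rfl, ⟨rfl, rfl⟩, rfl⟩
        rfl
    rw [key]
    refine MeasurableSet.iUnion fun S₀ => MeasurableSet.iUnion fun A => MeasurableSet.iUnion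
      fun B => MeasurableSet.iUnion fun _ => ((ih S₀).inter ?_).inter ?_
    · exact measurableSet_argmaxOver_eq τ _ (measurable_meanValue hg S₀) A
    · exact measurableSet_argmaxOver_eq τ _ (fun B => hg _) B

theorem evals_smStep_le (τ : TieBreak n) (g : Finset (Fin n) → ℝ) (c : ℕ) (s : GreedyState n)
    (hn : 0 < n) : (smStep τ g c s).evals ≤ s.evals + 2 * n ^ (c + 2) := by
  have hb : ∀ A B : Finset (Fin n), A.card * B.card ≤ n ^ 2 := fun A B => by
    rw [pow_two]
    exact Nat.mul_le_mul (card_finset_fin_le A) (card_finset_fin_le B)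
  have h1 : ∑ B ∈ bundles c s.sol, B.card * (s.sol ∪ B)ᶜ.card ≤ n ^ (c + 2) := by
    calc _ ≤ (bundles c s.sol).card • n ^ 2 := Finset.sum_le_card_nsmul _ _ _ fun B _ => hb _ _
      _ ≤ n ^ c * n ^ 2 := by
        rw [smul_eq_mul]
        refine Nat.mul_le_mul_right _ ?_
        rw [bundles, Finset.card_powersetCard]
        exact (Nat.choose_le_pow _ _).trans (Nat.pow_le_pow_left (card_finset_fin_le _) _)
      _ = _ := (pow_add _ _ _).symm
  have h2 := hb (argmaxOver τ (bundles c s.sol) (meanValue g s.sol))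
    (s.sol ∪ argmaxOver τ (bundles c s.sol) (meanValue g s.sol))ᶜ
  have h3 : n ^ 2 ≤ n ^ (c + 2) := Nat.pow_le_pow_right hn (by omega)
  simp only [smStep]
  omega

theorem evals_iterate_smStep_le (τ : TieBreak n) (g : Finset (Fin n) → ℝ) (c t : ℕ)
    (hn : 0 < n) : ((smStep τ g c)^[t] ⟨∅, 0⟩).evals ≤ t * (2 * n ^ (c + 2)) := by
  induction t with
  | zero => simp
  | succ t ih =>
    rw [Function.iterate_succ_apply', Nat.succ_mul]
    exact (evals_smStep_le τ g c _ hn).trans (Nat.add_le_add_right ih _)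

theorem smGreedy_card_evals_le (τ : TieBreak n) (g : Finset (Fin n) → ℝ) {c k : ℕ} (hc : 0 < c)
    (hn : 2 ≤ n) (hk : k < n) :
    (smGreedy τ g c k).sol.card ≤ k ∧ (smGreedy τ g c k).evals ≤ n ^ (c + 4) := by
  have hkc : k / c * c ≤ k := Nat.div_mul_le_self k c
  constructor
  · rw [smGreedy, smStep_iterate_sol, card_iterate_stepSol τ g hc _ (by omega)]
    exact hkc
  · calc _ ≤ k / c * (2 * n ^ (c + 2)) := evals_iterate_smStep_le τ g c _ (by omega)
      _ ≤ n * (n * n ^ (c + 2)) := by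
        gcongr
        exact (Nat.div_le_self k c).trans hk.le
      _ = n ^ (c + 4) := by ring

end Algorithm

/-! ### The failure event of a single iteration. -/

section BadSelection

/-- Noise vectors for which some maximizer `A` of the noisy total, followed by a maximizer of the
noisy weight over the neighbors of `A`, leads to a true weight below `θ`. -/
def badSelection {ι β : Type*} (𝒜 : Finset β) (Nb : β → Finset ι) (w : ι → ℝ) (θ : ℝ) :
    Set (ι → ℝ) :=
  {ξ | ∃ A ∈ 𝒜, (∀ B ∈ 𝒜, ∑ T ∈ Nb B, ξ T * w T ≤ ∑ T ∈ Nb A, ξ T * w T) ∧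
    ∃ T ∈ Nb A, (∀ T' ∈ Nb A, ξ T' * w T' ≤ ξ T * w T) ∧ w T < θ}

theorem le_stepSol_of_notMem_badSelection {n : ℕ} (τ : TieBreak n) {f ξ : Finset (Fin n) → ℝ}
    {c : ℕ} (hc : 0 < c) {S : Finset (Fin n)} (h : S.card + c < n) {θ : ℝ}
    (hξ : ξ ∉ badSelection (bundles c S) (neighbors S) f θ) :
    θ ≤ f (stepSol τ (noisyOracle f ξ) c S) := by
  by_contra! hlt
  obtain ⟨A, hA, hmax, hT, hmax'⟩ := stepSol_spec τ (noisyOracle f ξ) hc h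
  refine hξ ⟨A, hA, fun B hB => ?_, _, hT, hmax', hlt⟩
  have := hmax B hB
  rw [meanValue_eq hB, meanValue_eq hA, div_le_div_iff_of_pos_right] at this
  · exact this
  · exact_mod_cast Nat.mul_pos hc (by omega)

theorem measurableSet_badSelection {ι β : Type*} (𝒜 : Finset β) (Nb : β → Finset ι) (w : ι → ℝ)
    (θ : ℝ) : MeasurableSet (badSelection 𝒜 Nb w θ) := by
  have key : badSelection 𝒜 Nb w θ = ⋃ A ∈ 𝒜,
      (⋂ B ∈ 𝒜, {ξ | ∑ T ∈ Nb B, ξ T * w T ≤ ∑ T ∈ Nb A, ξ T * w T}) ∩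
      ⋃ T ∈ Nb A, (⋂ T' ∈ Nb A, {ξ | ξ T' * w T' ≤ ξ T * w T}) ∩ {_ξ | w T < θ} := by
    ext ξ
    simp only [badSelection, mem_ofPred_eq, mem_iUnion, mem_inter_iff, mem_iInter, exists_prop]
  rw [key]
  refine Finset.measurableSet_biUnion _ fun A _ => MeasurableSet.inter ?_ ?_
  · exact Finset.measurableSet_biInter _ fun B _ => measurableSet_le (by fun_prop) (by fun_prop)
  · refine Finset.measurableSet_biUnion _ fun T _ => MeasurableSet.inter ?_ (.const _)
    exact Finset.measurableSet_biInter _ fun T' _ => measurableSet_le (by fun_prop) (by fun_prop)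

end BadSelection

end

/-! ### Greedy analysis: from the value of one step to the final approximation ratio. -/

noncomputable section

section Greedy

variable {n : ℕ}

/-- The largest value of `f (S ∪ B)` over the bundles `B` of size `c`. -/
def bundleMax (f : Finset (Fin n) → ℝ) (c : ℕ) (S : Finset (Fin n)) : ℝ :=
  if h : (bundles c S).Nonempty then (bundles c S).sup' h fun B => f (S ∪ B) else 0

theorem bundleMax_spec (f : Finset (Fin n) → ℝ) {c : ℕ} {S : Finset (Fin n)}
    (h : S.card + c ≤ n) : (∃ A ∈ bundles c S, bundleMax f c S = f (S ∪ A)) ∧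
      ∀ B ∈ bundles c S, f (S ∪ B) ≤ bundleMax f c S := by
  rw [bundleMax, dif_pos (bundles_nonempty h)]
  exact ⟨Finset.exists_mem_eq_sup' _ _, fun B hB => Finset.le_sup' (fun B => f (S ∪ B)) hB⟩

/-- The value that one iteration of SM-Greedy reaches with high probability. -/
def stepValue (f : Finset (Fin n) → ℝ) (c : ℕ) (η : ℝ) (S : Finset (Fin n)) : ℝ :=
  bundleMax f c S - 2 * ((bundleMax f c S - f S) / c) - 6 * η * bundleMax f c S

theorem le_optValue (f : Finset (Fin n) → ℝ) {k : ℕ} {T : Finset (Fin n)} (hT : T.card ≤ k) :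
    f T ≤ optValue f k :=
  Finset.le_sup' f (Finset.mem_filter.2 ⟨Finset.mem_univ _, hT⟩)

theorem exists_optValue_eq (f : Finset (Fin n) → ℝ) (k : ℕ) :
    ∃ T : Finset (Fin n), T.card ≤ k ∧ optValue f k = f T := by
  obtain ⟨T, hT, h⟩ := Finset.exists_mem_eq_sup'
    (⟨∅, by simp⟩ : (Finset.univ.filter fun T : Finset (Fin n) => T.card ≤ k).Nonempty) f
  exact ⟨T, (Finset.mem_filter.1 hT).2, h⟩

theorem bundleMax_le_optValue (f : Finset (Fin n) → ℝ) {c k : ℕ} {S : Finset (Fin n)}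
    (hS : S.card + c ≤ k) (hn : S.card + c ≤ n) : bundleMax f c S ≤ optValue f k := by
  obtain ⟨⟨A, hA, h⟩, -⟩ := bundleMax_spec f hn
  rw [h]
  exact le_optValue f (by rw [card_union_of_mem_bundles hA]; exact hS)

/-- Let `O` be optimal. If `O \ S` has at most `c` elements, pad it to a bundle, which already
reaches the optimum. Otherwise some `c` of its at most `k` elements carry a proportional share of
its gain (`Submodular.exists_subset_card_eq`). -/
theorem Submodular.mul_le_bundleMax_sub {f : Finset (Fin n) → ℝ} (hf : Submodular f)
    (hm : Monotone f) {c k : ℕ} (hc : 0 < c) {S : Finset (Fin n)} (hS : S.card + c ≤ k)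
    (hn : S.card + c ≤ n) :
    (c : ℝ) * (optValue f k - f S) ≤ k * (bundleMax f c S - f S) := by
  obtain ⟨O, hO, hopt⟩ := exists_optValue_eq f k
  have hSO : S ∪ (O \ S) = S ∪ O := Finset.union_sdiff_self_eq_union
  have hdisj : Disjoint S (O \ S) := Finset.disjoint_sdiff
  have hle : optValue f k ≤ f (S ∪ O) := hopt ▸ hm Finset.subset_union_right
  have hpos : 0 ≤ optValue f k - f S := sub_nonneg.2 (le_optValue f (by omega))
  have hck : (c : ℝ) ≤ k := by exact_mod_cast (by omega : c ≤ k)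
  have hX : (O \ S).card ≤ k := (Finset.card_le_card Finset.sdiff_subset).trans hO
  obtain ⟨-, hmax⟩ := bundleMax_spec f hn
  rcases le_total (O \ S).card c with h | h
  · obtain ⟨B, hB1, hB2, hB3⟩ := Finset.exists_subsuperset_card_eq
      (Finset.subset_compl_iff_disjoint_left.2 hdisj) h (n := c)
      (by rw [Finset.card_compl, Fintype.card_fin]; omega)
    have hB : B ∈ bundles c S := Finset.mem_powersetCard.2 ⟨hB2, hB3⟩
    have h1 : f (S ∪ O) ≤ f (S ∪ B) := hSO ▸ hm (Finset.union_subset_union_right hB1)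
    have h2 := hmax B hB
    calc (c : ℝ) * (optValue f k - f S) ≤ k * (optValue f k - f S) :=
          mul_le_mul_of_nonneg_right hck hpos
      _ ≤ _ := mul_le_mul_of_nonneg_left (by linarith) (Nat.cast_nonneg _)
  · obtain ⟨B, hB1, hB2, hB3⟩ := hf.exists_subset_card_eq S hc (O \ S) hdisj h
    have hB : B ∈ bundles c S := mem_bundles.2 ⟨hdisj.mono_right hB1, hB2⟩
    have h2 := hmax B hB
    rw [hSO] at hB3
    have h3 : 0 ≤ f (S ∪ B) - f S := sub_nonneg.2 (hm Finset.subset_union_left)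
    have hXk : ((O \ S).card : ℝ) ≤ k := by exact_mod_cast hX
    calc (c : ℝ) * (optValue f k - f S) ≤ c * (f (S ∪ O) - f S) :=
          mul_le_mul_of_nonneg_left (by linarith) (Nat.cast_nonneg _)
      _ ≤ _ := hB3
      _ ≤ k * (f (S ∪ B) - f S) := mul_le_mul_of_nonneg_right hXk h3
      _ ≤ _ := mul_le_mul_of_nonneg_left (by linarith) (Nat.cast_nonneg _)

theorem Submodular.optValue_sub_le_of_stepValue_le {f : Finset (Fin n) → ℝ} (hf : Submodular f)
    (hm : Monotone f) {c k : ℕ} (hc : 2 ≤ c) {η : ℝ} (hη : 0 ≤ η)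
    {S S' : Finset (Fin n)} (hS : S.card + c ≤ k) (hn : S.card + c ≤ n)
    (h : stepValue f c η S ≤ f S') :
    optValue f k - f S' ≤
      (1 - ((c : ℝ) - 2) / k) * (optValue f k - f S) + 6 * η * optValue f k := by
  have h1 := hf.mul_le_bundleMax_sub hm (by omega) hS hn
  have h2 := bundleMax_le_optValue f hS hn
  have hc' : (2 : ℝ) ≤ c := by exact_mod_cast hc
  have hk : (0 : ℝ) < k := by exact_mod_cast (by omega : 0 < k)
  set W := bundleMax f c S with hW
  set O := optValue f k
  rw [stepValue, ← hW] at h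
  have h3 : 6 * η * W ≤ 6 * η * O := mul_le_mul_of_nonneg_left h2 (by linarith)
  have h4 : (c : ℝ) / k * (O - f S) ≤ W - f S := by
    rw [div_mul_eq_mul_div, div_le_iff₀ hk]; linarith
  -- `stepValue` gives up a `2 / c` share of the gain `W - f S`, so the greedy rate `c / k` becomes
  -- `(c - 2) / k`.
  have h5 : (1 - 2 / (c : ℝ)) * (c / k * (O - f S)) ≤ (1 - 2 / c) * (W - f S) :=
    mul_le_mul_of_nonneg_left h4 (sub_nonneg.2 ((div_le_one (by linarith)).2 hc'))
  have h6 : (1 - 2 / (c : ℝ)) * (c / k * (O - f S)) = ((c : ℝ) - 2) / k * (O - f S) := by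
    field_simp
  have h7 : (1 - 2 / (c : ℝ)) * (W - f S) = W - f S - 2 * ((W - f S) / c) := by ring
  linarith

theorem Submodular.optValue_sub_iterate_le {f : Finset (Fin n) → ℝ} (hf : Submodular f)
    (hm : Monotone f) (h0 : 0 ≤ f ∅) {c k r : ℕ} (hc : 2 ≤ c) (hr : r * c ≤ k) (hk : k < n)
    {η : ℝ} (hη : 0 ≤ η) (s : ℕ → Finset (Fin n)) (hs0 : s 0 = ∅)
    (hcard : ∀ t ≤ r, (s t).card = t * c)
    (hs : ∀ t < r, stepValue f c η (s t) ≤ f (s (t + 1))) :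
    optValue f k - f (s r) ≤ ((1 - ((c : ℝ) - 2) / k) ^ r + 6 * η * r) * optValue f k := by
  have hO : 0 ≤ optValue f k := h0.trans (le_optValue f (by simp))
  have key : ∀ t ≤ r, optValue f k - f (s t) ≤
      ((1 - ((c : ℝ) - 2) / k) ^ t + 6 * η * t) * optValue f k := by
    intro t
    induction t with
    | zero => intro _; rw [hs0]; simp [h0]
    | succ t ih =>
      intro ht
      have hct : t * c + c ≤ r * c := by rw [← Nat.succ_mul]; exact Nat.mul_le_mul_right _ ht
      have hck : c ≤ k := by omega
      have h1 := ih (by omega)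
      have h2 := hf.optValue_sub_le_of_stepValue_le hm hc hη (k := k)
        (by rw [hcard t (by omega)]; omega) (by rw [hcard t (by omega)]; omega) (hs t (by omega))
      have hc' : (2 : ℝ) ≤ c := by exact_mod_cast hc
      have hk0 : (0 : ℝ) < k := by exact_mod_cast (by omega : 0 < k)
      have hck' : (c : ℝ) ≤ k := by exact_mod_cast hck
      have hq0 : 0 ≤ ((c : ℝ) - 2) / k := div_nonneg (by linarith) hk0.le
      have hq1 : ((c : ℝ) - 2) / k ≤ 1 := (div_le_one hk0).2 (by linarith)
      set q := ((c : ℝ) - 2) / k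
      have h3 : (1 - q) * (optValue f k - f (s t)) ≤
          (1 - q) * (((1 - q) ^ t + 6 * η * t) * optValue f k) :=
        mul_le_mul_of_nonneg_left h1 (by linarith)
      -- The contraction of earlier errors is discarded; they are simply added up.
      have h4 : 0 ≤ q * (6 * η * t * optValue f k) := by positivity
      push_cast
      rw [pow_succ]
      linarith
  exact key r le_rfl

end Greedy

/-! ### Numerical consequences of the choice of bundle size. -/

section BundleSize

/-- In the single-iteration regime the left side is `2 / k`, below `1 / 3 < 1 / e`. Otherwise
rounding `k / c` down costs at most `c / k` and the swap loss `2 / c`, together at most `ε / 4`, in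
an exponent that would ideally be `1`. -/
theorem one_sub_pow_le {ε : ℝ} (hε : 0 < ε) (hε1 : ε < 1) {k : ℕ} (hk : 16 / ε ≤ k) :
    16 ≤ bundleSize ε k ∧
    (1 - ((bundleSize ε k : ℝ) - 2) / k) ^ (k / bundleSize ε k) ≤ 1 / Real.exp 1 + ε / 2 := by
  have hk16 : (16 : ℝ) < k := lt_of_lt_of_le (by rw [lt_div_iff₀ hε]; linarith) hk
  have hk0 : (0 : ℝ) < k := by linarith
  have he : (1 : ℝ) / 3 ≤ 1 / Real.exp 1 :=
    one_div_le_one_div_of_le (Real.exp_pos 1) (by linarith [Real.exp_one_lt_d9])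
  unfold bundleSize
  split_ifs with h
  · have : 16 ≤ k := by exact_mod_cast hk16.le
    refine ⟨this, ?_⟩
    rw [Nat.div_self (by omega), pow_one]
    have h1 : 1 - ((k : ℝ) - 2) / k = 2 / k := by field_simp; ring
    rw [h1]
    have : (2 : ℝ) / k ≤ 1 / 3 := by rw [div_le_div_iff₀ hk0 (by norm_num)]; linarith
    linarith
  · push Not at h
    set c := ⌈80 / ε⌉₊ with hc
    have hc1 : 80 / ε ≤ c := Nat.le_ceil _
    have hc2 : (c : ℝ) < 80 / ε + 1 := Nat.ceil_lt_add_one (by positivity)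
    have h80 : (80 : ℝ) < 80 / ε := by rw [lt_div_iff₀ hε]; linarith
    have hc80 : (80 : ℝ) < c := by linarith
    have hc0 : 0 < c := by exact_mod_cast (by linarith : (0 : ℝ) < c)
    refine ⟨by exact_mod_cast (by linarith : (16 : ℝ) ≤ c), ?_⟩
    have hck : (c : ℝ) / k ≤ ε / 5 + ε / 400 := by
      rw [div_le_iff₀ hk0]
      -- The summand `ε ^ 2 / 400` pays for rounding `80 / ε` up.
      have h1 : (ε / 5 + ε ^ 2 / 400) * (400 / ε ^ 2) = 80 / ε + 1 := by field_simp; ring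
      have h2 : (ε / 5 + ε ^ 2 / 400) * (400 / ε ^ 2) ≤ (ε / 5 + ε ^ 2 / 400) * k :=
        mul_le_mul_of_nonneg_left h.le (by positivity)
      have h3 : (ε / 5 + ε ^ 2 / 400) * k ≤ (ε / 5 + ε / 400) * k :=
        mul_le_mul_of_nonneg_right (by nlinarith) hk0.le
      linarith
    have h2c : 2 / (c : ℝ) ≤ ε / 40 := by
      rw [div_le_div_iff₀ (by linarith) (by norm_num)]
      rw [div_le_iff₀ hε] at hc1
      linarith
    have hr : (k : ℝ) - c ≤ (k / c : ℕ) * c := by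
      have := Nat.lt_div_mul_add (a := k) hc0
      have h' : (k : ℝ) < (k / c : ℕ) * c + c := by exact_mod_cast this
      linarith
    set r := k / c
    have hx : 1 - ε / 4 ≤ (r : ℝ) * (((c : ℝ) - 2) / k) := by
      have e1 : (r : ℝ) * (((c : ℝ) - 2) / k) = (r * c / k) * (1 - 2 / c) := by
        field_simp
      have h1 : 1 - (c : ℝ) / k ≤ r * c / k := by
        rw [le_div_iff₀ hk0, sub_mul, div_mul_cancel₀ _ hk0.ne']; linarith
      have h2 : (1 - (c : ℝ) / k) * (1 - 2 / c) ≤ (r * c / k) * (1 - 2 / c) :=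
        mul_le_mul_of_nonneg_right h1 (by linarith)
      rw [e1]
      have h3 : 0 ≤ (c : ℝ) / k * (2 / c) := by positivity
      nlinarith
    have hq1 : ((c : ℝ) - 2) / k ≤ 1 := by
      rw [div_le_one hk0]
      have : (c : ℝ) / k ≤ 1 := by linarith
      rw [div_le_one hk0] at this
      linarith
    calc (1 - ((c : ℝ) - 2) / k) ^ r ≤ (Real.exp (-(((c : ℝ) - 2) / k))) ^ r :=
          pow_le_pow_left₀ (by linarith) (Real.one_sub_le_exp_neg _) _
      _ = Real.exp (-(r * (((c : ℝ) - 2) / k))) := by rw [← Real.exp_nat_mul]; congr 1; ring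
      _ ≤ Real.exp (-1 + ε / 4) := Real.exp_le_exp.2 (by linarith)
      _ = 1 / Real.exp 1 * Real.exp (ε / 4) := by
          rw [Real.exp_add, Real.exp_neg, one_div]
      _ ≤ 1 / Real.exp 1 * (1 + ε / 2) := by
          refine mul_le_mul_of_nonneg_left ?_ (by positivity)
          have := Real.abs_exp_sub_one_le (x := ε / 4) (by rw [abs_of_pos] <;> linarith)
          rw [abs_of_pos (by linarith : 0 < ε / 4)] at this
          linarith [le_abs_self (Real.exp (ε / 4) - 1)]
      _ ≤ 1 / Real.exp 1 + ε / 2 := by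
          have : 1 / Real.exp 1 ≤ 1 := by
            rw [div_le_one (Real.exp_pos 1)]; exact Real.one_le_exp (by norm_num)
          nlinarith

theorem bundleSize_pos {ε : ℝ} (hε : 0 < ε) {k : ℕ} (hk : 16 / ε ≤ k) : 0 < bundleSize ε k := by
  unfold bundleSize
  split_ifs with h
  · have : (0 : ℝ) < k := lt_of_lt_of_le (by positivity) hk
    exact_mod_cast this
  · exact Nat.ceil_pos.2 (by positivity)

theorem bundleSize_le (ε : ℝ) (k : ℕ) :
    bundleSize ε k ≤ ⌈400 / ε ^ 2⌉₊ + ⌈80 / ε⌉₊ := by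
  unfold bundleSize
  split_ifs with h
  · have : k ≤ ⌈400 / ε ^ 2⌉₊ := by exact_mod_cast h.trans (Nat.le_ceil _)
    omega
  · omega

end BundleSize

end

/-! ### Product measures: independence, union bounds, truncation and concentration. -/

section ProductMeasures

open ProbabilityTheory
open scoped ENNReal NNReal

variable {ι : Type*} [Fintype ι]

theorem lintegral_pi_prod {α : ι → Type*} [∀ i, MeasurableSpace (α i)] (μ : ∀ i, Measure (α i))
    [∀ i, IsProbabilityMeasure (μ i)] (s : Finset ι) {F : ∀ i, α i → ℝ≥0∞}
    (hF : ∀ i, Measurable (F i)) :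
    ∫⁻ ω, ∏ i ∈ s, F i (ω i) ∂Measure.pi μ = ∏ i ∈ s, ∫⁻ x, F i x ∂μ i := by
  rw [lintegral_prod_eq_prod_lintegral_of_indepFun s (fun i (ω : ∀ i, α i) => F i (ω i))
    (iIndepFun_pi fun i => (hF i).aemeasurable) fun i => (hF i).comp (measurable_pi_apply i)]
  exact Finset.prod_congr rfl fun i _ =>
    (measurePreserving_eval μ i).lintegral_comp (hF i)

theorem pi_withDensity {α : ι → Type*} [∀ i, MeasurableSpace (α i)] (μ : ∀ i, Measure (α i))
    [∀ i, IsProbabilityMeasure (μ i)] {r : ∀ i, α i → ℝ≥0∞} (hr : ∀ i, Measurable (r i))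
    [∀ i, SigmaFinite ((μ i).withDensity (r i))] :
    Measure.pi (fun i => (μ i).withDensity (r i)) =
      (Measure.pi μ).withDensity fun ω => ∏ i, r i (ω i) := by
  refine Measure.pi_eq fun s hs => ?_
  rw [withDensity_apply _ (MeasurableSet.univ_pi hs), ← lintegral_indicator
    (MeasurableSet.univ_pi hs)]
  have h : ∀ ω, (univ.pi s).indicator (fun ω => ∏ i, r i (ω i)) ω =
      ∏ i, (s i).indicator (r i) (ω i) := by
    intro ω
    by_cases hω : ω ∈ univ.pi s
    · rw [indicator_of_mem hω]
      exact Finset.prod_congr rfl fun i _ => (indicator_of_mem (hω i (mem_univ i)) _).symm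
    · rw [indicator_of_notMem hω]
      obtain ⟨i, hi⟩ : ∃ i, ω i ∉ s i := by simpa [Set.mem_pi] using hω
      exact (Finset.prod_eq_zero (Finset.mem_univ i) (indicator_of_notMem hi _)).symm
  simp_rw [h]
  rw [lintegral_pi_prod μ Finset.univ fun i => (hr i).indicator (hs i)]
  exact Finset.prod_congr rfl fun i _ => by
    rw [lintegral_indicator (hs i), withDensity_apply _ (hs i)]

variable {D : Measure ℝ} [IsProbabilityMeasure D]

/-- Events that depend on disjoint sets of coordinates are independent. -/
theorem pi_real_inter_eq_mul [DecidableEq ι] (U : Finset ι) {X Y : Set (ι → ℝ)}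
    (hX : MeasurableSet X) (hY : MeasurableSet Y)
    (hXU : ∀ ξ ξ' : ι → ℝ, (∀ i ∈ U, ξ i = ξ' i) → ξ ∈ X → ξ' ∈ X)
    (hYU : ∀ ξ ξ' : ι → ℝ, (∀ i ∉ U, ξ i = ξ' i) → ξ ∈ Y → ξ' ∈ Y) :
    (Measure.pi fun _ : ι => D).real (X ∩ Y) =
      (Measure.pi fun _ : ι => D).real X * (Measure.pi fun _ : ι => D).real Y := by
  set P := Measure.pi fun _ : ι => D
  have hind : iIndepFun (fun i (ξ : ι → ℝ) => ξ i) P :=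
    iIndepFun_pi (X := fun _ (x : ℝ) => x) fun _ => aemeasurable_id
  have h := hind.indepFun_finset U Uᶜ disjoint_compl_right fun i => measurable_pi_apply i
  let extend (V : Finset ι) (y : V → ℝ) : ι → ℝ := fun i => if h : i ∈ V then y ⟨i, h⟩ else 0
  have hext : ∀ V, Measurable (extend V) := fun V => measurable_pi_lambda _ fun i => by
    by_cases h : i ∈ V <;> simp only [extend, h, dite_true, dite_false] <;> fun_prop
  have hX' : X = (fun ξ (i : U) => ξ i) ⁻¹' (extend U ⁻¹' X) := by
    ext ξ
    constructor <;> refine hXU _ _ fun i hi => ?_ <;> simp [extend, hi]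
  have hY' : Y = (fun ξ (i : (Uᶜ : Finset ι)) => ξ i) ⁻¹' (extend Uᶜ ⁻¹' Y) := by
    ext ξ
    constructor <;> refine hYU _ _ fun i hi => ?_ <;> simp [extend, hi]
  have := h.measure_inter_preimage_eq_mul (extend U ⁻¹' X) (extend Uᶜ ⁻¹' Y)
    (hext _ hX) (hext _ hY)
  rw [← hX', ← hY'] at this
  simp only [Measure.real, this, ENNReal.toReal_mul]

theorem pi_real_eval_preimage (i : ι) {s : Set ℝ} (hs : MeasurableSet s) :
    (Measure.pi fun _ : ι => D).real {ξ | ξ i ∈ s} = D.real s :=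
  (measurePreserving_eval (fun _ : ι => D) i).measureReal_preimage hs.nullMeasurableSet

theorem pi_real_forall_le_le (G : Finset ι) (M : ℝ) :
    (Measure.pi fun _ : ι => D).real {ξ | ∀ i ∈ G, ξ i ≤ M} ≤
      Real.exp (-(D.real (Ioi M) * G.card)) := by
  classical
  have h : {ξ : ι → ℝ | ∀ i ∈ G, ξ i ≤ M} = univ.pi fun i => if i ∈ G then Iic M else univ := by
    ext ξ
    simp only [mem_ofPred_eq, mem_univ_pi]
    refine forall_congr' fun i => ?_
    by_cases hi : i ∈ G <;> simp [hi]
  rw [h, Measure.real, Measure.pi_pi, ENNReal.toReal_prod]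
  have h2 : ∀ i, (D (if i ∈ G then Iic M else univ)).toReal =
      if i ∈ G then D.real (Iic M) else 1 := by
    intro i; by_cases hi : i ∈ G <;> simp [hi, Measure.real]
  simp_rw [h2]
  rw [Finset.prod_ite_mem, Finset.univ_inter, Finset.prod_const, mul_comm, ← mul_neg,
    Real.exp_nat_mul]
  refine pow_le_pow_left₀ measureReal_nonneg ?_ _
  have h3 := probReal_compl_eq_one_sub (μ := D) (measurableSet_Ioi (a := M))
  rw [compl_Ioi] at h3
  rw [h3]
  exact Real.one_sub_le_exp_neg _

theorem pi_real_exists_lt_abs_le (𝒯 : Finset ι) (R : ℝ) :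
    (Measure.pi fun _ : ι => D).real {ξ | ∃ i ∈ 𝒯, R < |ξ i|} ≤
      𝒯.card * D.real {x | R < |x|} := by
  have h : {ξ : ι → ℝ | ∃ i ∈ 𝒯, R < |ξ i|} = ⋃ i ∈ 𝒯, {ξ | ξ i ∈ {x | R < |x|}} := by
    ext ξ; simp
  rw [h]
  refine (measureReal_biUnion_finset_le _ _).trans ?_
  rw [← nsmul_eq_mul]
  refine Finset.sum_le_card_nsmul _ _ _ fun i _ => (pi_real_eval_preimage i ?_).le
  exact measurableSet_lt measurable_const measurable_id.abs

/-- Truncation of a real number to `[-R, R]`. -/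
noncomputable def clamp (R x : ℝ) : ℝ := max (-R) (min x R)

theorem clamp_of_abs_le {R x : ℝ} (h : |x| ≤ R) : clamp R x = x := by
  rw [abs_le] at h
  rw [clamp, min_eq_left h.2, max_eq_right h.1]

theorem clamp_mem_Icc {R : ℝ} (hR : 0 ≤ R) (x : ℝ) : clamp R x ∈ Icc (-R) R :=
  ⟨le_max_left _ _, max_le (by linarith) (min_le_right _ _)⟩

theorem measurable_clamp (R : ℝ) : Measurable (clamp R) :=
  measurable_const.max (measurable_id.min measurable_const)

/-- Where truncation acts, the error is at most `|x|` and `|x| > R`. Integrated, this shows that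
truncation moves the mean by at most the second moment over `R`. -/
theorem abs_clamp_sub_le {R : ℝ} (hR : 0 < R) (x : ℝ) : |clamp R x - x| ≤ x ^ 2 / R := by
  rcases le_or_gt |x| R with h | h
  · rw [clamp_of_abs_le h, sub_self, abs_zero]; positivity
  · have h1 : |clamp R x - x| ≤ |x| := by
      unfold clamp
      rcases le_total 0 x with h0 | h0
      · rw [abs_of_nonneg h0] at h
        rw [min_eq_right h.le, max_eq_right (by linarith), abs_of_nonneg h0,
          abs_of_nonpos (by linarith)]
        linarith
      · rw [abs_of_nonpos h0] at h
        rw [min_eq_left (by linarith), max_eq_left (by linarith), abs_of_nonpos h0,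
          abs_of_nonneg (by linarith)]
        linarith
    rw [le_div_iff₀ hR]
    calc _ ≤ |x| * |x| := mul_le_mul h1 h.le hR.le (abs_nonneg _)
      _ = x ^ 2 := by rw [abs_mul_abs_self, sq]

theorem abs_integral_clamp_sub_le {R : ℝ} (hR : 0 < R) (h1 : Integrable (fun x : ℝ => x) D)
    (h2 : Integrable (fun x : ℝ => x ^ 2) D) :
    |∫ x, clamp R x ∂D - ∫ x, x ∂D| ≤ (∫ x, x ^ 2 ∂D) / R := by
  have hc : Integrable (clamp R) D := Integrable.of_mem_Icc (-R) R
    (measurable_clamp R).aemeasurable (ae_of_all _ (clamp_mem_Icc hR.le))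
  rw [← integral_sub hc h1, ← integral_div]
  refine abs_integral_le_integral_abs.trans ?_
  exact integral_mono (hc.sub h1).abs (h2.div_const R) fun x => abs_clamp_sub_le hR x

/-- Hoeffding's inequality for weighted sums of truncated independent copies. -/
theorem pi_real_lt_abs_sum_clamp_le {R W t : ℝ} (hR : 0 ≤ R) (ht : 0 ≤ t)
    (G : Finset ι) {w : ι → ℝ} (hw : ∀ i ∈ G, |w i| ≤ W) :
    (Measure.pi fun _ : ι => D).real
      {ξ | t ≤ |∑ i ∈ G, w i * (clamp R (ξ i) - ∫ x, clamp R x ∂D)|} ≤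
      2 * Real.exp (-t ^ 2 / (2 * (G.card * (W * R) ^ 2))) := by
  set P := Measure.pi fun _ : ι => D
  set μ := ∫ x, clamp R x ∂D with hμ
  have hsub : HasSubgaussianMGF (fun x => clamp R x - μ) ((‖R - -R‖₊ / 2) ^ 2) D :=
    hasSubgaussianMGF_of_mem_Icc (measurable_clamp R).aemeasurable
      (ae_of_all _ (clamp_mem_Icc hR))
  have hmeas : Measurable fun x => clamp R x - μ := (measurable_clamp R).sub_const _
  have hP : ∀ (v : ℝ) (i : ι), HasSubgaussianMGF (fun ξ : ι → ℝ => v * (clamp R (ξ i) - μ))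
      (NNReal.mk (v ^ 2) (sq_nonneg v) * (‖R - -R‖₊ / 2) ^ 2) P := fun v i => by
    refine HasSubgaussianMGF.const_mul ?_ v
    refine HasSubgaussianMGF.of_map (X := fun x => clamp R x - μ) (Y := fun ξ : ι → ℝ => ξ i)
      (measurable_pi_apply i).aemeasurable ?_
    rw [(measurePreserving_eval (fun _ : ι => D) i).map_eq]
    exact hsub
  have hind : ∀ v : ι → ℝ, iIndepFun (fun i (ξ : ι → ℝ) => v i * (clamp R (ξ i) - μ)) P :=
    fun v => iIndepFun_pi (X := fun i x => v i * (clamp R x - μ))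
      fun i => (hmeas.const_mul _).aemeasurable
  have hone : ∀ v : ι → ℝ, (∀ i ∈ G, |v i| ≤ W) →
      P.real {ξ | t ≤ ∑ i ∈ G, v i * (clamp R (ξ i) - μ)} ≤
        Real.exp (-t ^ 2 / (2 * (G.card * (W * R) ^ 2))) := by
    intro v hv
    -- The individual variance proxies `v i ^ 2 * R ^ 2` are enlarged to the common value `(W * R) ^
    -- 2`.
    have hc : ∀ i ∈ G, HasSubgaussianMGF (fun ξ : ι → ℝ => v i * (clamp R (ξ i) - μ))
        (Real.toNNReal ((W * R) ^ 2)) P := fun i hi => by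
      have hm := (hP (v i) i)
      refine ⟨hm.integrable_exp_mul, fun s => (hm.mgf_le s).trans (Real.exp_le_exp.2 ?_)⟩
      have e : ((NNReal.mk (v i ^ 2) (sq_nonneg (v i)) * (‖R - -R‖₊ / 2) ^ 2 : ℝ≥0) : ℝ) =
          v i ^ 2 * R ^ 2 := by
        have e0 : ((‖R - -R‖₊ : ℝ≥0) : ℝ) = 2 * R := by
          rw [coe_nnnorm, Real.norm_eq_abs, abs_of_nonneg (by linarith)]; ring
        rw [NNReal.coe_mul, NNReal.coe_pow, NNReal.coe_div, e0, NNReal.coe_ofNat,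
          NNReal.coe_mk]
        ring
      rw [e, Real.coe_toNNReal _ (by positivity)]
      have : v i ^ 2 ≤ W ^ 2 := sq_le_sq' (by linarith [(abs_le.1 (hv i hi)).1])
        (abs_le.1 (hv i hi)).2
      have h2 : v i ^ 2 * R ^ 2 ≤ (W * R) ^ 2 := by
        rw [mul_pow]; exact mul_le_mul_of_nonneg_right this (sq_nonneg R)
      have := mul_le_mul_of_nonneg_right h2 (sq_nonneg s)
      linarith
    have := HasSubgaussianMGF.measure_sum_ge_le_of_iIndepFun (hind v) hc ht
    simpa [Real.coe_toNNReal _ (sq_nonneg (W * R))] using this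
  have hsplit : {ξ : ι → ℝ | t ≤ |∑ i ∈ G, w i * (clamp R (ξ i) - μ)|} ⊆
      {ξ | t ≤ ∑ i ∈ G, w i * (clamp R (ξ i) - μ)} ∪
      {ξ | t ≤ ∑ i ∈ G, (-w i) * (clamp R (ξ i) - μ)} := by
    intro ξ hξ
    rcases le_abs.1 (mem_ofPred_eq ▸ hξ) with h | h
    · exact Or.inl h
    · right
      simpa only [mem_ofPred_eq, neg_mul, Finset.sum_neg_distrib] using h
  have h1 := hone w hw
  have h2 := hone (fun i => -w i) fun i hi => by rw [abs_neg]; exact hw i hi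
  calc _ ≤ _ := measureReal_mono hsplit
    _ ≤ _ := measureReal_union_le _ _
    _ ≤ _ := by linarith

end ProductMeasures

/-! ### The raising coupling for one multiplier. -/

section Coupling

open ProbabilityTheory
open scoped ENNReal NNReal

/-- Replace the first coordinate, if it is at most `a`, by the second one, if that is at least
`a + 1`; the original first coordinate is kept for comparison. -/
noncomputable def raise (a : ℝ) (p : ℝ × ℝ) : ℝ × ℝ :=
  open Classical in (p.1, if p.1 ≤ a ∧ a + 1 ≤ p.2 then p.2 else p.1)

/-- The law of a pair `(x, x')`, where `x` has law `D` and `x'` arises from `x` by an independent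
attempt, made with probability `ρ`, to raise a value below `a` to a value above `a + 1`. -/
noncomputable def raiseCoupling (D : Measure ℝ) (a ρ : ℝ) : Measure (ℝ × ℝ) :=
  ENNReal.ofReal (1 - ρ) • D.map (fun x => (x, x)) +
    ENNReal.ofReal ρ • (D.prod D).map (raise a)

/-- The first order term of the density of a raised variable. -/
noncomputable def raiseScore (D : Measure ℝ) (a x : ℝ) : ℝ :=
  (Ici (a + 1)).indicator (fun _ => D.real (Iic a)) x -
    (Iic a).indicator (fun _ => D.real (Ici (a + 1))) x

variable (D : Measure ℝ) (a : ℝ) {ρ : ℝ}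

theorem measurable_raise : Measurable (raise a) := by
  unfold raise
  refine measurable_fst.prodMk (Measurable.ite ?_ measurable_snd measurable_fst)
  exact (measurableSet_le measurable_fst measurable_const).inter
    (measurableSet_le measurable_const measurable_snd)

theorem lintegral_raiseCoupling {F : ℝ × ℝ → ℝ≥0∞} (hF : Measurable F) :
    ∫⁻ p, F p ∂raiseCoupling D a ρ = ENNReal.ofReal (1 - ρ) * ∫⁻ x, F (x, x) ∂D +
      ENNReal.ofReal ρ * ∫⁻ p, F (raise a p) ∂D.prod D := by
  rw [raiseCoupling, lintegral_add_measure, lintegral_smul_measure, lintegral_smul_measure,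
    lintegral_map hF (by fun_prop), lintegral_map hF (measurable_raise a), smul_eq_mul, smul_eq_mul]

theorem raiseCoupling_apply {s : Set (ℝ × ℝ)} (hs : MeasurableSet s) :
    raiseCoupling D a ρ s = ENNReal.ofReal (1 - ρ) * D {x | (x, x) ∈ s} +
      ENNReal.ofReal ρ * (D.prod D) {p | raise a p ∈ s} := by
  rw [raiseCoupling, Measure.add_apply, Measure.smul_apply, Measure.smul_apply,
    Measure.map_apply (by fun_prop) hs, Measure.map_apply (measurable_raise a) hs]
  rfl

theorem measurable_raiseScore : Measurable (raiseScore D a) := by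
  unfold raiseScore
  exact (measurable_const.indicator measurableSet_Ici).sub
    (measurable_const.indicator measurableSet_Iic)

theorem ofReal_one_sub_add_ofReal (h0 : 0 ≤ ρ) (h1 : ρ ≤ 1) :
    ENNReal.ofReal (1 - ρ) + ENNReal.ofReal ρ = 1 := by
  rw [← ENNReal.ofReal_add (by linarith) h0]; simp

theorem raise_fst_le_snd (p : ℝ × ℝ) : (raise a p).1 ≤ (raise a p).2 := by
  classical
  by_cases h : p.1 ≤ a ∧ a + 1 ≤ p.2
  · simp only [raise, h, and_self, if_true]; linarith [h.1, h.2]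
  · simp only [raise, h, if_false]; exact le_rfl

theorem ae_fst_le_snd_raiseCoupling : ∀ᵐ p ∂raiseCoupling D a ρ, p.1 ≤ p.2 := by
  have hm : MeasurableSet {p : ℝ × ℝ | ¬ p.1 ≤ p.2} :=
    (measurableSet_le measurable_fst measurable_snd).compl
  rw [ae_iff, raiseCoupling_apply D a hm]
  simp [not_lt.2 (raise_fst_le_snd a _)]

variable [IsProbabilityMeasure D]

theorem isProbabilityMeasure_raiseCoupling (h0 : 0 ≤ ρ) (h1 : ρ ≤ 1) :
    IsProbabilityMeasure (raiseCoupling D a ρ) := by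
  constructor
  rw [raiseCoupling_apply D a MeasurableSet.univ]
  simp only [mem_univ, ofPred_true, measure_univ, mul_one]
  exact ofReal_one_sub_add_ofReal h0 h1

theorem map_fst_raiseCoupling (h0 : 0 ≤ ρ) (h1 : ρ ≤ 1) :
    (raiseCoupling D a ρ).map Prod.fst = D := by
  ext s hs
  rw [Measure.map_apply measurable_fst hs, raiseCoupling_apply D a (measurable_fst hs)]
  have e : {p : ℝ × ℝ | raise a p ∈ Prod.fst ⁻¹' s} = s ×ˢ univ := by
    ext p; simp [raise]
  rw [e, Measure.prod_prod, measure_univ, mul_one]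
  change ENNReal.ofReal (1 - ρ) * D s + _ = _
  rw [← add_mul, ofReal_one_sub_add_ofReal h0 h1, one_mul]

/-- A successful raise has probability `ρ * q` and gains at least `1`, and `exp (-1) < 1 / 2`.
Multiplied over coordinates, this gives a Chernoff bound against a small total increase. -/
theorem lintegral_exp_sub_raiseCoupling_le (h0 : 0 ≤ ρ) (h1 : ρ ≤ 1) :
    ∫⁻ p, ENNReal.ofReal (Real.exp (-(p.2 - p.1))) ∂raiseCoupling D a ρ ≤
      ENNReal.ofReal (Real.exp (-(ρ * (D.real (Iic a) * D.real (Ici (a + 1)))) / 2)) := by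
  set q := D.real (Iic a) * D.real (Ici (a + 1)) with hq
  have hq0 : 0 ≤ q := by positivity
  rw [lintegral_raiseCoupling D a (by fun_prop)]
  simp only [sub_self, neg_zero, Real.exp_zero, ENNReal.ofReal_one, lintegral_one, measure_univ,
    mul_one]
  have hS : MeasurableSet (Iic a ×ˢ Ici (a + 1) : Set (ℝ × ℝ)) :=
    measurableSet_Iic.prod measurableSet_Ici
  have hle : ∀ p : ℝ × ℝ, ENNReal.ofReal (Real.exp (-((raise a p).2 - (raise a p).1))) ≤
      ENNReal.ofReal (1 - (Iic a ×ˢ Ici (a + 1)).indicator (fun _ => (1 / 2 : ℝ)) p) := by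
    intro p
    refine ENNReal.ofReal_le_ofReal ?_
    by_cases hp : p ∈ Iic a ×ˢ Ici (a + 1)
    · rw [indicator_of_mem hp]
      have hp' : p.1 ≤ a ∧ a + 1 ≤ p.2 := hp
      simp only [raise, hp', and_self, if_true]
      calc Real.exp (-(p.2 - p.1)) ≤ Real.exp (-1) := Real.exp_le_exp.2 (by linarith [hp'.1, hp'.2])
        _ ≤ 1 - 1 / 2 := by linarith [Real.exp_neg_one_lt_half]
    · rw [indicator_of_notMem hp, sub_zero, Real.exp_le_one_iff, neg_nonpos, sub_nonneg]
      exact raise_fst_le_snd a p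
  have hint : Integrable ((Iic a ×ˢ Ici (a + 1)).indicator fun _ : ℝ × ℝ => (1 / 2 : ℝ))
      (D.prod D) := (integrable_const _).indicator hS
  have hprod : (D.prod D).real (Iic a ×ˢ Ici (a + 1)) = q := by
    rw [measureReal_prod_prod]
  have h2 : ∫⁻ p, ENNReal.ofReal (1 - (Iic a ×ˢ Ici (a + 1)).indicator (fun _ => (1 / 2 : ℝ)) p)
      ∂D.prod D = ENNReal.ofReal (1 - q / 2) := by
    rw [← ofReal_integral_eq_lintegral_ofReal (f := fun p => 1 - (Iic a ×ˢ Ici (a + 1)).indicator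
      (fun _ => (1 / 2 : ℝ)) p) ((integrable_const _).sub hint)]
    · rw [integral_sub (integrable_const _) hint, integral_indicator hS, setIntegral_const, hprod]
      simp [div_eq_mul_inv]
    · refine ae_of_all _ fun p => ?_
      by_cases hp : p ∈ Iic a ×ˢ Ici (a + 1)
      · simp only [indicator_of_mem hp]; norm_num
      · simp only [indicator_of_notMem hp]; norm_num
  have hq1 : q ≤ 1 := mul_le_one₀ measureReal_le_one measureReal_nonneg measureReal_le_one
  calc _ ≤ ENNReal.ofReal (1 - ρ) + ENNReal.ofReal ρ * ENNReal.ofReal (1 - q / 2) := by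
        rw [← h2]
        exact add_le_add le_rfl (mul_le_mul_right (lintegral_mono hle) _)
    _ = ENNReal.ofReal (1 - ρ * q / 2) := by
        rw [← ENNReal.ofReal_mul h0, ← ENNReal.ofReal_add (by linarith)
          (mul_nonneg h0 (by linarith))]
        congr 1; ring
    _ ≤ _ := by
        refine ENNReal.ofReal_le_ofReal ?_
        have := Real.one_sub_le_exp_neg (ρ * q / 2)
        rwa [← neg_div] at this

theorem raiseScore_mem_Icc (x : ℝ) : raiseScore D a x ∈ Icc (-1) 1 := by
  have h1 : D.real (Iic a) ≤ 1 := measureReal_le_one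
  have h2 : D.real (Ici (a + 1)) ≤ 1 := measureReal_le_one
  have h3 : 0 ≤ D.real (Iic a) := measureReal_nonneg
  have h4 : 0 ≤ D.real (Ici (a + 1)) := measureReal_nonneg
  unfold raiseScore
  by_cases hx : x ∈ Ici (a + 1) <;> by_cases hx' : x ∈ Iic a <;>
    simp only [hx, hx', indicator_of_mem, indicator_of_notMem, not_false_eq_true, mem_Icc] <;>
    constructor <;> linarith

theorem setIntegral_raiseScore (s : Set ℝ) :
    ∫ x in s, raiseScore D a x ∂D = D.real (s ∩ Ici (a + 1)) * D.real (Iic a) -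
      D.real (s ∩ Iic a) * D.real (Ici (a + 1)) := by
  unfold raiseScore
  rw [integral_sub ((integrable_const _).indicator measurableSet_Ici)
    ((integrable_const _).indicator measurableSet_Iic), setIntegral_indicator measurableSet_Ici,
    setIntegral_indicator measurableSet_Iic, setIntegral_const, setIntegral_const, smul_eq_mul,
    smul_eq_mul]

theorem integrable_raiseScore : Integrable (raiseScore D a) D :=
  Integrable.of_mem_Icc (-1) 1 (measurable_raiseScore D a).aemeasurable
    (ae_of_all _ (raiseScore_mem_Icc D a))

/-- A successful raise takes mass from `Iic a`, in proportion to the mass of `Ici (a + 1)`, and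
returns it distributed as `D` on `Ici (a + 1)`; the balance is the integral of the score. -/
theorem prod_real_raise_snd {s : Set ℝ} (hs : MeasurableSet s) :
    (D.prod D).real {p | (raise a p).2 ∈ s} = D.real s + ∫ x in s, raiseScore D a x ∂D := by
  have e : {p : ℝ × ℝ | (raise a p).2 ∈ s} =
      ((s ×ˢ univ) \ ((s ∩ Iic a) ×ˢ Ici (a + 1))) ∪ (Iic a ×ˢ (s ∩ Ici (a + 1))) := by
    ext p
    by_cases h : p.1 ≤ a ∧ a + 1 ≤ p.2
    · simp [raise, h]
    · simp only [raise, h, if_false, mem_ofPred_eq, mem_union, mem_sdiff, mem_prod, mem_univ,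
        and_true, mem_inter_iff, mem_Iic, mem_Ici]
      tauto
  rw [e, measureReal_union, measureReal_sdiff, measureReal_prod_prod, measureReal_prod_prod,
    measureReal_prod_prod, setIntegral_raiseScore D a s]
  · simp; ring
  · exact prod_mono inter_subset_left (subset_univ _)
  · exact (hs.inter measurableSet_Iic).prod measurableSet_Ici
  · rw [Set.disjoint_left]
    rintro p ⟨⟨h1, -⟩, h2⟩ ⟨h3, -, h4⟩
    exact h2 ⟨⟨h1, h3⟩, h4⟩
  · exact measurableSet_Iic.prod (hs.inter measurableSet_Ici)

theorem map_snd_raiseCoupling (h0 : 0 ≤ ρ) (h1 : ρ ≤ 1) :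
    (raiseCoupling D a ρ).map Prod.snd =
      D.withDensity fun x => ENNReal.ofReal (1 + ρ * raiseScore D a x) := by
  ext s hs
  rw [Measure.map_apply measurable_snd hs, raiseCoupling_apply D a (measurable_snd hs),
    withDensity_apply _ hs, ← ofReal_integral_eq_lintegral_ofReal]
  · rw [integral_add (integrable_const _) ((integrable_raiseScore D a).integrableOn.const_mul ρ),
      setIntegral_const, integral_const_mul, smul_eq_mul, mul_one]
    have h2 := prod_real_raise_snd D a hs
    have h3 : ENNReal.ofReal (D.real s) = D s := ofReal_measureReal
    have h4 : ENNReal.ofReal ((D.prod D).real {p | (raise a p).2 ∈ s}) =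
      (D.prod D) {p | raise a p ∈ Prod.snd ⁻¹' s} := ofReal_measureReal
    change ENNReal.ofReal (1 - ρ) * D s + _ = _
    rw [← h3, ← h4, ← ENNReal.ofReal_mul (by linarith), ← ENNReal.ofReal_mul h0,
      ← ENNReal.ofReal_add (mul_nonneg (by linarith) measureReal_nonneg)
        (mul_nonneg h0 measureReal_nonneg), h2]
    congr 1
    ring
  · exact (integrable_const _).add ((integrable_raiseScore D a).integrableOn.const_mul ρ)
  · refine ae_of_all _ fun x => ?_
    have := (raiseScore_mem_Icc D a x).1
    change 0 ≤ 1 + ρ * raiseScore D a x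
    nlinarith

/-- Raising only moves mass, so the score has mean zero; it lies in `[-1, 1]`, and Hoeffding's lemma
applies. With no first order term, changing `m` coordinates costs order `ρ ^ 2 * m` while the gain
is of order `ρ * m`. -/
theorem lintegral_exp_raiseScore_le (t : ℝ) :
    ∫⁻ x, ENNReal.ofReal (Real.exp (t * raiseScore D a x)) ∂D ≤
      ENNReal.ofReal (Real.exp (t ^ 2 / 2)) := by
  have hsub := hasSubgaussianMGF_of_mem_Icc_of_integral_eq_zero (μ := D)
    (measurable_raiseScore D a).aemeasurable (ae_of_all _ (raiseScore_mem_Icc D a)) (by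
      rw [← setIntegral_univ, setIntegral_raiseScore D a univ]
      simp [mul_comm])
  rw [← ofReal_integral_eq_lintegral_ofReal (hsub.integrable_exp_mul t)
    (ae_of_all _ fun x => (Real.exp_pos _).le)]
  refine ENNReal.ofReal_le_ofReal ((hsub.mgf_le t).trans (Real.exp_le_exp.2 ?_))
  have e0 : ((‖(1 : ℝ) - -1‖₊ : ℝ≥0) : ℝ) = 2 := by
    rw [coe_nnnorm, Real.norm_eq_abs, abs_of_nonneg (by norm_num)]; norm_num
  rw [NNReal.coe_pow, NNReal.coe_div, e0, NNReal.coe_ofNat]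
  norm_num

end Coupling

/-! ### Comparing probabilities before and after raising many coordinates. -/

section CouplingComparison

open ProbabilityTheory
open scoped ENNReal NNReal

variable {ι : Type*} [Fintype ι] {D : Measure ℝ} [IsProbabilityMeasure D]

/-- Truncation of a density `exp y`: it is at most `e` when `y ≤ 1`, and for `y ≥ 1` it is
controlled by a higher exponential moment with the small prefactor `exp (-l)`. -/
theorem exp_le_exp_one_add (l y : ℝ) (hl : 0 ≤ l) :
    Real.exp y ≤ Real.exp 1 + Real.exp (-l) * Real.exp ((1 + l) * y) := by
  rcases le_total y 1 with h | h
  · have h1 := Real.exp_le_exp.2 h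
    have h2 : 0 < Real.exp (-l) * Real.exp ((1 + l) * y) := by positivity
    linarith
  · have h1 : Real.exp y ≤ Real.exp (-l) * Real.exp ((1 + l) * y) := by
      rw [← Real.exp_add]
      exact Real.exp_le_exp.2 (by nlinarith)
    linarith [Real.exp_pos 1]

/-- Raising the coordinates in `G` increases probabilities by a bounded factor only. -/
theorem pi_withDensity_raiseScore_le [DecidableEq ι] (a : ℝ) {ρ l : ℝ} (hl : 0 ≤ l)
    (G : Finset ι) {Y : Set (ι → ℝ)} (hY : MeasurableSet Y) :
    ((Measure.pi fun _ : ι => D).withDensity fun ξ =>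
      ∏ i, if i ∈ G then ENNReal.ofReal (1 + ρ * raiseScore D a (ξ i)) else 1) Y ≤
    ENNReal.ofReal (Real.exp 1 * (Measure.pi fun _ : ι => D).real Y +
      Real.exp (((1 + l) * ρ) ^ 2 / 2 * G.card - l)) := by
  set P := Measure.pi fun _ : ι => D
  have hs := measurable_raiseScore D a
  have hprod : ∀ ξ : ι → ℝ,
      (∏ i, if i ∈ G then ENNReal.ofReal (1 + ρ * raiseScore D a (ξ i)) else 1) ≤
      ENNReal.ofReal (Real.exp 1) + ENNReal.ofReal (Real.exp (-l)) *
        ∏ i ∈ G, ENNReal.ofReal (Real.exp ((1 + l) * ρ * raiseScore D a (ξ i))) := by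
    intro ξ
    rw [Finset.prod_ite_mem, Finset.univ_inter]
    calc _ ≤ ∏ i ∈ G, ENNReal.ofReal (Real.exp (ρ * raiseScore D a (ξ i))) :=
          Finset.prod_le_prod' fun i _ => ENNReal.ofReal_le_ofReal (by
            rw [add_comm]; exact Real.add_one_le_exp _)
      _ = ENNReal.ofReal (Real.exp (∑ i ∈ G, ρ * raiseScore D a (ξ i))) := by
          rw [← ENNReal.ofReal_prod_of_nonneg fun i _ => (Real.exp_pos _).le, Real.exp_sum]
      _ ≤ ENNReal.ofReal (Real.exp 1 + Real.exp (-l) *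
            Real.exp ((1 + l) * ∑ i ∈ G, ρ * raiseScore D a (ξ i))) :=
          ENNReal.ofReal_le_ofReal (exp_le_exp_one_add l _ hl)
      _ = _ := by
          rw [ENNReal.ofReal_add (Real.exp_pos _).le (by positivity),
            ENNReal.ofReal_mul (Real.exp_pos _).le, Finset.mul_sum, Real.exp_sum,
            ENNReal.ofReal_prod_of_nonneg fun i _ => (Real.exp_pos _).le]
          simp only [mul_assoc]
  have hmeas : Measurable fun x => ENNReal.ofReal (Real.exp ((1 + l) * ρ * raiseScore D a x)) := by
    fun_prop
  rw [withDensity_apply _ hY]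
  calc _ ≤ ∫⁻ ξ in Y, (ENNReal.ofReal (Real.exp 1) + ENNReal.ofReal (Real.exp (-l)) *
        ∏ i ∈ G, ENNReal.ofReal (Real.exp ((1 + l) * ρ * raiseScore D a (ξ i)))) ∂P :=
        lintegral_mono hprod
    _ = ENNReal.ofReal (Real.exp 1) * P Y + ENNReal.ofReal (Real.exp (-l)) *
        ∫⁻ ξ in Y, ∏ i ∈ G, ENNReal.ofReal (Real.exp ((1 + l) * ρ * raiseScore D a (ξ i))) ∂P := by
        rw [lintegral_add_left measurable_const, setLIntegral_const, lintegral_const_mul']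
        exact ENNReal.ofReal_ne_top
    _ ≤ ENNReal.ofReal (Real.exp 1) * P Y + ENNReal.ofReal (Real.exp (-l)) *
        ENNReal.ofReal (Real.exp (((1 + l) * ρ) ^ 2 / 2 * G.card)) := by
        gcongr
        refine (setLIntegral_le_lintegral _ _).trans ?_
        rw [lintegral_pi_prod (fun _ => D) G fun _ => hmeas, Finset.prod_const,
          mul_comm (((1 + l) * ρ) ^ 2 / 2), Real.exp_nat_mul, ENNReal.ofReal_pow (Real.exp_pos _).le]
        exact pow_le_pow_left₀ zero_le (lintegral_exp_raiseScore_le D a _) _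
    _ = _ := by
        have h : ENNReal.ofReal (P.real Y) = P Y := ofReal_measureReal
        rw [← h, ← ENNReal.ofReal_mul (Real.exp_pos _).le, ← ENNReal.ofReal_mul (Real.exp_pos _).le,
          ← ENNReal.ofReal_add (by positivity) (by positivity), ← Real.exp_add]
        congr 3
        ring

/-- If raising the coordinates in `G` leads from `X` to `Y`, except when for some `B` the total
increase over `H B` is at most `t`, then `X` is not much more likely than `Y`. -/
theorem pi_real_le_of_raise {β : Type*} (a : ℝ) {ρ l t : ℝ} (hρ0 : 0 ≤ ρ) (hρ1 : ρ ≤ 1)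
    (hl : 0 ≤ l) (G : Finset ι) (ℬ : Finset β) (H : β → Finset ι) {h : ℝ}
    (hH : ∀ B ∈ ℬ, h ≤ (H B).card) (hHG : ∀ B ∈ ℬ, H B ⊆ G)
    {X Y : Set (ι → ℝ)} (hX : MeasurableSet X) (hY : MeasurableSet Y)
    (hXY : ∀ ξ ξ' : ι → ℝ, (∀ i, ξ i ≤ ξ' i) → (∀ i ∉ G, ξ' i = ξ i) → ξ ∈ X →
      (∀ B ∈ ℬ, t < ∑ i ∈ H B, (ξ' i - ξ i)) → ξ' ∈ Y) :
    (Measure.pi fun _ : ι => D).real X ≤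
      Real.exp 1 * (Measure.pi fun _ : ι => D).real Y +
      Real.exp (((1 + l) * ρ) ^ 2 / 2 * G.card - l) +
      ℬ.card * Real.exp (t - ρ * (D.real (Iic a) * D.real (Ici (a + 1))) / 2 * h) := by
  classical
  set P := Measure.pi fun _ : ι => D
  set κ := raiseCoupling D a ρ
  set q := ρ * (D.real (Iic a) * D.real (Ici (a + 1)))
  have hq : 0 ≤ q := by positivity
  have : IsProbabilityMeasure κ := isProbabilityMeasure_raiseCoupling D a hρ0 hρ1
  set Q := Measure.pi fun _ : ι => κ
  let p₁ : (ι → ℝ × ℝ) → ι → ℝ := fun ω i => (ω i).1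
  -- Only coordinates in `G` are raised; the others are shared by both noise vectors.
  let p₂ : (ι → ℝ × ℝ) → ι → ℝ := fun ω i => if i ∈ G then (ω i).2 else (ω i).1
  have hp₁ : Measurable p₁ := by fun_prop
  have hp₂ : Measurable p₂ := measurable_pi_lambda _ fun i => by
    by_cases hi : i ∈ G <;> simp only [p₂, hi, if_true, if_false] <;> fun_prop
  have hfst : κ.map Prod.fst = D := map_fst_raiseCoupling D a hρ0 hρ1
  have hsnd : κ.map Prod.snd = D.withDensity fun x => ENNReal.ofReal (1 + ρ * raiseScore D a x) :=
    map_snd_raiseCoupling D a hρ0 hρ1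
  have hmap₁ : Q.map p₁ = P := by
    have : ∀ i : ι, SigmaFinite (κ.map Prod.fst) := fun i => by rw [hfst]; infer_instance
    have := Measure.pi_map_pi (μ := fun _ : ι => κ) (f := fun _ => Prod.fst)
      fun _ => measurable_fst.aemeasurable
    simp only [hfst] at this
    exact this
  have hmap₂ : Q.map p₂ = P.withDensity fun ξ =>
      ∏ i, if i ∈ G then ENNReal.ofReal (1 + ρ * raiseScore D a (ξ i)) else 1 := by
    let F : ι → ℝ × ℝ → ℝ := fun i => if i ∈ G then Prod.snd else Prod.fst
    let r : ι → ℝ → ℝ≥0∞ := fun i x =>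
      if i ∈ G then ENNReal.ofReal (1 + ρ * raiseScore D a x) else 1
    have hF : ∀ i, Measurable (F i) := fun i => by
      by_cases hi : i ∈ G <;> simp only [F, hi, if_true, if_false] <;> fun_prop
    have hr : ∀ i, Measurable (r i) := fun i => by
      have := measurable_raiseScore D a
      by_cases hi : i ∈ G <;> simp only [r, hi, if_true, if_false] <;> fun_prop
    have hFr : ∀ i, κ.map (F i) = D.withDensity (r i) := fun i => by
      by_cases hi : i ∈ G
      · simp only [F, r, hi, if_true, hsnd]
      · simp only [F, r, hi, if_false, hfst]
        exact withDensity_one.symm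
    have hprob : ∀ i, IsProbabilityMeasure (κ.map (F i)) := fun i =>
      Measure.isProbabilityMeasure_map (hF i).aemeasurable
    have hprob' : ∀ i, IsProbabilityMeasure (D.withDensity (r i)) := fun i => hFr i ▸ hprob i
    have h1 := Measure.pi_map_pi (μ := fun _ : ι => κ) (f := F) fun i => (hF i).aemeasurable
    have h2 := pi_withDensity (fun _ : ι => D) hr
    simp only [hFr] at h1
    rw [h2] at h1
    rw [← h1]
    congr 1
    ext ω i
    by_cases hi : i ∈ G <;> simp only [p₂, F, hi, if_true, if_false]
  have hmono : ∀ᵐ ω ∂Q, ∀ i, (ω i).1 ≤ (ω i).2 := by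
    rw [ae_all_iff]
    intro i
    exact (Measure.quasiMeasurePreserving_eval (fun _ : ι => κ) i).ae
      (ae_fst_le_snd_raiseCoupling D a)
  have hfew : ∀ B ∈ ℬ, Q {ω | ∑ i ∈ H B, ((ω i).2 - (ω i).1) ≤ t} ≤
      ENNReal.ofReal (Real.exp (t - q / 2 * h)) := by
    intro B hB
    set Φ : ℝ × ℝ → ℝ≥0∞ := fun p => ENNReal.ofReal (Real.exp (-(p.2 - p.1))) with hΦ
    have hΦm : Measurable Φ := by fun_prop
    have hprodle : ∫⁻ ω, ∏ i ∈ H B, Φ (ω i) ∂Q ≤ ENNReal.ofReal (Real.exp (-(q / 2 * h))) := by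
      rw [lintegral_pi_prod (fun _ => κ) (H B) fun _ => hΦm, Finset.prod_const]
      calc _ ≤ (ENNReal.ofReal (Real.exp (-q / 2))) ^ (H B).card :=
            pow_le_pow_left₀ zero_le (lintegral_exp_sub_raiseCoupling_le D a hρ0 hρ1) _
        _ = ENNReal.ofReal (Real.exp ((H B).card * (-q / 2))) := by
            rw [Real.exp_nat_mul, ENNReal.ofReal_pow (Real.exp_pos _).le]
        _ ≤ _ := ENNReal.ofReal_le_ofReal (Real.exp_le_exp.2 (by
            have := mul_le_mul_of_nonneg_left (hH B hB) (by positivity : 0 ≤ q / 2)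
            linarith))
    -- Chernoff: Markov's inequality for the exponential of `t` minus the total increase.
    calc Q {ω | ∑ i ∈ H B, ((ω i).2 - (ω i).1) ≤ t}
        ≤ Q {ω | 1 ≤ ENNReal.ofReal (Real.exp t) * ∏ i ∈ H B, Φ (ω i)} := by
          refine measure_mono fun ω hω => ?_
          rw [mem_ofPred_eq] at hω ⊢
          rw [← ENNReal.ofReal_prod_of_nonneg fun i _ => (Real.exp_pos _).le, ← Real.exp_sum,
            ← ENNReal.ofReal_mul (Real.exp_pos _).le, ← Real.exp_add, ENNReal.one_le_ofReal,
            Real.one_le_exp_iff, Finset.sum_neg_distrib]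
          linarith
      _ ≤ ∫⁻ ω, ENNReal.ofReal (Real.exp t) * ∏ i ∈ H B, Φ (ω i) ∂Q := by
          have := mul_meas_ge_le_lintegral₀ (μ := Q)
            (f := fun ω => ENNReal.ofReal (Real.exp t) * ∏ i ∈ H B, Φ (ω i)) ((Finset.measurable_prod _ fun i _ =>
              hΦm.comp (measurable_pi_apply i)).const_mul _).aemeasurable 1
          rwa [one_mul] at this
      _ = ENNReal.ofReal (Real.exp t) * ∫⁻ ω, ∏ i ∈ H B, Φ (ω i) ∂Q :=
          lintegral_const_mul' _ _ ENNReal.ofReal_ne_top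
      _ ≤ ENNReal.ofReal (Real.exp t) * ENNReal.ofReal (Real.exp (-(q / 2 * h))) := by gcongr
      _ = _ := by
          rw [← ENNReal.ofReal_mul (Real.exp_pos _).le, ← Real.exp_add, sub_eq_add_neg]
  -- An unraised vector in `X` has its raised version in `Y`, unless the increase is too small over
  -- some `H B`.
  have hcover : Q (p₁ ⁻¹' X) ≤ Q ((p₂ ⁻¹' Y) ∪
      ⋃ B ∈ ℬ, {ω | ∑ i ∈ H B, ((ω i).2 - (ω i).1) ≤ t}) := by
    refine measure_mono_ae ?_
    filter_upwards [hmono] with ω hω hωX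
    by_cases hB : ∃ B ∈ ℬ, ∑ i ∈ H B, ((ω i).2 - (ω i).1) ≤ t
    · right
      simpa using hB
    · left
      push Not at hB
      refine hXY (p₁ ω) (p₂ ω) (fun i => ?_) (fun i hi => ?_) hωX fun B hBℬ => ?_
      · by_cases hi : i ∈ G <;> simp only [p₁, p₂, hi, if_true, if_false, le_refl]
        exact hω i
      · simp only [p₁, p₂, hi, if_false]
      · refine (hB B hBℬ).trans_eq (Finset.sum_congr rfl fun i hi => ?_)
        simp only [p₁, p₂, hHG B hBℬ hi, if_true]
  have hfin : P X ≤ ENNReal.ofReal (Real.exp 1 * P.real Y +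
      Real.exp (((1 + l) * ρ) ^ 2 / 2 * G.card - l) + ℬ.card * Real.exp (t - q / 2 * h)) := by
    calc P X = Q (p₁ ⁻¹' X) := by rw [← hmap₁, Measure.map_apply hp₁ hX]
      _ ≤ _ := hcover
      _ ≤ Q (p₂ ⁻¹' Y) + ∑ B ∈ ℬ, Q {ω | ∑ i ∈ H B, ((ω i).2 - (ω i).1) ≤ t} :=
          (measure_union_le _ _).trans (by gcongr; exact measure_biUnion_finset_le _ _)
      _ ≤ ENNReal.ofReal (Real.exp 1 * P.real Y +
            Real.exp (((1 + l) * ρ) ^ 2 / 2 * G.card - l)) +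
          ℬ.card • ENNReal.ofReal (Real.exp (t - q / 2 * h)) := by
          refine add_le_add ?_ (Finset.sum_le_card_nsmul _ _ _ hfew)
          rw [← Measure.map_apply hp₂ hY, hmap₂]
          exact pi_withDensity_raiseScore_le a hl G hY
      _ = _ := by
          rw [nsmul_eq_mul, ← ENNReal.ofReal_natCast, ← ENNReal.ofReal_mul (Nat.cast_nonneg _),
            ← ENNReal.ofReal_add (by positivity) (by positivity)]
  exact ENNReal.toReal_le_of_le_ofReal (by positivity) hfin

end CouplingComparison

/-! ### Selection systems: concentration, near and strict maximizers, spikes. -/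

section Selection

open ProbabilityTheory

/-- Candidates `A ∈ 𝒜`, each with `m` weighted neighbors, such that distinct candidates share few
neighbors, the weights are at most `W`, and some candidate has average weight at least `W - v`. -/
structure SelectionSystem (ι β : Type*) where
  𝒜 : Finset β
  Nb : β → Finset ι
  w : ι → ℝ
  m : ℕ
  W : ℝ
  v : ℝ
  𝒯 : Finset ι
  card_Nb : ∀ A ∈ 𝒜, (Nb A).card = m
  card_inter : ∀ A ∈ 𝒜, ∀ B ∈ 𝒜, A ≠ B → ∀ s : Finset ι, s ⊆ Nb A → s ⊆ Nb B → 4 * s.card ≤ m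
  Nb_subset : ∀ A ∈ 𝒜, Nb A ⊆ 𝒯
  m_pos : 0 < m
  w_nonneg : ∀ T, 0 ≤ w T
  w_le : ∀ A ∈ 𝒜, ∀ T ∈ Nb A, w T ≤ W
  W_pos : 0 < W
  v_nonneg : 0 ≤ v
  v_le : v ≤ W / 8
  exists_le_sum : ∃ A ∈ 𝒜, m * (W - v) ≤ ∑ T ∈ Nb A, w T

namespace SelectionSystem

variable {ι β : Type*} (s : SelectionSystem ι β)

/-- The noisy total weight of the neighbors of `A`. -/
def total (A : β) (ξ : ι → ℝ) : ℝ := ∑ T ∈ s.Nb A, ξ T * s.w T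

/-- Noise vectors for which `A` maximizes the noisy total up to `Δ`. -/
def nearMax (A : β) (Δ : ℝ) : Set (ι → ℝ) := {ξ | ∀ B ∈ s.𝒜, s.total B ξ ≤ s.total A ξ + Δ}

/-- Noise vectors for which `A` is the unique maximizer of the noisy total. -/
def strictMax (A : β) : Set (ι → ℝ) := {ξ | ∀ B ∈ s.𝒜, B ≠ A → s.total B ξ < s.total A ξ}

/-- Noise vectors for which some noisy total is far from its mean. -/
def deviation (μ η : ℝ) : Set (ι → ℝ) :=
  {ξ | ∃ B ∈ s.𝒜, η * μ * s.m * s.W < |s.total B ξ - μ * ∑ T ∈ s.Nb B, s.w T|}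

/-- Noise vectors for which some relevant multiplier exceeds `R` in absolute value. -/
def large (R : ℝ) : Set (ι → ℝ) := {ξ | ∃ T ∈ s.𝒯, R < |ξ T|}

/-- Noise vectors for which a maximizer of the noisy total has a neighbor whose multiplier exceeds
`M`. -/
def spike (M : ℝ) : Set (ι → ℝ) :=
  {ξ | ∃ A ∈ s.𝒜, (∀ B ∈ s.𝒜, s.total B ξ ≤ s.total A ξ) ∧ ∃ T ∈ s.Nb A, M < ξ T}

theorem measurable_total (A : β) : Measurable (s.total A) := by
  unfold total
  fun_prop

theorem measurableSet_nearMax (A : β) (Δ : ℝ) : MeasurableSet (s.nearMax A Δ) := by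
  have : s.nearMax A Δ = ⋂ B ∈ s.𝒜, {ξ | s.total B ξ ≤ s.total A ξ + Δ} := by
    ext; simp [nearMax]
  rw [this]
  exact Finset.measurableSet_biInter _ fun B _ =>
    measurableSet_le (s.measurable_total B) ((s.measurable_total A).add_const _)

theorem measurableSet_strictMax (A : β) : MeasurableSet (s.strictMax A) := by
  have : s.strictMax A = ⋂ B ∈ s.𝒜, ⋂ (_ : B ≠ A), {ξ | s.total B ξ < s.total A ξ} := by
    ext; simp [strictMax]
  rw [this]
  exact Finset.measurableSet_biInter _ fun B _ => MeasurableSet.iInter fun _ =>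
    measurableSet_lt (s.measurable_total B) (s.measurable_total A)

theorem le_sum_of_mem_nearMax {μ η Δ : ℝ} (hμ : 0 < μ) {A : β} (hA : A ∈ s.𝒜) {ξ : ι → ℝ}
    (hdev : ξ ∉ s.deviation μ η) (hξ : ξ ∈ s.nearMax A Δ) :
    s.m * (s.W - s.v - 2 * η * s.W) - Δ / μ ≤ ∑ T ∈ s.Nb A, s.w T := by
  obtain ⟨B, hB, hsum⟩ := s.exists_le_sum
  have hdev' : ∀ B ∈ s.𝒜, |s.total B ξ - μ * ∑ T ∈ s.Nb B, s.w T| ≤ η * μ * s.m * s.W := by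
    intro B hB
    by_contra! h
    exact hdev ⟨B, hB, h⟩
  have h1 := (abs_le.1 (hdev' B hB)).1
  have h2 := (abs_le.1 (hdev' A hA)).2
  have h3 := hξ B hB
  have h4 := mul_le_mul_of_nonneg_left hsum hμ.le
  have h5 : Δ / μ * μ = Δ := div_mul_cancel₀ _ hμ.ne'
  refine le_of_mul_le_mul_left ?_ hμ
  linarith

/-- Neighbors of `A` with weight at least `θ`. -/
noncomputable def heavy (A : β) (θ : ℝ) : Finset ι :=
  open Classical in (s.Nb A).filter fun T => θ ≤ s.w T

theorem mem_heavy {A : β} {θ : ℝ} {T : ι} : T ∈ s.heavy A θ ↔ T ∈ s.Nb A ∧ θ ≤ s.w T := by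
  classical
  exact Finset.mem_filter

/-- Markov's inequality for the deficits `W - w T`, which are nonnegative with mean at most `x`. -/
theorem le_two_mul_card_heavy {A : β} (hA : A ∈ s.𝒜) {x : ℝ} (hx : 0 < x)
    (h : s.m * (s.W - x) ≤ ∑ T ∈ s.Nb A, s.w T) :
    (s.m : ℝ) ≤ 2 * (s.heavy A (s.W - 2 * x)).card := by
  classical
  have h1 : ∑ T ∈ s.Nb A, s.w T ≤
      ∑ T ∈ s.Nb A, ((s.W - 2 * x) + 2 * x * if s.W - 2 * x ≤ s.w T then 1 else 0) := by
    refine Finset.sum_le_sum fun T hT => ?_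
    have := s.w_le A hA T hT
    split_ifs with h <;> linarith
  rw [Finset.sum_add_distrib, Finset.sum_const, s.card_Nb A hA, nsmul_eq_mul, ← Finset.mul_sum,
    Finset.sum_boole] at h1
  have h2 : (((s.Nb A).filter fun T => s.W - 2 * x ≤ s.w T).card : ℝ) =
      (s.heavy A (s.W - 2 * x)).card := by
    unfold heavy; norm_cast
  rw [h2] at h1
  have h3 : x * s.m ≤ x * (2 * (s.heavy A (s.W - 2 * x)).card) := by linarith
  exact le_of_mul_le_mul_left h3 hx

/-- The deterministic core. Without deviation the maximizer `A` has at least `m / 2` heavy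
neighbors, of weight at least `θ`. If one of them has multiplier above `M` while the chosen `T` has
multiplier at most `M'`, comparing noisy values gives `θ * M < w T * M'`, hence `w T > (1 - η) * θ`.
The final union thus runs over candidates with many heavy neighbors only. -/
theorem badSelection_subset {μ η M M' : ℝ} (hμ : 0 < μ) (hη : 0 < η) (hη1 : η ≤ 1 / 16)
    (hM : 0 < M) (hMM' : (1 - η) * M' ≤ M) :
    badSelection s.𝒜 s.Nb s.w (s.W - 2 * s.v - 6 * η * s.W) ⊆
      s.deviation μ η ∪ s.spike M' ∪ ⋃ A ∈ s.𝒜.filter fun A =>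
        (s.m : ℝ) ≤ 2 * (s.heavy A (s.W - 2 * (s.v + 2 * η * s.W))).card,
        {ξ | ∀ T ∈ s.heavy A (s.W - 2 * (s.v + 2 * η * s.W)), ξ T ≤ M} := by
  rintro ξ ⟨A, hA, hmax, T, hT, hTmax, hlt⟩
  have hW := s.W_pos
  have hv := s.v_le
  have hηW : 0 < η * s.W := mul_pos hη hW
  have hηW' : η * s.W ≤ 1 / 16 * s.W := mul_le_mul_of_nonneg_right hη1 hW.le
  set θ := s.W - 2 * (s.v + 2 * η * s.W) with hθ
  have hθ0 : 0 < θ := by linarith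
  by_cases hdev : ξ ∈ s.deviation μ η
  · exact Or.inl (Or.inl hdev)
  by_cases hspike : ξ ∈ s.spike M'
  · exact Or.inl (Or.inr hspike)
  right
  have hnear : ξ ∈ s.nearMax A 0 := fun B hB => by rw [add_zero]; exact hmax B hB
  have h1 := s.le_sum_of_mem_nearMax hμ hA hdev hnear
  rw [zero_div, sub_zero] at h1
  have h2 := s.le_two_mul_card_heavy hA (x := s.v + 2 * η * s.W)
    (by linarith [s.v_nonneg]) (le_of_eq_of_le (by ring) h1)
  simp only [mem_iUnion, exists_prop, mem_ofPred_eq]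
  refine ⟨A, Finset.mem_filter.2 ⟨hA, h2⟩, fun T' hT' => ?_⟩
  by_contra! hgt
  rw [mem_heavy] at hT'
  have hTM : ξ T ≤ M' := by
    by_contra! h
    exact hspike ⟨A, hA, hmax, T, hT, h⟩
  have h3 : θ * M < s.w T * M' := by
    calc θ * M < θ * ξ T' := mul_lt_mul_of_pos_left hgt hθ0
      _ ≤ s.w T' * ξ T' := mul_le_mul_of_nonneg_right hT'.2 (hM.trans hgt).le
      _ = ξ T' * s.w T' := mul_comm _ _
      _ ≤ ξ T * s.w T := hTmax T' hT'.1
      _ = s.w T * ξ T := mul_comm _ _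
      _ ≤ s.w T * M' := mul_le_mul_of_nonneg_left hTM (s.w_nonneg T)
  have hM' : 0 < M' := by
    by_contra! h
    have := mul_nonpos_of_nonneg_of_nonpos (s.w_nonneg T) h
    have := mul_pos hθ0 hM
    linarith
  have h4 : θ * (1 - η) * M' < s.w T * M' := by
    have := mul_le_mul_of_nonneg_left hMM' hθ0.le
    linarith
  have h5 := lt_of_mul_lt_mul_right h4 hM'.le
  -- Here `(1 - η) * θ` is at least `W - 2 * v - 5 * η * W`, which exceeds the bound to be
  -- contradicted.
  have h6 : θ * η ≤ s.W * η := mul_le_mul_of_nonneg_right (by linarith [s.v_nonneg]) hη.le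
  linarith

variable [Fintype ι] {D : Measure ℝ} [IsProbabilityMeasure D]

theorem real_large_le (R : ℝ) : (Measure.pi fun _ : ι => D).real (s.large R) ≤
    s.𝒯.card * D.real {x | R < |x|} :=
  pi_real_exists_lt_abs_le s.𝒯 R

/-- Half of the allowed deviation absorbs the shift of the mean by truncation, the other half is
left to Hoeffding. -/
theorem real_deviation_le {μ η R : ℝ} (hμ : 0 < μ) (hη : 0 < η) (hR : 0 < R)
    (hclamp : |∫ x, clamp R x ∂D - μ| ≤ η * μ / 2) :
    (Measure.pi fun _ : ι => D).real (s.deviation μ η) ≤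
      s.𝒯.card * D.real {x | R < |x|} +
      s.𝒜.card * (2 * Real.exp (-((η * μ) ^ 2 * s.m / (8 * R ^ 2)))) := by
  set P := Measure.pi fun _ : ι => D
  set μR := ∫ x, clamp R x ∂D
  set t := η * μ * s.m * s.W / 2 with ht
  have hW := s.W_pos
  have hm : (0 : ℝ) < s.m := by exact_mod_cast s.m_pos
  have ht0 : 0 ≤ t := by positivity
  have hsub : s.deviation μ η ⊆ s.large R ∪ ⋃ B ∈ s.𝒜,
      {ξ | t ≤ |∑ T ∈ s.Nb B, s.w T * (clamp R (ξ T) - μR)|} := by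
    rintro ξ ⟨B, hB, hlt⟩
    by_cases hl : ξ ∈ s.large R
    · exact Or.inl hl
    right
    simp only [mem_iUnion, exists_prop]
    refine ⟨B, hB, ?_⟩
    have hle : ∀ T ∈ s.Nb B, |ξ T| ≤ R := fun T hT => by
      by_contra! h
      exact hl ⟨T, s.Nb_subset B hB hT, h⟩
    have e : ∑ T ∈ s.Nb B, s.w T * (clamp R (ξ T) - μR) =
        (s.total B ξ - μ * ∑ T ∈ s.Nb B, s.w T) - (μR - μ) * ∑ T ∈ s.Nb B, s.w T := by
      have : s.total B ξ = ∑ T ∈ s.Nb B, s.w T * clamp R (ξ T) :=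
        Finset.sum_congr rfl fun T hT => by rw [clamp_of_abs_le (hle T hT), mul_comm]
      simp only [mul_sub, Finset.sum_sub_distrib, ← Finset.sum_mul, this]
      ring
    have hsum0 : 0 ≤ ∑ T ∈ s.Nb B, s.w T := Finset.sum_nonneg fun T _ => s.w_nonneg T
    have hsum : ∑ T ∈ s.Nb B, s.w T ≤ s.m * s.W := by
      have := Finset.sum_le_card_nsmul (s.Nb B) s.w s.W (s.w_le B hB)
      rwa [s.card_Nb B hB, nsmul_eq_mul] at this
    have h1 : |(μR - μ) * ∑ T ∈ s.Nb B, s.w T| ≤ t := by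
      rw [abs_mul, abs_of_nonneg hsum0]
      calc _ ≤ η * μ / 2 * (s.m * s.W) := mul_le_mul hclamp hsum hsum0 (by positivity)
        _ = t := by ring
    rw [mem_ofPred_eq, e]
    have h2 := abs_sub_abs_le_abs_sub (s.total B ξ - μ * ∑ T ∈ s.Nb B, s.w T)
      ((μR - μ) * ∑ T ∈ s.Nb B, s.w T)
    linarith
  calc _ ≤ _ := measureReal_mono hsub
    _ ≤ P.real (s.large R) + ∑ B ∈ s.𝒜,
        P.real {ξ | t ≤ |∑ T ∈ s.Nb B, s.w T * (clamp R (ξ T) - μR)|} :=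
        (measureReal_union_le _ _).trans (by gcongr; exact measureReal_biUnion_finset_le _ _)
    _ ≤ _ := by
        refine add_le_add (s.real_large_le R) ?_
        rw [← nsmul_eq_mul]
        refine Finset.sum_le_card_nsmul _ _ _ fun B hB => ?_
        refine (pi_real_lt_abs_sum_clamp_le hR.le ht0 (s.Nb B) (W := s.W) fun T hT => ?_).trans_eq ?_
        · rw [abs_of_nonneg (s.w_nonneg T)]; exact s.w_le B hB T hT
        · rw [s.card_Nb B hB]
          congr 2
          rw [ht]
          field_simp
          ring

/-- If at least half of the neighbors of `A` weigh at least `W / 2`, then for each rival `B` at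
least `m / 4` of these lie outside `Nb B`. Raising helps `A` against `B` through these, and a total
increase above `4 * R` at weight `W / 2` beats the slack `2 * W * R`. If fewer are heavy, near
maximality already forces a deviation. -/
theorem real_nearMax_le {μ η R a ρ l : ℝ} (hμ : 0 < μ) (hη : 0 < η) (hη1 : η ≤ 1 / 32)
    (hR : 0 < R) (hclamp : |∫ x, clamp R x ∂D - μ| ≤ η * μ / 2) (hRm : 32 * R ≤ μ * s.m)
    (hρ0 : 0 ≤ ρ) (hρ1 : ρ ≤ 1) (hl : 0 ≤ l) {A : β} (hA : A ∈ s.𝒜) :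
    (Measure.pi fun _ : ι => D).real (s.nearMax A (2 * s.W * R)) ≤
      Real.exp 1 * (Measure.pi fun _ : ι => D).real (s.strictMax A) +
      (Real.exp (((1 + l) * ρ) ^ 2 / 2 * s.m - l) +
      s.𝒜.card * Real.exp (4 * R - ρ * (D.real (Iic a) * D.real (Ici (a + 1))) / 2 * (s.m / 4)) +
      (s.𝒯.card * D.real {x | R < |x|} +
        s.𝒜.card * (2 * Real.exp (-((η * μ) ^ 2 * s.m / (8 * R ^ 2)))))) := by
  classical
  have hW := s.W_pos
  have hm : (0 : ℝ) < s.m := by exact_mod_cast s.m_pos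
  have hE := s.real_deviation_le (D := D) hμ hη hR hclamp
  by_cases hheavy : (s.m : ℝ) ≤ 2 * (s.heavy A (s.W - 2 * (s.W / 4))).card
  · have hNbA := s.card_Nb A hA
    have key := pi_real_le_of_raise (D := D) a hρ0 hρ1 hl (s.Nb A) (s.𝒜.erase A)
      (fun B => s.heavy A (s.W - 2 * (s.W / 4)) \ s.Nb B) (h := s.m / 4) (t := 4 * R)
      (X := s.nearMax A (2 * s.W * R)) (Y := s.strictMax A) ?_ ?_
      (s.measurableSet_nearMax A _) (s.measurableSet_strictMax A) ?_
    · rw [hNbA] at key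
      have hcard : ((s.𝒜.erase A).card : ℝ) ≤ s.𝒜.card := by
        exact_mod_cast Finset.card_le_card (Finset.erase_subset _ _)
      have h1 := mul_le_mul_of_nonneg_right hcard (Real.exp_pos
        (4 * R - ρ * (D.real (Iic a) * D.real (Ici (a + 1))) / 2 * (s.m / 4))).le
      have h2 : 0 ≤ (Measure.pi fun _ : ι => D).real (s.deviation μ η) := measureReal_nonneg
      linarith
    · intro B hB
      rw [Finset.mem_erase] at hB
      have h1 := s.card_inter A hA B hB.2 (Ne.symm hB.1)
        (s.heavy A (s.W - 2 * (s.W / 4)) ∩ s.Nb B)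
        (fun T hT => (s.mem_heavy.1 (Finset.mem_inter.1 hT).1).1) Finset.inter_subset_right
      have h2 := Finset.card_sdiff_add_card_inter (s.heavy A (s.W - 2 * (s.W / 4))) (s.Nb B)
      have h1' : (4 : ℝ) * (s.heavy A (s.W - 2 * (s.W / 4)) ∩ s.Nb B).card ≤ s.m := by
        exact_mod_cast h1
      have h2' : ((s.heavy A (s.W - 2 * (s.W / 4)) \ s.Nb B).card : ℝ) +
          (s.heavy A (s.W - 2 * (s.W / 4)) ∩ s.Nb B).card =
          (s.heavy A (s.W - 2 * (s.W / 4))).card := by exact_mod_cast h2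
      linarith
    · intro B _ T hT
      exact (s.mem_heavy.1 (Finset.mem_sdiff.1 hT).1).1
    · intro ξ ξ' hle hoff hξ hsum B hB hBA
      have h1 := hξ B hB
      have h2 := hsum B (Finset.mem_erase.2 ⟨hBA, hB⟩)
      set d : ι → ℝ := fun T => (ξ' T - ξ T) * s.w T with hd
      have hd0 : ∀ T, 0 ≤ d T := fun T => mul_nonneg (sub_nonneg.2 (hle T)) (s.w_nonneg T)
      have htot : ∀ C, s.total C ξ' = s.total C ξ + ∑ T ∈ s.Nb C, d T := fun C => by
        simp only [total, hd, sub_mul, Finset.sum_sub_distrib]; ring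
      have h3 : ∑ T ∈ s.Nb B, d T ≤ ∑ T ∈ s.Nb A ∩ s.Nb B, d T := by
        rw [← Finset.sum_sdiff (Finset.inter_subset_right : s.Nb A ∩ s.Nb B ⊆ s.Nb B)]
        have : ∑ T ∈ s.Nb B \ (s.Nb A ∩ s.Nb B), d T = 0 := by
          refine Finset.sum_eq_zero fun T hT => ?_
          have hTA : T ∉ s.Nb A := fun h => (Finset.mem_sdiff.1 hT).2
            (Finset.mem_inter.2 ⟨h, (Finset.mem_sdiff.1 hT).1⟩)
          simp only [hd, hoff T hTA, sub_self, zero_mul]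
        rw [this, zero_add]
      have h4 : ∑ T ∈ s.Nb A \ s.Nb B, d T + ∑ T ∈ s.Nb A ∩ s.Nb B, d T = ∑ T ∈ s.Nb A, d T := by
        rw [← Finset.sum_sdiff (Finset.inter_subset_left : s.Nb A ∩ s.Nb B ⊆ s.Nb A),
          Finset.sdiff_inter_self_left]
      have h5 : ∑ T ∈ s.heavy A (s.W - 2 * (s.W / 4)) \ s.Nb B, (ξ' T - ξ T) * (s.W / 2) ≤
          ∑ T ∈ s.Nb A \ s.Nb B, d T := by
        refine (Finset.sum_le_sum (g := d) fun T hT => ?_).trans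
          (Finset.sum_le_sum_of_subset_of_nonneg ?_ fun T _ _ => hd0 T)
        · have := (s.mem_heavy.1 (Finset.mem_sdiff.1 hT).1).2
          exact mul_le_mul_of_nonneg_left (by linarith) (sub_nonneg.2 (hle T))
        · exact Finset.sdiff_subset_sdiff (fun T hT => (s.mem_heavy.1 hT).1) subset_rfl
      rw [← Finset.sum_mul] at h5
      have h6 := mul_lt_mul_of_pos_right h2 (by linarith : 0 < s.W / 2)
      rw [htot, htot]
      linarith
  · have hsub : s.nearMax A (2 * s.W * R) ⊆ s.deviation μ η := by
      intro ξ hξ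
      by_contra hdev
      -- The loss `W / 4` is the sum of `W / 8` from `v`, `W / 16` from the deviations and `W / 16`
      -- from the slack.
      refine hheavy (s.le_two_mul_card_heavy hA (by linarith) ?_)
      refine le_trans ?_ (s.le_sum_of_mem_nearMax hμ hA hdev hξ)
      have h1 : 2 * s.W * R / μ ≤ s.m * (s.W / 16) := by
        rw [div_le_iff₀ hμ]
        have := mul_le_mul_of_nonneg_left hRm (by linarith : 0 ≤ s.W / 16)
        linarith
      have h2 : s.m * (η * s.W) ≤ s.m * (1 / 32 * s.W) := by gcongr
      have h3 := mul_le_mul_of_nonneg_left s.v_le hm.le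
      linarith
    have h1 := (measureReal_mono hsub (μ := Measure.pi fun _ : ι => D)).trans hE
    have h2 : 0 ≤ Real.exp 1 * (Measure.pi fun _ : ι => D).real (s.strictMax A) := by positivity
    have h3 : 0 ≤ Real.exp (((1 + l) * ρ) ^ 2 / 2 * s.m - l) := (Real.exp_pos _).le
    have h4 : 0 ≤ s.𝒜.card * Real.exp (4 * R - ρ * (D.real (Iic a) * D.real (Ici (a + 1))) / 2 *
      (s.m / 4)) := by positivity
    linarith

theorem sum_real_strictMax_le :
    ∑ A ∈ s.𝒜, (Measure.pi fun _ : ι => D).real (s.strictMax A) ≤ 1 := by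
  rw [← measureReal_biUnion_finset]
  · exact measureReal_le_one
  · intro A hA B hB hAB
    rw [Function.onFun, Set.disjoint_left]
    intro ξ h1 h2
    exact lt_asymm (h1 B hB hAB.symm) (h2 A hA hAB)
  · exact fun A _ => s.measurableSet_strictMax A

/-- Setting the nonnegative `ξ T` to zero raises no rival and lowers the total of `A` by at most `W
* R`, so `A` stays maximal up to `W * R`. The reset event is independent of `ξ T`. Restoring an
arbitrary `ξ T` of size at most `R` costs another `W * R`. -/
theorem real_inter_max_spike_le {R M : ℝ} (hM : 0 ≤ M) {A : β} (hA : A ∈ s.𝒜) {T : ι}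
    (hT : T ∈ s.Nb A) :
    (Measure.pi fun _ : ι => D).real
      {ξ | (∀ B ∈ s.𝒜, s.total B ξ ≤ s.total A ξ) ∧ M < ξ T ∧ |ξ T| ≤ R} ≤
    D.real (Ioi M) * ((Measure.pi fun _ : ι => D).real (s.nearMax A (2 * s.W * R)) +
      D.real {x | R < |x|}) := by
  classical
  set P := Measure.pi fun _ : ι => D
  have hW := s.W_pos
  have hupd : ∀ (B : β) (ξ : ι → ℝ), s.total B ξ =
      s.total B (Function.update ξ T 0) + if T ∈ s.Nb B then ξ T * s.w T else 0 := by
    intro B ξ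
    have : ∀ T' ∈ s.Nb B, ξ T' * s.w T' =
        Function.update ξ T 0 T' * s.w T' + if T = T' then ξ T * s.w T else 0 := by
      intro T' _
      by_cases h : T = T'
      · subst h; simp
      · rw [Function.update_of_ne (Ne.symm h), if_neg h, add_zero]
    rw [total, total, Finset.sum_congr rfl this, Finset.sum_add_distrib, Finset.sum_ite_eq]
  have hmeasU : Measurable fun ξ : ι → ℝ => Function.update ξ T 0 :=
    measurable_update_left
  set X : Set (ι → ℝ) := {ξ | ξ T ∈ Ioi M}
  set Y : Set (ι → ℝ) := (fun ξ => Function.update ξ T 0) ⁻¹' s.nearMax A (s.W * R)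
  have hsub : {ξ : ι → ℝ | (∀ B ∈ s.𝒜, s.total B ξ ≤ s.total A ξ) ∧ M < ξ T ∧ |ξ T| ≤ R} ⊆
      X ∩ Y := by
    rintro ξ ⟨hmax, hM', hR⟩
    refine ⟨hM', fun B hB => ?_⟩
    have h1 := hmax B hB
    rw [hupd B ξ, hupd A ξ, if_pos hT] at h1
    have hR' : ξ T ≤ R := (le_abs_self _).trans hR
    have hw := s.w_le A hA T hT
    have hw0 := s.w_nonneg T
    have h2 : ξ T * s.w T ≤ s.W * R := by
      rw [mul_comm s.W]
      exact mul_le_mul hR' hw hw0 (by linarith)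
    have h3 : 0 ≤ if T ∈ s.Nb B then ξ T * s.w T else 0 := by
      split_ifs
      · exact mul_nonneg (by linarith) hw0
      · exact le_rfl
    linarith
  have hYsub : Y ⊆ s.nearMax A (2 * s.W * R) ∪ {ξ | ξ T ∈ {x | R < |x|}} := by
    intro ξ hξ
    by_cases h : R < |ξ T|
    · exact Or.inr h
    left
    push Not at h
    intro B hB
    have h1 := hξ B hB
    have habs : |ξ T * s.w T| ≤ R * s.W := by
      rw [abs_mul, abs_of_nonneg (s.w_nonneg T)]
      exact mul_le_mul h (s.w_le A hA T hT) (s.w_nonneg T) ((abs_nonneg _).trans h)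
    have h0 : 0 ≤ R * s.W := (abs_nonneg _).trans habs
    rw [hupd B ξ, hupd A ξ, if_pos hT]
    have h2 := abs_le.1 habs
    split_ifs <;> linarith
  have hind : P.real (X ∩ Y) = P.real X * P.real Y := by
    refine pi_real_inter_eq_mul {T} (measurable_pi_apply T measurableSet_Ioi)
      (hmeasU (s.measurableSet_nearMax A _)) (fun ξ ξ' h hξ => ?_) (fun ξ ξ' h hξ => ?_)
    · have := h T (Finset.mem_singleton_self T)
      change ξ' T ∈ Ioi M
      rw [← this]; exact hξ
    · have : Function.update ξ' T 0 = Function.update ξ T 0 := by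
        ext T'
        by_cases hT' : T' = T
        · subst hT'; simp
        · rw [Function.update_of_ne hT', Function.update_of_ne hT',
            h T' (by simpa using hT')]
      change Function.update ξ' T 0 ∈ s.nearMax A (s.W * R)
      rw [this]; exact hξ
  calc _ ≤ P.real (X ∩ Y) := measureReal_mono hsub
    _ = D.real (Ioi M) * P.real Y := by
        rw [hind, pi_real_eval_preimage T measurableSet_Ioi]
    _ ≤ _ := by
        refine mul_le_mul_of_nonneg_left ?_ measureReal_nonneg
        refine (measureReal_mono hYsub).trans ((measureReal_union_le _ _).trans ?_)
        have hmeas : MeasurableSet {x : ℝ | R < |x|} :=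
          measurableSet_lt measurable_const measurable_id.abs
        rw [pi_real_eval_preimage T hmeas]

/-- The strict maximality events are disjoint, so summing over candidates costs only a factor `e` in
the main term; the number of candidates multiplies error terms alone. -/
theorem real_spike_le {R M E : ℝ} (hM : 0 ≤ M)
    (hE : ∀ A ∈ s.𝒜, (Measure.pi fun _ : ι => D).real (s.nearMax A (2 * s.W * R)) ≤
      Real.exp 1 * (Measure.pi fun _ : ι => D).real (s.strictMax A) + E) :
    (Measure.pi fun _ : ι => D).real (s.spike M) ≤ s.𝒯.card * D.real {x | R < |x|} +
      s.m * D.real (Ioi M) * (Real.exp 1 + s.𝒜.card * (E + D.real {x | R < |x|})) := by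
  set P := Measure.pi fun _ : ι => D
  have hsub : s.spike M ⊆ s.large R ∪ ⋃ A ∈ s.𝒜, ⋃ T ∈ s.Nb A,
      {ξ | (∀ B ∈ s.𝒜, s.total B ξ ≤ s.total A ξ) ∧ M < ξ T ∧ |ξ T| ≤ R} := by
    rintro ξ ⟨A, hA, hmax, T, hT, hMT⟩
    by_cases hl : ξ ∈ s.large R
    · exact Or.inl hl
    right
    simp only [mem_iUnion, exists_prop]
    refine ⟨A, hA, T, hT, hmax, hMT, ?_⟩
    by_contra! h
    exact hl ⟨T, s.Nb_subset A hA hT, h⟩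
  have hsum : ∀ A ∈ s.𝒜, P.real (⋃ T ∈ s.Nb A,
      {ξ | (∀ B ∈ s.𝒜, s.total B ξ ≤ s.total A ξ) ∧ M < ξ T ∧ |ξ T| ≤ R}) ≤
      s.m * D.real (Ioi M) * (Real.exp 1 * P.real (s.strictMax A) +
        (E + D.real {x | R < |x|})) := by
    intro A hA
    refine (measureReal_biUnion_finset_le _ _).trans ?_
    refine (Finset.sum_le_card_nsmul _ _ _ fun T hT =>
      s.real_inter_max_spike_le hM hA hT).trans ?_
    rw [s.card_Nb A hA, nsmul_eq_mul, ← mul_assoc]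
    exact mul_le_mul_of_nonneg_left (by linarith [hE A hA]) (by positivity)
  calc _ ≤ _ := measureReal_mono hsub
    _ ≤ P.real (s.large R) + ∑ A ∈ s.𝒜, s.m * D.real (Ioi M) *
        (Real.exp 1 * P.real (s.strictMax A) + (E + D.real {x | R < |x|})) := by
        refine (measureReal_union_le _ _).trans (add_le_add le_rfl ?_)
        exact (measureReal_biUnion_finset_le _ _).trans (Finset.sum_le_sum hsum)
    _ ≤ _ := by
        refine add_le_add (s.real_large_le R) ?_
        rw [← Finset.mul_sum, Finset.sum_add_distrib, ← Finset.mul_sum, Finset.sum_const,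
          nsmul_eq_mul]
        have h1 := mul_le_mul_of_nonneg_left (s.sum_real_strictMax_le (D := D))
          (Real.exp_pos 1).le
        rw [mul_one] at h1
        gcongr

theorem real_spike_eq_zero {M : ℝ} (hM : D.real (Ioi M) = 0) :
    (Measure.pi fun _ : ι => D).real (s.spike M) = 0 := by
  refine le_antisymm ?_ measureReal_nonneg
  have hsub : s.spike M ⊆ ⋃ T ∈ s.𝒯, {ξ | ξ T ∈ Ioi M} := by
    rintro ξ ⟨A, hA, -, T, hT, hMT⟩
    simp only [mem_iUnion, exists_prop]
    exact ⟨T, s.Nb_subset A hA hT, hMT⟩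
  refine (measureReal_mono hsub (measure_ne_top _ _)).trans
    ((measureReal_biUnion_finset_le _ _).trans ?_)
  simp only [pi_real_eval_preimage _ (measurableSet_Ioi (a := M)), hM, Finset.sum_const_zero,
    le_refl]

theorem real_badSelection_le {μ η R M M' σ : ℝ} (hμ : 0 < μ) (hη : 0 < η) (hη1 : η ≤ 1 / 32)
    (hR : 0 < R) (hclamp : |∫ x, clamp R x ∂D - μ| ≤ η * μ / 2)
    (hM : 0 < M) (hMM' : (1 - η) * M' ≤ M)
    (hσ : (Measure.pi fun _ : ι => D).real (s.spike M') ≤ σ) :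
    (Measure.pi fun _ : ι => D).real
      (badSelection s.𝒜 s.Nb s.w (s.W - 2 * s.v - 6 * η * s.W)) ≤
    (s.𝒯.card * D.real {x | R < |x|} +
      s.𝒜.card * (2 * Real.exp (-((η * μ) ^ 2 * s.m / (8 * R ^ 2))))) + σ +
      s.𝒜.card * Real.exp (-(D.real (Ioi M) * (s.m / 2))) := by
  classical
  set θ := s.W - 2 * (s.v + 2 * η * s.W) with hθ
  refine (measureReal_mono (s.badSelection_subset hμ hη (by linarith) hM hMM')).trans ?_
  refine (measureReal_union_le _ _).trans (add_le_add ?_ ?_)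
  · exact (measureReal_union_le _ _).trans
      (add_le_add (s.real_deviation_le hμ hη hR hclamp) hσ)
  · refine (measureReal_biUnion_finset_le _ _).trans ?_
    have hcard : ((s.𝒜.filter fun A => (s.m : ℝ) ≤ 2 * (s.heavy A θ).card).card : ℝ) ≤
        s.𝒜.card := by exact_mod_cast Finset.card_filter_le _ _
    refine (Finset.sum_le_card_nsmul _ _ (Real.exp (-(D.real (Ioi M) * (s.m / 2))))
      fun A hA => ?_).trans ?_
    · refine (pi_real_forall_le_le _ M).trans (Real.exp_le_exp.2 (neg_le_neg ?_))
      have := (Finset.mem_filter.1 hA).2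
      exact mul_le_mul_of_nonneg_left (by linarith) measureReal_nonneg
    · rw [nsmul_eq_mul]
      exact mul_le_mul_of_nonneg_right hcard (Real.exp_pos _).le

end SelectionSystem

end Selection

/-! ### Upper tail of a density `exp (-g)`. -/

section Tail

open Filter Topology
open scoped ENNReal

variable {D : Measure ℝ}

theorem lintegral_Ioi_mul_left {c : ℝ} (hc : 0 < c) (x : ℝ) (F : ℝ → ℝ≥0∞) :
    ∫⁻ z in Ioi (c * x), F z = ENNReal.ofReal c * ∫⁻ y in Ioi x, F (c * y) := by
  have h := lintegral_image_eq_lintegral_abs_deriv_mul (s := Ioi x) (f := fun y => c * y)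
    (f' := fun _ => c) measurableSet_Ioi
    (fun y _ => by simpa using ((hasDerivAt_id y).const_mul c).hasDerivWithinAt)
    (fun y _ z _ h => mul_left_cancel₀ hc.ne' h) F
  rw [image_mul_left_Ioi hc] at h
  rw [h, lintegral_const_mul' _ _ ENNReal.ofReal_ne_top, abs_of_pos hc]

theorem measure_eq_lintegral_of_restrict_eq {S s : Set ℝ} {F : ℝ → ℝ≥0∞}
    (h : D.restrict S = (volume.restrict S).withDensity F) (hs : MeasurableSet s) (hsS : s ⊆ S) :
    D s = ∫⁻ x in s, F x := by
  rw [← Measure.restrict_eq_self D hsS, h, withDensity_apply _ hs, Measure.restrict_restrict hs,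
    inter_eq_left.2 hsS]

/-- For `x ≥ x₁` each term after the leading one is at most `(x / x₁) ^ α 1` times its size at `x₁`,
where the series converges absolutely. -/
theorem exists_abs_sub_leading_le {x₀ : ℝ} {a α : ℕ → ℝ} {g : ℝ → ℝ} (hα : Antitone α)
    (hg : ∀ x > x₀, HasSum (fun i => a i * x ^ α i) (g x)) :
    ∃ x₁ K : ℝ, x₀ < x₁ ∧ 1 ≤ x₁ ∧ 0 ≤ K ∧
      ∀ x ≥ x₁, |g x - a 0 * x ^ α 0| ≤ K * x ^ α 1 := by
  set x₁ := max (x₀ + 1) 1 with hx₁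
  have h1 : 1 ≤ x₁ := le_max_right _ _
  have hx₁0 : 0 < x₁ := by linarith
  have h0 : x₀ < x₁ := by linarith [le_max_left (x₀ + 1) 1]
  have hsum : Summable fun i => |a (i + 1) * x₁ ^ α (i + 1)| :=
    (summable_nat_add_iff (f := fun i => |a i * x₁ ^ α i|) 1).2 (hg x₁ h0).summable.abs
  set K' := ∑' i, |a (i + 1) * x₁ ^ α (i + 1)|
  have hK' : 0 ≤ K' := tsum_nonneg fun i => abs_nonneg _
  refine ⟨x₁, K' / x₁ ^ α 1, h0, h1, by positivity, fun x hx => ?_⟩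
  have hx0 : 0 < x := by linarith
  have htail := (hasSum_nat_add_iff' (f := fun i => a i * x ^ α i) 1).2 (hg x (by linarith))
  rw [Finset.sum_range_one] at htail
  have hr : 1 ≤ x / x₁ := (one_le_div hx₁0).2 hx
  have hterm : ∀ i, |a (i + 1) * x ^ α (i + 1)| ≤
      |a (i + 1) * x₁ ^ α (i + 1)| * (x / x₁) ^ α 1 := by
    intro i
    have e : x ^ α (i + 1) = x₁ ^ α (i + 1) * (x / x₁) ^ α (i + 1) := by
      rw [← Real.mul_rpow hx₁0.le (by positivity), mul_div_cancel₀ _ hx₁0.ne']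
    rw [e, ← mul_assoc, abs_mul, abs_of_pos (a := (x / x₁) ^ α (i + 1)) (by positivity)]
    exact mul_le_mul_of_nonneg_left
      (Real.rpow_le_rpow_of_exponent_le hr (hα (by omega))) (abs_nonneg _)
  have hsumx : Summable fun i => |a (i + 1) * x ^ α (i + 1)| :=
    Summable.of_nonneg_of_le (fun i => abs_nonneg _) hterm (hsum.mul_right _)
  rw [← htail.tsum_eq]
  calc _ ≤ ∑' i, |a (i + 1) * x ^ α (i + 1)| := by
        have := norm_tsum_le_tsum_norm (f := fun i => a (i + 1) * x ^ α (i + 1)) hsumx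
        simpa only [Real.norm_eq_abs] using this
    _ ≤ ∑' i, |a (i + 1) * x₁ ^ α (i + 1)| * (x / x₁) ^ α 1 :=
        hsumx.tsum_le_tsum hterm (hsum.mul_right _)
    _ = K' * (x / x₁) ^ α 1 := tsum_mul_right
    _ = K' / x₁ ^ α 1 * x ^ α 1 := by
        rw [Real.div_rpow hx0.le hx₁0.le]; ring

variable [IsProbabilityMeasure D]

/-- Properties of the upper tail of a distribution with density `exp (-g)`, where `g` behaves like
a power with positive coefficient. -/
theorem exists_tail_bounds {x₀ : ℝ} {a α : ℕ → ℝ} {g : ℝ → ℝ} (hα : Antitone α)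
    (hα0 : 1 ≤ α 0) (ha : 0 < a 0) (hα1 : α 1 < α 0)
    (hg : ∀ x > x₀, HasSum (fun i => a i * x ^ α i) (g x))
    (hD : D.restrict (Ioi x₀) =
      (volume.restrict (Ioi x₀)).withDensity fun x => ENNReal.ofReal (Real.exp (-g x))) :
    ∃ x₁ A K b C γ : ℝ, 1 ≤ x₁ ∧ 1 ≤ A ∧ 0 < b ∧ 0 < C ∧ 0 < γ ∧
      (∀ x ≥ x₁, Real.exp (-(C * x ^ A)) ≤ D.real (Ioi x)) ∧
      ∀ x ≥ x₁, ∀ h : ℝ, 0 < h → h ≤ 1 → K ≤ h * x ^ γ →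
        D.real (Ioi ((1 + h) * x)) ≤ 2 * Real.exp (-(b * h * x ^ A)) * D.real (Ioi x) := by
  obtain ⟨x₁, K, h0, h1, hK, hgK⟩ := exists_abs_sub_leading_le hα hg
  have hden : ∀ x ≥ x₁, D (Ioi x) = ∫⁻ y in Ioi x, ENNReal.ofReal (Real.exp (-g y)) :=
    fun x hx => measure_eq_lintegral_of_restrict_eq hD measurableSet_Ioi
      (Ioi_subset_Ioi (by linarith))
  -- The exponent `γ` is the gap between the two leading exponents. Half of `a 0` goes into `b`; the
  -- other half absorbs the remainders at `y` and `(1 + h) * y` once `h * x ^ γ` is large. The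
  -- factor `2 ^ α 0` in `C` allows for integration up to `x + 1 ≤ 2 * x`.
  refine ⟨x₁, α 0, 2 * (K * (2 ^ |α 1| + 1)) / a 0, a 0 / 2, (a 0 + K) * 2 ^ α 0, α 0 - α 1, h1,
    hα0, by linarith, by positivity, by linarith, fun x hx => ?_, fun x hx h hh0 hh1 hKx => ?_⟩
  · have hx1 : 1 ≤ x := h1.trans hx
    have hle : ENNReal.ofReal (Real.exp (-((a 0 + K) * 2 ^ α 0 * x ^ α 0))) ≤ D (Ioi x) := by
      rw [hden x hx]
      calc ENNReal.ofReal (Real.exp (-((a 0 + K) * 2 ^ α 0 * x ^ α 0)))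
          = ∫⁻ _ in Ioc x (x + 1),
              ENNReal.ofReal (Real.exp (-((a 0 + K) * 2 ^ α 0 * x ^ α 0))) := by
            rw [setLIntegral_const, Real.volume_Ioc, add_sub_cancel_left, ENNReal.ofReal_one,
              mul_one]
        _ ≤ ∫⁻ y in Ioc x (x + 1), ENNReal.ofReal (Real.exp (-g y)) := by
            refine setLIntegral_mono' measurableSet_Ioc fun y hy => ENNReal.ofReal_le_ofReal
              (Real.exp_le_exp.2 (neg_le_neg ?_))
            have hyx : x₁ ≤ y := hx.trans hy.1.le
            have hy1 : 1 ≤ y := h1.trans hyx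
            have hb := (abs_le.1 (hgK y hyx)).2
            have h2 : y ^ α 1 ≤ y ^ α 0 := Real.rpow_le_rpow_of_exponent_le hy1 hα1.le
            have h3 : y ^ α 0 ≤ 2 ^ α 0 * x ^ α 0 := by
              rw [← Real.mul_rpow (by norm_num) (by linarith)]
              exact Real.rpow_le_rpow (by linarith) (by linarith [hy.2]) (by linarith)
            have h4 := mul_le_mul_of_nonneg_left h2 hK
            have h5 := mul_le_mul_of_nonneg_left h3 (by linarith : 0 ≤ a 0 + K)
            linarith
        _ ≤ _ := lintegral_mono_set Ioc_subset_Ioi_self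
    exact (ENNReal.ofReal_le_iff_le_toReal (measure_ne_top _ _)).1 hle
  · have hx1 : 1 ≤ x := h1.trans hx
    have hx0 : 0 < x := by linarith
    have hgg : ∀ y ∈ Ioi x, a 0 / 2 * h * x ^ α 0 + g y ≤ g ((1 + h) * y) := by
      intro y hy
      have hyx : x ≤ y := le_of_lt hy
      have hy1 : 1 ≤ y := hx1.trans hyx
      have hy0 : 0 < y := by linarith
      have hhy : y ≤ (1 + h) * y := by nlinarith
      have hb1 := (abs_le.1 (hgK y (hx.trans hyx))).2
      have hb2 := (abs_le.1 (hgK ((1 + h) * y) (hx.trans (hyx.trans hhy)))).1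
      rw [Real.mul_rpow (by linarith) hy0.le, Real.mul_rpow (by linarith) hy0.le] at hb2
      have hP0 : 0 < y ^ α 0 := by positivity
      have hP1 : 0 < y ^ α 1 := by positivity
      have h2 : 1 + h ≤ (1 + h) ^ α 0 := by
        have := Real.rpow_le_rpow_of_exponent_le (by linarith : 1 ≤ 1 + h) hα0
        rwa [Real.rpow_one] at this
      have h3 : (1 + h) ^ α 1 ≤ 2 ^ |α 1| :=
        (Real.rpow_le_rpow_of_exponent_le (by linarith) (le_abs_self _)).trans
          (Real.rpow_le_rpow (by linarith) (by linarith) (abs_nonneg _))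
      have h4 : K * (2 ^ |α 1| + 1) * y ^ α 1 ≤ a 0 / 2 * h * y ^ α 0 := by
        have e : y ^ α 0 = y ^ (α 0 - α 1) * y ^ α 1 := by
          rw [← Real.rpow_add hy0]; congr 1; ring
        have h5 : x ^ (α 0 - α 1) ≤ y ^ (α 0 - α 1) :=
          Real.rpow_le_rpow hx0.le hyx (by linarith)
        have h6 : 2 * (K * (2 ^ |α 1| + 1)) ≤ a 0 * (h * y ^ (α 0 - α 1)) := by
          rw [div_le_iff₀ ha] at hKx
          have := mul_le_mul_of_nonneg_left h5 (by positivity : 0 ≤ a 0 * h)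
          linarith
        rw [e]
        have := mul_le_mul_of_nonneg_right h6 hP1.le
        linarith
      have h7 : a 0 / 2 * h * x ^ α 0 ≤ a 0 / 2 * h * y ^ α 0 :=
        mul_le_mul_of_nonneg_left (Real.rpow_le_rpow hx0.le hyx (by linarith)) (by positivity)
      have h8 := mul_le_mul_of_nonneg_right (mul_le_mul_of_nonneg_left h2 ha.le) hP0.le
      have h9 := mul_le_mul_of_nonneg_right (mul_le_mul_of_nonneg_left h3 hK) hP1.le
      linarith
    have hxh : x ≤ (1 + h) * x := by nlinarith
    have hle : D (Ioi ((1 + h) * x)) ≤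
        ENNReal.ofReal (2 * Real.exp (-(a 0 / 2 * h * x ^ α 0))) * D (Ioi x) := by
      -- The substitution `z = (1 + h) * y` compares the two tails pointwise; its Jacobian `1 + h ≤
      -- 2` is the factor `2` of the bound.
      rw [hden _ (hx.trans hxh), hden x hx, lintegral_Ioi_mul_left (by linarith)]
      calc _ ≤ ENNReal.ofReal 2 * ∫⁻ y in Ioi x,
            ENNReal.ofReal (Real.exp (-(a 0 / 2 * h * x ^ α 0))) *
              ENNReal.ofReal (Real.exp (-g y)) := by
            refine mul_le_mul' (ENNReal.ofReal_le_ofReal (by linarith)) ?_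
            refine setLIntegral_mono' measurableSet_Ioi fun y hy => ?_
            rw [← ENNReal.ofReal_mul (Real.exp_pos _).le, ← Real.exp_add]
            exact ENNReal.ofReal_le_ofReal (Real.exp_le_exp.2 (by linarith [hgg y hy]))
        _ = _ := by
            rw [lintegral_const_mul' _ _ ENNReal.ofReal_ne_top, ← mul_assoc,
              ← ENNReal.ofReal_mul (by norm_num)]
    have := ENNReal.toReal_mono (by finiteness) hle
    rwa [ENNReal.toReal_mul, ENNReal.toReal_ofReal (by positivity)] at this

end Tail

/-! ### Thresholds at the scale of the maximum of about `n` multipliers. -/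

section Thresholds

open Filter Topology Asymptotics
open scoped ENNReal

theorem eventually_log_pow_le {c : ℝ} (hc : 0 < c) (k : ℕ) {r : ℝ} (hr : 0 < r) (C : ℝ) :
    ∀ᶠ L : ℝ in atTop, C * Real.log L ^ k ≤ c * L ^ r := by
  have h := (isLittleO_log_rpow_rpow_atTop (k : ℝ) hr).def
    (c := c / (|C| + 1)) (by positivity)
  filter_upwards [h, eventually_ge_atTop 1] with L hL hL1
  have h0 : 0 ≤ Real.log L := Real.log_nonneg hL1
  rw [Real.rpow_natCast, Real.norm_of_nonneg (by positivity),
    Real.norm_of_nonneg (by positivity), div_mul_eq_mul_div, le_div_iff₀ (by positivity)] at hL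
  have h1 : C * Real.log L ^ k ≤ (|C| + 1) * Real.log L ^ k :=
    mul_le_mul_of_nonneg_right (by linarith [le_abs_self C]) (by positivity)
  linarith

theorem eventually_log_pow_le_mul {c : ℝ} (hc : 0 < c) (k : ℕ) (C : ℝ) :
    ∀ᶠ L : ℝ in atTop, C * Real.log L ^ k ≤ c * L := by
  simpa using eventually_log_pow_le hc k one_pos C

theorem eventually_pow_mul_exp_neg_le {c : ℝ} (hc : 0 < c) (k : ℕ) :
    ∀ᶠ L : ℝ in atTop, L ^ k * Real.exp (-L) ≤ c :=
  (Real.tendsto_pow_mul_exp_neg_atTop_nhds_zero k).eventually (ge_mem_nhds hc)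

variable {D : Measure ℝ} [IsProbabilityMeasure D]

theorem tendsto_real_Ioi_atTop : Tendsto (fun x => D.real (Ioi x)) atTop (𝓝 0) := by
  have h := (ProbabilityTheory.tendsto_cdf_atTop D).const_sub 1
  rw [sub_self] at h
  refine h.congr fun x => ?_
  rw [ProbabilityTheory.cdf_eq_real, ← compl_Iic, probReal_compl_eq_one_sub measurableSet_Iic]

theorem antitone_real_Ioi : Antitone fun x => D.real (Ioi x) :=
  fun _ _ h => measureReal_mono (Ioi_subset_Ioi h)

/-- Let `s` be the point where the tail falls below `p = L ^ 2 * exp (-L)`. Slightly below `s` the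
tail is at least `p`. Slightly above, it decays by a factor `exp (-(b * h * y ^ A))`, and since `y ^
A` has order at least `L`, a relative step `h` of order `1 / (log L) ^ 2` already gains any fixed
power of `L`. -/
theorem eventually_exists_thresholds_of_tail_bounds {x₁ A K b C γ : ℝ} (hx₁ : 1 ≤ x₁)
    (hA : 1 ≤ A) (hb : 0 < b) (hC : 0 < C) (hγ : 0 < γ)
    (hlow : ∀ x ≥ x₁, Real.exp (-(C * x ^ A)) ≤ D.real (Ioi x))
    (hup : ∀ x ≥ x₁, ∀ h : ℝ, 0 < h → h ≤ 1 → K ≤ h * x ^ γ →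
        D.real (Ioi ((1 + h) * x)) ≤ 2 * Real.exp (-(b * h * x ^ A)) * D.real (Ioi x)) :
    ∀ᶠ L : ℝ in atTop, ∃ M M' : ℝ, 0 < M ∧ 0 ≤ M' ∧ (1 - 1 / Real.log L ^ 2) * M' ≤ M ∧
      L ^ 2 * Real.exp (-L) ≤ D.real (Ioi M) ∧ D.real (Ioi M') ≤ Real.exp (-L) / L ^ 3 := by
  have hA0 : 0 < A := by linarith
  have hG1 : 0 < D.real (Ioi x₁) := (Real.exp_pos _).trans_le (hlow x₁ le_rfl)
  filter_upwards [eventually_pow_mul_exp_neg_le hG1 2,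
    eventually_log_pow_le_mul (c := 1 / 4) (by norm_num) 1 1,
    eventually_log_pow_le (c := (1 / (2 * C)) ^ (γ / A)) (by positivity) 2
      (div_pos hγ hA0) (4 * K),
    eventually_log_pow_le_mul one_pos 3 (6 * (8 * C / b)),
    eventually_ge_atTop (Real.exp 1)] with L e1 e2 e3 e4 hL
  have hL0 : 0 < L := (Real.exp_pos 1).trans_le hL
  have hl1 : 1 ≤ Real.log L := (Real.le_log_iff_exp_le hL0).2 hL
  set l := Real.log L
  set p := L ^ 2 * Real.exp (-L) with hp
  have hp0 : 0 < p := by positivity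
  set h := 1 / (4 * l ^ 2) with hh
  have hh0 : 0 < h := by positivity
  have hl2 : 1 ≤ l ^ 2 := one_le_pow₀ hl1
  have hh1 : h ≤ 1 / 4 := by
    rw [hh]; exact one_div_le_one_div_of_le (by norm_num) (by linarith)
  set V := {x | x₁ ≤ x ∧ p ≤ D.real (Ioi x)} with hV
  have hne : V.Nonempty := ⟨x₁, le_rfl, e1⟩
  have hbdd : BddAbove V := by
    obtain ⟨y, hy⟩ := ((tendsto_real_Ioi_atTop (D := D)).eventually (gt_mem_nhds hp0)).exists
    refine ⟨y, fun x hx => ?_⟩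
    by_contra! hlt
    exact absurd (hx.2.trans (antitone_real_Ioi hlt.le)) (not_le.2 hy)
  set s := sSup V
  have hs1 : x₁ ≤ s := le_csSup hbdd ⟨le_rfl, e1⟩
  have hs0 : 0 < s := by linarith
  set y := (1 + h) * s with hy
  have hsy : s < y := by nlinarith
  have hGy : D.real (Ioi y) < p := by
    by_contra! hge
    exact absurd (le_csSup hbdd ⟨hs1.trans hsy.le, hge⟩) (not_le.2 hsy)
  have hy0 : 0 < y := hs0.trans hsy
  -- The tail at `y` is below `p`, so the lower tail bound forces `y` to be large.
  have hyA : L / (2 * C) ≤ y ^ A := by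
    have h1 := (hlow y (hs1.trans hsy.le)).trans_lt hGy
    have h2 := (Real.lt_log_iff_exp_lt hp0).2 h1
    rw [hp, Real.log_mul (by positivity) (Real.exp_pos _).ne', Real.log_pow, Real.log_exp] at h2
    rw [div_le_iff₀ (by positivity)]
    push_cast at h2
    change 1 * l ^ 1 ≤ _ at e2
    change _ < 2 * l + -L at h2
    linarith
  have hyγ : K ≤ h * y ^ γ := by
    have h1 : (1 / (2 * C)) ^ (γ / A) * L ^ (γ / A) ≤ y ^ γ := by
      rw [← Real.mul_rpow (by positivity) hL0.le]
      calc _ ≤ (y ^ A) ^ (γ / A) := by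
            refine Real.rpow_le_rpow (by positivity) ?_ (by positivity)
            rw [one_div_mul_eq_div]; exact hyA
        _ = y ^ γ := by
            rw [← Real.rpow_mul hy0.le, mul_div_cancel₀ _ hA0.ne']
    have h2 : 4 * K * l ^ 2 ≤ y ^ γ := e3.trans h1
    rw [hh, one_div_mul_eq_div, le_div_iff₀ (by positivity)]
    linarith
  have hfin := hup y (hs1.trans hsy.le) h hh0 (by linarith) hyγ
  have hexp : 5 * l + 1 ≤ b * h * y ^ A := by
    have h1 : b * h * (L / (2 * C)) ≤ b * h * y ^ A := mul_le_mul_of_nonneg_left hyA (by positivity)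
    refine le_trans ?_ h1
    have h2 : b * h * (L / (2 * C)) = L / (8 * C / b * l ^ 2) := by
      rw [hh]; field_simp; ring
    rw [h2, le_div_iff₀ (by positivity)]
    have h3 : (5 * l + 1) * (8 * C / b * l ^ 2) ≤ (6 * l) * (8 * C / b * l ^ 2) :=
      mul_le_mul_of_nonneg_right (by linarith) (by positivity)
    change _ * l ^ 3 ≤ _ at e4
    nlinarith
  have htwo : 2 * Real.exp (-(b * h * y ^ A)) ≤ 1 / L ^ 5 := by
    have h1 : Real.exp (-(b * h * y ^ A)) ≤ Real.exp (-1) * Real.exp (-(5 * l)) := by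
      rw [← Real.exp_add]; exact Real.exp_le_exp.2 (by linarith)
    have h2 : Real.exp (-(5 * l)) = 1 / L ^ 5 := by
      rw [Real.exp_neg, one_div, show (5 : ℝ) * l = ((5 : ℕ) : ℝ) * l by norm_num,
        Real.exp_nat_mul, Real.exp_log hL0]
    rw [h2] at h1
    have h3 := mul_lt_mul_of_pos_right Real.exp_neg_one_lt_half (by positivity : 0 < 1 / L ^ 5)
    linarith
  -- The ratio condition reads `(1 - 4 * h) * (1 + h) ^ 2 ≤ 1 - h`. The first factor `1 + h` brings
  -- the tail below `p`, the second gains `L ^ (-5)`.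
  refine ⟨(1 - h) * s, (1 + h) * y, mul_pos (by linarith) hs0, by positivity, ?_, ?_, ?_⟩
  · have e : 1 / l ^ 2 = 4 * h := by rw [hh]; field_simp
    rw [e, hy, ← mul_assoc, ← mul_assoc]
    refine mul_le_mul_of_nonneg_right ?_ hs0.le
    have h3 : 0 ≤ h ^ 3 := by positivity
    nlinarith
  · obtain ⟨x, hx, hxs⟩ := exists_lt_of_lt_csSup hne
      (show (1 - h) * s < s by nlinarith)
    exact hx.2.trans (antitone_real_Ioi hxs.le)
  · calc _ ≤ _ := hfin
      _ ≤ 1 / L ^ 5 * p := mul_le_mul htwo hGy.le measureReal_nonneg (by positivity)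
      _ = _ := by rw [hp]; field_simp

/-- The two cases for the upper end of a distribution with generalized exponential tail: either a
bounded distribution with enough mass close to its supremum, or an unbounded one with thresholds at
the scale of the maximum of about `exp L` independent copies. -/
theorem HasGeneralizedExponentialTail.eventually_exists_thresholds
    (hD : HasGeneralizedExponentialTail D) (hint : Integrable (fun x : ℝ => x) D)
    (hmean : 0 < ∫ x, x ∂D) :
    ∃ a : ℝ, ∀ᶠ L : ℝ in atTop, ∃ M M' : ℝ, 0 < M ∧ 0 ≤ M' ∧
      (1 - 1 / Real.log L ^ 2) * M' ≤ M ∧ L ^ 2 * Real.exp (-L) ≤ D.real (Ioi M) ∧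
      (D.real (Ioi M') = 0 ∨ D.real (Ioi M') ≤ Real.exp (-L) / L ^ 3 ∧
        0 < D.real (Iic a) * D.real (Ici (a + 1))) := by
  rcases hD with ⟨x₀, a, α, g, -, hα, hα0, ha, hα1, hg, hden⟩ | ⟨b, χ, hbχ, -, hχ⟩
  · obtain ⟨x₁, A, K, b, C, γ, hx₁, hA, hb, hC, hγ, hlow, hup⟩ :=
      exists_tail_bounds hα hα0 ha hα1 hg hden
    -- The level `a` must have mass at most `a` and at least `a + 1`, so that raising has an effect.
    obtain ⟨z, hz1, hz2⟩ := (((tendsto_real_Ioi_atTop (D := D)).eventually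
      (gt_mem_nhds one_pos)).and (eventually_ge_atTop x₁)).exists
    refine ⟨z, ?_⟩
    filter_upwards [eventually_exists_thresholds_of_tail_bounds hx₁ hA hb hC hγ hlow hup]
      with L hL
    obtain ⟨M, M', h1, h2, h3, h4, h5⟩ := hL
    refine ⟨M, M', h1, h2, h3, h4, Or.inr ⟨h5, mul_pos ?_ ?_⟩⟩
    · rw [← compl_Ioi, probReal_compl_eq_one_sub measurableSet_Ioi]
      linarith
    · exact ((Real.exp_pos _).trans_le (hlow (z + 1) (by linarith))).trans_le
        (measureReal_mono Ioi_subset_Ici_self)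
  · have hIoi : D (Ioi χ) = 0 := measure_mono_null (t := (Icc b χ)ᶜ)
      (fun x hx h => not_le.2 (mem_Ioi.1 hx) (mem_Icc.1 h).2) hbχ
    have hle : ∀ᵐ x ∂D, x ≤ χ := by
      rw [ae_iff]
      simp only [not_le]
      exact hIoi
    -- This uses the positive mean; relative thresholds around `χ` would be useless otherwise.
    have hχ0 : 0 < χ := by
      have := integral_mono_ae hint (integrable_const χ) hle
      rw [integral_const, probReal_univ, one_smul] at this
      linarith
    obtain ⟨c, h₀, hc, hh₀, hmass⟩ : ∃ c h₀ : ℝ, 0 < c ∧ 0 < h₀ ∧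
        ∀ h : ℝ, 0 < h → h ≤ h₀ → c * h ≤ D.real (Ioi ((1 - h) * χ)) := by
      rcases hχ with hatom | ⟨y, hy, p, -, hden, hcont, hpos⟩
      · refine ⟨D.real {χ}, 1, ENNReal.toReal_pos hatom.ne' (measure_ne_top _ _), one_pos,
          fun h hh0 hh1 => ?_⟩
        calc D.real {χ} * h ≤ D.real {χ} := mul_le_of_le_one_right measureReal_nonneg hh1
          _ ≤ _ := measureReal_mono (singleton_subset_iff.2
              (mem_Ioi.2 (by nlinarith)))
      · have hev : ∀ᶠ x in 𝓝[≤] χ, p χ / 2 < p x :=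
          hcont.eventually (lt_mem_nhds (by linarith))
        obtain ⟨z, hz, hzp⟩ := (mem_nhdsLE_iff_exists_Ioc_subset' hy).1 hev
        set u := max y z
        have hu : u < χ := max_lt hy hz
        refine ⟨p χ / 2 * χ, (χ - u) / χ, by positivity, div_pos (by linarith) hχ0,
          fun h hh0 hh1 => ?_⟩
        rw [le_div_iff₀ hχ0] at hh1
        have hlow : u ≤ (1 - h) * χ := by linarith
        have hsub : Ioc ((1 - h) * χ) χ ⊆ Ioc y χ :=
          Ioc_subset_Ioc_left ((le_max_left _ _).trans hlow)
        have h1 : ENNReal.ofReal (p χ / 2 * χ * h) ≤ D (Ioc ((1 - h) * χ) χ) := by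
          rw [measure_eq_lintegral_of_restrict_eq hden measurableSet_Ioc hsub]
          calc ENNReal.ofReal (p χ / 2 * χ * h)
              = ∫⁻ _ in Ioc ((1 - h) * χ) χ, ENNReal.ofReal (p χ / 2) := by
                rw [setLIntegral_const, Real.volume_Ioc, ← ENNReal.ofReal_mul (by linarith)]
                congr 1; ring
            _ ≤ _ := setLIntegral_mono' measurableSet_Ioc fun x hx =>
                ENNReal.ofReal_le_ofReal (hzp ⟨((le_max_right _ _).trans hlow).trans_lt hx.1,
                  hx.2⟩ : p χ / 2 < p x).le
        exact ((ENNReal.ofReal_le_iff_le_toReal (measure_ne_top _ _)).1 h1).trans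
          (measureReal_mono Ioc_subset_Ioi_self)
    refine ⟨0, ?_⟩
    have hloginf := Real.tendsto_log_atTop.eventually (eventually_ge_atTop (1 / h₀ + 2))
    filter_upwards [hloginf, eventually_pow_mul_exp_neg_le hc 4, eventually_ge_atTop 1]
      with L hlog hexp hL1
    have hL0 : 0 < L := by linarith
    set l := Real.log L
    have hh : 0 < 1 / h₀ := by positivity
    have hl1 : 1 < l := by linarith
    have hl2 : l ≤ l ^ 2 := by nlinarith
    have hη0 : 0 < 1 / l ^ 2 := by positivity
    have hη1 : 1 / l ^ 2 < 1 := by rw [div_lt_one (by positivity)]; linarith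
    have hη2 : 1 / l ^ 2 ≤ h₀ := by
      rw [div_le_iff₀ (by positivity)]
      have h1 : 1 / h₀ ≤ l ^ 2 := by linarith
      rw [div_le_iff₀ hh₀] at h1
      linarith
    refine ⟨(1 - 1 / l ^ 2) * χ, χ, mul_pos (by linarith) hχ0, hχ0.le, le_rfl, ?_,
      Or.inl (by rw [Measure.real, hIoi]; rfl)⟩
    refine le_trans ?_ (hmass _ hη0 hη2)
    rw [mul_one_div, le_div_iff₀ (by positivity)]
    have h1 : l ^ 2 ≤ L ^ 2 := pow_le_pow_left₀ (by linarith)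
      ((Real.log_le_sub_one_of_pos hL0).trans (by linarith)) 2
    calc _ ≤ L ^ 2 * Real.exp (-L) * L ^ 2 := by gcongr
      _ = L ^ 4 * Real.exp (-L) := by ring
      _ ≤ c := hexp

end Thresholds

/-! ### Asymptotic inequalities, and the selection system of one iteration. -/

section StepFailure

open Filter Topology

theorem eventually_mul_rpow_le {C c r s : ℝ} (hc : 0 < c) (hrs : r < s) :
    ∀ᶠ x : ℝ in atTop, C * x ^ r ≤ c * x ^ s := by
  filter_upwards [(tendsto_rpow_atTop (sub_pos.2 hrs)).eventually (eventually_ge_atTop (C / c)),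
    eventually_gt_atTop 0] with x hx hx0
  rw [div_le_iff₀ hc] at hx
  have e : x ^ s = x ^ (s - r) * x ^ r := by rw [← Real.rpow_add hx0]; congr 1; ring
  rw [e]
  have := mul_le_mul_of_nonneg_right hx (Real.rpow_nonneg hx0.le r)
  linarith

theorem eventually_growth (c : ℕ) {μ q : ℝ} (hμ : 0 < μ) (hq : 0 < q) (C C₂ : ℝ) :
    ∀ᶠ x : ℝ in atTop, 2 ≤ x ∧ C ≤ x ∧ 6 ≤ Real.log (Real.log x) ∧
      2 * C₂ * Real.log (Real.log x) ^ 2 ≤ μ * x ^ (1 / 10 : ℝ) ∧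
      32 * x ^ (1 / 10 : ℝ) ≤ μ * (8 * x) ∧
      (2 * c + 3) * Real.log x * Real.log (Real.log x) ^ 4 ≤ μ ^ 2 * x ^ (4 / 5 : ℝ) ∧
      2 * c + 3 ≤ Real.log x ∧
      (2 * c + 3) * Real.log x + 2 * c ≤ x ^ (1 / 10 : ℝ) ∧
      5 * x ^ (1 / 10 : ℝ) ≤ q * x ^ (1 / 4 : ℝ) ∧
      8 * Real.log x ^ 2 ≤ x ∧ 16 * c ≤ Real.log x := by
  have hlog := Real.tendsto_log_atTop
  have e1 := (hlog.comp hlog).eventually (eventually_ge_atTop 6)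
  have e2 := hlog.eventually (eventually_ge_atTop (2 * c + 3 : ℝ))
  have e3 := hlog.eventually (eventually_ge_atTop (16 * c : ℝ))
  have e4 := eventually_log_pow_le hμ 2 (r := 1 / 10) (by norm_num) (2 * |C₂|)
  have e5 := eventually_mul_rpow_le (C := 32) (c := 8 * μ) (r := 1 / 10) (s := 1)
    (by positivity) (by norm_num)
  have e6 := eventually_log_pow_le (pow_pos hμ 2) 5 (r := 4 / 5) (by norm_num) (2 * c + 3)
  have e7 := eventually_log_pow_le one_pos 1 (r := 1 / 10) (by norm_num) (4 * c + 3)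
  have e8 := eventually_mul_rpow_le (C := 5) (c := q) (r := 1 / 10) (s := 1 / 4) hq (by norm_num)
  have e9 := eventually_log_pow_le one_pos 2 (r := 1) (by norm_num) 8
  filter_upwards [eventually_ge_atTop 2, eventually_ge_atTop C, e1, e2, e3, e4, e5, e6, e7, e8, e9]
    with x h2 hC h1 h3 h4 h5 h6 h7 h8 h9 h10
  simp only [Function.comp_apply] at h1
  have hL1 : 1 ≤ Real.log x := by
    have : (0 : ℝ) ≤ c := Nat.cast_nonneg c
    linarith
  have hlL : Real.log (Real.log x) ≤ Real.log x :=
    (Real.log_le_sub_one_of_pos (by linarith)).trans (by linarith)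
  rw [Real.rpow_one] at h6 h10
  refine ⟨h2, hC, h1, ?_, by linarith, ?_, h3, ?_, h9, by linarith, h4⟩
  · refine le_trans ?_ h5
    have h11 : Real.log (Real.log x) ^ 2 ≤ Real.log x ^ 2 :=
      pow_le_pow_left₀ (by linarith) hlL 2
    have h12 : C₂ * Real.log (Real.log x) ^ 2 ≤ |C₂| * Real.log x ^ 2 :=
      mul_le_mul (le_abs_self _) h11 (by positivity) (abs_nonneg _)
    linarith
  · refine le_trans ?_ h7
    have h11 : Real.log (Real.log x) ^ 4 ≤ Real.log x ^ 4 :=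
      pow_le_pow_left₀ (by linarith) hlL 4
    calc _ ≤ (2 * c + 3) * Real.log x * Real.log x ^ 4 :=
          mul_le_mul_of_nonneg_left h11 (by positivity)
      _ = _ := by ring
  · rw [pow_one, one_mul] at h8
    have : (0 : ℝ) ≤ c := Nat.cast_nonneg c
    nlinarith

/-- The two factors `x ^ c` pay for two nested union bounds over candidates: one over the maximizer,
one over its rivals. -/
theorem pow_mul_pow_mul_exp_neg_le {c : ℕ} {x X : ℝ} (hx : 2 ≤ x)
    (hX : (2 * c + 3) * Real.log x ≤ X) : x ^ c * (x ^ c * (2 * Real.exp (-X))) ≤ 1 / x := by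
  have hx0 : 0 < x := by linarith
  have h1 : Real.exp (-X) ≤ (x ^ (2 * c + 3))⁻¹ := by
    rw [Real.exp_neg]
    refine inv_anti₀ (by positivity) ?_
    calc x ^ (2 * c + 3) = Real.exp ((2 * c + 3 : ℕ) * Real.log x) := by
          rw [Real.exp_nat_mul, Real.exp_log hx0]
      _ ≤ _ := Real.exp_le_exp.2 (by push_cast; exact hX)
  calc x ^ c * (x ^ c * (2 * Real.exp (-X)))
      ≤ x ^ c * (x ^ c * (2 * (x ^ (2 * c + 3))⁻¹)) := by gcongr
    _ = 2 / x ^ 3 := by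
        rw [show 2 * c + 3 = c + (c + 3) by ring, pow_add, pow_add]; field_simp
    _ ≤ 1 / x := by
        rw [div_le_div_iff₀ (by positivity) hx0]
        have := pow_le_pow_left₀ (by norm_num) hx 2
        nlinarith

variable {D : Measure ℝ} [IsProbabilityMeasure D]

theorem real_lt_abs_le_div {R : ℝ} (hR : 0 < R) (p : ℕ)
    (hp : Integrable (fun x : ℝ => |x| ^ p) D) :
    D.real {x | R < |x|} ≤ (∫ x, |x| ^ p ∂D) / R ^ p := by
  rw [le_div_iff₀ (by positivity), mul_comm]
  refine le_trans ?_ (mul_meas_ge_le_integral_of_nonneg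
    (ae_of_all _ fun x => by positivity) hp (R ^ p))
  refine mul_le_mul_of_nonneg_left (measureReal_mono fun x hx => ?_) (by positivity)
  exact pow_le_pow_left₀ hR.le (le_of_lt hx) p

/-- Markov's inequality with a moment whose order grows with `c`: at level `x ^ (1/10)` it yields
the denominator `x ^ (2 * c + 2)`. -/
theorem pow_mul_pow_mul_real_lt_abs_le {c : ℕ} {x : ℝ} (hx : 2 ≤ x)
    (hp : Integrable (fun x : ℝ => |x| ^ (10 * (2 * c + 2))) D)
    (hC : ∫ x, |x| ^ (10 * (2 * c + 2)) ∂D ≤ x) :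
    x ^ c * (x ^ c * D.real {y | x ^ (1 / 10 : ℝ) < |y|}) ≤ 1 / x := by
  have hx0 : 0 < x := by linarith
  have h1 := real_lt_abs_le_div (D := D) (R := x ^ (1 / 10 : ℝ)) (by positivity)
    (10 * (2 * c + 2)) hp
  have h2 : (x ^ (1 / 10 : ℝ)) ^ (10 * (2 * c + 2)) = x ^ (2 * c + 2) := by
    rw [pow_mul, ← Real.rpow_natCast (x ^ (1 / 10 : ℝ)) 10, ← Real.rpow_mul hx0.le]
    norm_num
  rw [h2] at h1
  calc _ ≤ x ^ c * (x ^ c * (x / x ^ (2 * c + 2))) := by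
        gcongr
        exact h1.trans (by gcongr)
    _ = _ := by
        rw [show 2 * c + 2 = c + (c + 2) by ring, pow_add, pow_add]; field_simp

variable {n : ℕ}

/-- The selection problem which an iteration of SM-Greedy solves. -/
noncomputable def stepSystem {f : Finset (Fin n) → ℝ} (hm : Monotone f) (hf : Submodular f)
    (h0 : 0 ≤ f ∅) {c : ℕ} (hc : 8 ≤ c) {S : Finset (Fin n)} (hS : 2 * (S.card + c) ≤ n)
    (hW : 0 < bundleMax f c S) (hSc : 0 < n - (S.card + c)) :
    SelectionSystem (Finset (Fin n)) (Finset (Fin n)) where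
  𝒜 := bundles c S
  Nb := neighbors S
  w := f
  m := c * (n - (S.card + c))
  W := bundleMax f c S
  v := (bundleMax f c S - f S) / c
  𝒯 := (bundles c S).image (S ∪ ·)
  card_Nb _ hA := card_neighbors hA
  card_inter A hA B hB hAB s hsA hsB := by
    -- Since `c ≤ n - (|S| + c)`, the overlap is at most `2 * (n - (|S| + c))`; four times this is
    -- at most `m` because `c ≥ 8`.
    have h1 := (Finset.card_le_card (Finset.subset_inter hsA hsB)).trans
      (card_neighbors_inter_le hA hB hAB)
    have h2 : 8 * (n - (S.card + c)) ≤ c * (n - (S.card + c)) := Nat.mul_le_mul_right _ hc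
    omega
  Nb_subset A hA T hT := by
    obtain ⟨B, hB, rfl⟩ := exists_of_mem_neighbors hA hT
    exact Finset.mem_image_of_mem _ hB
  m_pos := Nat.mul_pos (by omega) hSc
  w_nonneg T := h0.trans (hm (Finset.empty_subset T))
  w_le A hA T hT := by
    obtain ⟨B, hB, rfl⟩ := exists_of_mem_neighbors hA hT
    exact (bundleMax_spec f (by omega)).2 B hB
  W_pos := hW
  v_nonneg := by
    obtain ⟨⟨A, hA, h⟩, -⟩ := bundleMax_spec f (c := c) (S := S) (by omega)
    rw [h]
    exact div_nonneg (sub_nonneg.2 (hm Finset.subset_union_left)) (Nat.cast_nonneg c)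
  v_le := by
    have h1 : 0 ≤ f S := h0.trans (hm (Finset.empty_subset S))
    have hc' : (8 : ℝ) ≤ c := by exact_mod_cast hc
    rw [div_le_div_iff₀ (by linarith) (by norm_num)]
    nlinarith
  exists_le_sum := by
    obtain ⟨⟨A, hA, h⟩, -⟩ := bundleMax_spec f (c := c) (S := S) (by omega)
    refine ⟨A, hA, le_trans (le_of_eq ?_) (hf.le_sum_neighbors hm hA)⟩
    have hc' : (c : ℝ) ≠ 0 := by exact_mod_cast (by omega : c ≠ 0)
    rw [← h]
    push_cast
    field_simp

theorem card_bundles_le (c : ℕ) (S : Finset (Fin n)) : ((bundles c S).card : ℝ) ≤ (n : ℝ) ^ c := by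
  have : (bundles c S).card ≤ n ^ c := by
    rw [bundles, Finset.card_powersetCard]
    exact (Nat.choose_le_pow _ _).trans (Nat.pow_le_pow_left (card_finset_fin_le _) _)
  exact_mod_cast this

end StepFailure

/-! ### Failure probability of one iteration from a fixed solution. -/

section StepBound

open Filter Topology

-- Here `x` stands for `n`, and the parameters are `R = x ^ (1/10)`, `ρ = x ^ (-3/4)` and `l = R` in
-- `real_nearMax_le`. With `m` of order `x`: `m / R ^ 2` has order `x ^ (4/5)`, so Hoeffding beats
-- any power of `x`; `(R * ρ) ^ 2 * m` has order `x ^ (-3/10)`, so the change of measure costs a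
-- constant; `ρ * m` has order `x ^ (1/4)`, which beats `R`. The dominant error is the spike term,
-- of order `m / (x * L ^ 3)`.
set_option maxHeartbeats 1000000 in
theorem SelectionSystem.real_badSelection_le_of_growth {ι β : Type*} [Fintype ι]
    (s : SelectionSystem ι β) {D : Measure ℝ} [IsProbabilityMeasure D]
    (hint : ∀ p : ℕ, Integrable (fun x : ℝ => |x| ^ p) D) {a q : ℝ} {c : ℕ}
    (hμ : 0 < ∫ x, x ∂D) {x : ℝ} (hx2 : 2 ≤ x)
    (hxC : ∫ y, |y| ^ (10 * (2 * c + 2)) ∂D ≤ x)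
    (hll : 6 ≤ Real.log (Real.log x))
    (hg1 : 2 * (∫ y, y ^ 2 ∂D) * Real.log (Real.log x) ^ 2 ≤ (∫ x, x ∂D) * x ^ (1 / 10 : ℝ))
    (hg2 : 32 * x ^ (1 / 10 : ℝ) ≤ (∫ x, x ∂D) * (8 * x))
    (hg3 : (2 * c + 3) * Real.log x * Real.log (Real.log x) ^ 4 ≤
      (∫ x, x ∂D) ^ 2 * x ^ (4 / 5 : ℝ))
    (hg4 : 2 * c + 3 ≤ Real.log x)
    (hg5 : (2 * c + 3) * Real.log x + 2 * c ≤ x ^ (1 / 10 : ℝ))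
    (hg6 : 5 * x ^ (1 / 10 : ℝ) ≤ q * x ^ (1 / 4 : ℝ))
    (hg7 : 8 * Real.log x ^ 2 ≤ x) (hg8 : 16 * c ≤ Real.log x)
    {M M' : ℝ} (hM : 0 < M) (hM'0 : 0 ≤ M') (hMM' : (1 - 1 / Real.log (Real.log x) ^ 2) * M' ≤ M)
    (hMlow : Real.log x ^ 2 * Real.exp (-Real.log x) ≤ D.real (Ioi M))
    (hM' : D.real (Ioi M') = 0 ∨ D.real (Ioi M') ≤ Real.exp (-Real.log x) / Real.log x ^ 3 ∧
        q = D.real (Iic a) * D.real (Ici (a + 1)))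
    (hm1 : 8 * x ≤ s.m) (hm2 : s.m ≤ c * x) (h𝒜 : (s.𝒜.card : ℝ) ≤ x ^ c)
    (h𝒯 : (s.𝒯.card : ℝ) ≤ x ^ c) :
    (Measure.pi fun _ : ι => D).real (badSelection s.𝒜 s.Nb s.w
      (s.W - 2 * s.v - 6 * (1 / Real.log (Real.log x) ^ 2) * s.W)) ≤ 1 / Real.log x ^ 2 := by
  set L := Real.log x with hL
  set l := Real.log L with hl
  set η := 1 / l ^ 2 with hη
  set μ := ∫ x, x ∂D with hμdef
  have hx0 : 0 < x := by linarith
  have hcpos : (0 : ℝ) ≤ c := Nat.cast_nonneg c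
  have hL3 : 3 ≤ L := by linarith
  have hη0 : 0 < η := by positivity
  have hη1 : η ≤ 1 / 32 := by
    rw [hη]; exact one_div_le_one_div_of_le (by norm_num)
      (by linarith only [pow_le_pow_left₀ (by norm_num) hll 2])
  set R := x ^ (1 / 10 : ℝ) with hR
  have hR0 : 0 < R := by positivity
  have hR1 : 1 ≤ R := Real.one_le_rpow (by linarith) (by norm_num)
  set ρ := x ^ (-(3 / 4) : ℝ) with hρ
  have hρ0 : 0 < ρ := by positivity
  have hρ1 : ρ ≤ 1 := Real.rpow_le_one_of_one_le_of_nonpos (by linarith) (by norm_num)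
  have hexpL : Real.exp (-L) = 1 / x := by rw [Real.exp_neg, hL, Real.exp_log hx0, one_div]
  set N := x ^ c with hN
  have hN1 : 1 ≤ N := one_le_pow₀ (by linarith)
  have hN0 : 0 ≤ N := by linarith
  have hclamp : |∫ y, clamp R y ∂D - μ| ≤ η * μ / 2 := by
    have hi1 : Integrable (fun y : ℝ => y) D := by
      have := hint 1
      simp only [pow_one] at this
      exact (integrable_norm_iff aestronglyMeasurable_id).1 this
    have hi2 : Integrable (fun y : ℝ => y ^ 2) D := by simpa only [sq_abs] using hint 2
    refine (abs_integral_clamp_sub_le hR0 hi1 hi2).trans ?_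
    rw [hη, div_le_iff₀ hR0, one_div_mul_eq_div, div_div, div_mul_eq_mul_div,
      le_div_iff₀ (by positivity)]
    linarith
  set ν := 1 / x with hν
  set t := D.real {y | R < |y|} with ht
  have ht0 : 0 ≤ t := measureReal_nonneg
  have hT : N * (N * t) ≤ ν := pow_mul_pow_mul_real_lt_abs_le hx2 (hint _) hxC
  set e₁ := 2 * Real.exp (-((η * μ) ^ 2 * s.m / (8 * R ^ 2))) with he₁
  have hE1 : N * (N * e₁) ≤ ν := by
    refine pow_mul_pow_mul_exp_neg_le hx2 ?_
    have hR2 : R ^ 2 * x ^ (4 / 5 : ℝ) = x := by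
      rw [hR, ← Real.rpow_natCast, ← Real.rpow_mul hx0.le, ← Real.rpow_add hx0]
      norm_num
    have h1 : (η * μ) ^ 2 * (8 * x) / (8 * R ^ 2) ≤ (η * μ) ^ 2 * s.m / (8 * R ^ 2) := by gcongr
    refine le_trans ?_ h1
    have h2 : (η * μ) ^ 2 * (8 * x) / (8 * R ^ 2) = μ ^ 2 * x ^ (4 / 5 : ℝ) / l ^ 4 := by
      nth_rewrite 1 [← hR2]
      rw [hη]
      field_simp
    rw [h2, le_div_iff₀ (by positivity)]
    exact hg3
  set e₂ := Real.exp (4 * R - ρ * (D.real (Iic a) * D.real (Ici (a + 1))) / 2 * (s.m / 4)) with he₂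
  set V := Real.exp (((1 + R) * ρ) ^ 2 / 2 * s.m - R) with hV
  have hNV : N * (N * (2 * V)) ≤ ν := by
    rw [hV, ← neg_sub]
    refine pow_mul_pow_mul_exp_neg_le hx2 ?_
    have h1 : ((1 + R) * ρ) ^ 2 / 2 * s.m ≤ (2 * R * ρ) ^ 2 / 2 * (c * x) := by
      gcongr
      linarith
    have h2 : (R * ρ) ^ 2 * x ≤ 1 := by
      have : (R * ρ) ^ 2 * x = x ^ (-(3 / 10) : ℝ) := by
        rw [hR, hρ, ← Real.rpow_add hx0, ← Real.rpow_natCast, ← Real.rpow_mul hx0.le]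
        nth_rewrite 2 [← Real.rpow_one x]
        rw [← Real.rpow_add hx0]
        norm_num
      rw [this]
      exact Real.rpow_le_one_of_one_le_of_nonpos (by linarith) (by norm_num)
    have h3 := mul_le_mul_of_nonneg_left h2 hcpos
    linarith
  set e₃ := Real.exp (-(D.real (Ioi M) * (s.m / 2))) with he₃
  have hE3 : N * (N * (2 * e₃)) ≤ ν := by
    refine pow_mul_pow_mul_exp_neg_le hx2 ?_
    have h1 : L ^ 2 * Real.exp (-L) * (8 * x / 2) ≤ D.real (Ioi M) * (s.m / 2) := by gcongr
    refine le_trans ?_ h1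
    rw [hexpL]
    have : L ^ 2 * (1 / x) * (8 * x / 2) = 4 * L * L := by field_simp; ring
    rw [this]
    have h2 := mul_le_mul_of_nonneg_right hg4 (by linarith : 0 ≤ L)
    have h3 : 0 ≤ L * L := mul_self_nonneg L
    linarith only [h2, h3]
  have hdrop : ∀ z : ℝ, 0 ≤ z → N * z ≤ N * (N * z) := fun z hz =>
    mul_le_mul_of_nonneg_left (le_mul_of_one_le_left hz hN1) hN0
  have he₁0 : 0 ≤ e₁ := by positivity
  have he₂0 : 0 < e₂ := Real.exp_pos _
  have he₃0 : 0 < e₃ := Real.exp_pos _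
  have hV0 : 0 < V := Real.exp_pos _
  have hν0 : 0 < ν := by positivity
  have hν1 : ν ≤ 1 / 2 := one_div_le_one_div_of_le (by norm_num) hx2
  have hνL : 4 * ν ≤ 1 / 2 * (1 / L ^ 2) := by
    rw [hν, mul_one_div, mul_one_div, div_le_div_iff₀ hx0 (by positivity)]
    linarith
  have hcL : 8 * (c / L ^ 3) ≤ 1 / 2 * (1 / L ^ 2) := by
    rw [mul_div_assoc', mul_one_div, div_le_div_iff₀ (by positivity) (by positivity)]
    have := mul_le_mul_of_nonneg_right hg8 (by positivity : 0 ≤ L ^ 2)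
    linarith
  have hspike : (Measure.pi fun _ : ι => D).real (s.spike M') ≤ N * t + 8 * (c / L ^ 3) := by
    rcases hM' with h | ⟨hM', hq⟩
    · refine (s.real_spike_eq_zero h).le.trans ?_
      positivity
    · have hNe2 : N * (N * (2 * e₂)) ≤ ν := by
        rw [he₂, ← neg_sub (ρ * _ / 2 * _)]
        refine pow_mul_pow_mul_exp_neg_le hx2 ?_
        rw [← hq]
        have h1 : ρ * x = x ^ (1 / 4 : ℝ) := by
          rw [hρ]
          nth_rewrite 2 [← Real.rpow_one x]
          rw [← Real.rpow_add hx0]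
          norm_num
        have hq0 : 0 ≤ q := hq ▸ (by positivity)
        have h2 : ρ * q / 2 * (8 * x / 4) ≤ ρ * q / 2 * (s.m / 4) := by gcongr
        have h3 : ρ * q / 2 * (8 * x / 4) = q * x ^ (1 / 4 : ℝ) := by rw [← h1]; ring
        linarith
      have key := s.real_spike_le (D := D) (R := R) hM'0 fun A hA =>
        s.real_nearMax_le (a := a) hμ hη0 hη1 hR0 hclamp
          (hg2.trans (mul_le_mul_of_nonneg_left hm1 hμ.le)) hρ0.le hρ1 hR0.le hA
      refine key.trans (add_le_add (mul_le_mul_of_nonneg_right h𝒯 ht0) ?_)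
      have h1 : (s.m : ℝ) * D.real (Ioi M') ≤ c / L ^ 3 := by
        calc (s.m : ℝ) * D.real (Ioi M') ≤ (c * x) * (Real.exp (-L) / L ^ 3) :=
              mul_le_mul hm2 hM' measureReal_nonneg (by positivity)
          _ = c / L ^ 3 := by rw [hexpL, hν]; field_simp
      have h2 : Real.exp 1 + s.𝒜.card * ((V + s.𝒜.card * e₂ + (s.𝒯.card * t + s.𝒜.card * e₁)) + t) ≤
          8 := by
        have h3 : s.𝒜.card * ((V + s.𝒜.card * e₂ + (s.𝒯.card * t + s.𝒜.card * e₁)) + t) ≤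
            N * ((V + N * e₂ + (N * t + N * e₁)) + t) := by gcongr
        have h4 := hdrop V hV0.le
        have h5 := hdrop t ht0
        have h6 : 0 ≤ N * (N * e₂) := by positivity
        linarith [Real.exp_one_lt_d9]
      calc _ ≤ c / L ^ 3 * 8 := mul_le_mul h1 h2 (by positivity) (by positivity)
        _ = _ := mul_comm _ _
  have key := s.real_badSelection_le (D := D) hμ hη0 hη1 hR0 hclamp hM hMM' hspike
  refine key.trans ?_
  have h1 : s.𝒯.card * t ≤ N * t := mul_le_mul_of_nonneg_right h𝒯 ht0
  have h2 : s.𝒜.card * e₁ ≤ N * e₁ := mul_le_mul_of_nonneg_right h𝒜 he₁0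
  have h3 : s.𝒜.card * e₃ ≤ N * e₃ := mul_le_mul_of_nonneg_right h𝒜 he₃0.le
  have h4 := hdrop t ht0
  have h5 := hdrop e₁ he₁0
  have h6 := hdrop e₃ he₃0.le
  have h7 : 0 ≤ N * (N * e₃) := by positivity
  linarith

/-- One iteration of SM-Greedy which starts from `S` fails with small probability, provided that the
corresponding bound holds for selection systems of the right size. -/
theorem real_badSelection_le_of_selectionSystem {n : ℕ} {P : Measure (Finset (Fin n) → ℝ)}
    {c : ℕ} (hc : 16 ≤ c) (hn : 0 < n) {η δ : ℝ} (hδ : 0 ≤ δ)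
    (h : ∀ s : SelectionSystem (Finset (Fin n)) (Finset (Fin n)), 8 * (n : ℝ) ≤ s.m →
      s.m ≤ c * (n : ℝ) → (s.𝒜.card : ℝ) ≤ (n : ℝ) ^ c → (s.𝒯.card : ℝ) ≤ (n : ℝ) ^ c →
      P.real (badSelection s.𝒜 s.Nb s.w (s.W - 2 * s.v - 6 * η * s.W)) ≤ δ)
    {f : Finset (Fin n) → ℝ} (hm : Monotone f) (hf : Submodular f) (h0 : 0 ≤ f ∅)
    {S : Finset (Fin n)} (hS : 2 * (S.card + c) ≤ n) :
    P.real (badSelection (bundles c S) (neighbors S) f (stepValue f c η S)) ≤ δ := by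
  have hn2 : 0 < n - (S.card + c) := by omega
  have hspec := bundleMax_spec f (c := c) (S := S) (by omega)
  have hfS : 0 ≤ f S := h0.trans (hm (Finset.empty_subset S))
  have hfW : f S ≤ bundleMax f c S := by
    obtain ⟨⟨A, hA, h⟩, -⟩ := hspec
    rw [h]; exact hm Finset.subset_union_left
  -- A selection system needs `W > 0`. If `W = 0`, the target value is `0` and the iteration cannot
  -- fail.
  rcases (hfS.trans hfW).eq_or_lt with hW0 | hW
  · have hempty : badSelection (bundles c S) (neighbors S) f (stepValue f c η S) = ∅ := by
      refine eq_empty_of_forall_notMem ?_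
      rintro ξ ⟨A, -, -, T, -, -, hlt⟩
      have hfS0 : f S = 0 := by linarith
      rw [stepValue, ← hW0, hfS0] at hlt
      have := h0.trans (hm (Finset.empty_subset T))
      simp only [sub_self, zero_div, mul_zero] at hlt
      linarith
    rw [hempty, measureReal_empty]
    exact hδ
  have h𝒜 := card_bundles_le c S
  refine h (stepSystem hm hf h0 (by omega : 8 ≤ c) hS hW hn2) ?_ ?_ h𝒜 (le_trans ?_ h𝒜)
  · have h1 : 8 * n ≤ c * (n - (S.card + c)) := by
      calc 8 * n ≤ 16 * (n - (S.card + c)) := by omega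
        _ ≤ _ := Nat.mul_le_mul_right _ hc
    exact_mod_cast h1
  · have h1 : c * (n - (S.card + c)) ≤ c * n := Nat.mul_le_mul_left _ (Nat.sub_le _ _)
    exact_mod_cast h1
  · exact_mod_cast Finset.card_image_le

theorem HasGeneralizedExponentialTail.eventually_real_badSelection_le {D : Measure ℝ}
    [IsProbabilityMeasure D] (hD : HasGeneralizedExponentialTail D)
    (hint : ∀ p : ℕ, Integrable (fun x : ℝ => |x| ^ p) D) (hμ : 0 < ∫ x, x ∂D)
    {c : ℕ} (hc : 16 ≤ c) :
    ∀ᶠ n : ℕ in atTop, ∀ f : Finset (Fin n) → ℝ, Monotone f → Submodular f → 0 ≤ f ∅ →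
      ∀ S : Finset (Fin n), 2 * (S.card + c) ≤ n →
        (noiseLaw D n).real (badSelection (bundles c S) (neighbors S) f
          (stepValue f c (1 / Real.log (Real.log n) ^ 2) S)) ≤ 1 / Real.log n ^ 2 := by
  have hi1 : Integrable (fun y : ℝ => y) D := by
    have := hint 1
    simp only [pow_one] at this
    exact (integrable_norm_iff aestronglyMeasurable_id).1 this
  obtain ⟨a, ha⟩ := hD.eventually_exists_thresholds hi1 hμ
  -- The growth conditions need a positive `q`. The value `1` is used only if the product vanishes,
  -- when no multiplier exceeds `M'`.
  obtain ⟨q, hq0, hq⟩ : ∃ q : ℝ, 0 < q ∧ (0 < D.real (Iic a) * D.real (Ici (a + 1)) →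
      q = D.real (Iic a) * D.real (Ici (a + 1))) := by
    by_cases h : 0 < D.real (Iic a) * D.real (Ici (a + 1))
    · exact ⟨_, h, fun _ => rfl⟩
    · exact ⟨1, one_pos, fun h' => absurd h' h⟩
  have hgrow := tendsto_natCast_atTop_atTop.eventually (eventually_growth c hμ hq0
    (∫ y, |y| ^ (10 * (2 * c + 2)) ∂D) (∫ y, y ^ 2 ∂D))
  have hthr := (Real.tendsto_log_atTop.comp tendsto_natCast_atTop_atTop).eventually ha
  filter_upwards [hgrow, hthr] with n hn hn' f hm hf h0 S hS
  obtain ⟨g0, g1, g2, g3, g4, g5, g6, g7, g8, g9, g10⟩ := hn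
  obtain ⟨M, M', k1, k2, k3, k4, k5⟩ := hn'
  refine real_badSelection_le_of_selectionSystem hc
    (by exact_mod_cast (by linarith : (0 : ℝ) < n)) (by positivity) (fun s s1 s2 s3 s4 => ?_) hm hf h0 hS
  exact s.real_badSelection_le_of_growth hint hμ g0 g1 g2 g3 g4 g5 g6 g7 g8 g9 g10 k1 k2 k3 k4
    (k5.imp id fun h => ⟨h.1, hq h.2⟩) s1 s2 s3 s4

end StepBound

/-! ### All iterations together: fresh noise and the union bound. -/

section Failure

variable {n : ℕ}

theorem badSelection_congr {ι β : Type*} {𝒜 : Finset β} {Nb : β → Finset ι} {w : ι → ℝ} {θ : ℝ}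
    {ξ ξ' : ι → ℝ} (h : ∀ A ∈ 𝒜, ∀ T ∈ Nb A, ξ T = ξ' T) (hξ : ξ ∈ badSelection 𝒜 Nb w θ) :
    ξ' ∈ badSelection 𝒜 Nb w θ := by
  obtain ⟨A, hA, hmax, T, hT, hTmax, hlt⟩ := hξ
  have hsum : ∀ B ∈ 𝒜, ∑ T ∈ Nb B, ξ' T * w T = ∑ T ∈ Nb B, ξ T * w T := fun B hB =>
    Finset.sum_congr rfl fun T hT => by rw [h B hB T hT]
  refine ⟨A, hA, fun B hB => ?_, T, hT, fun T' hT' => ?_, hlt⟩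
  · rw [hsum B hB, hsum A hA]; exact hmax B hB
  · rw [← h A hA T hT, ← h A hA T' hT']; exact hTmax T' hT'

/-- The bound on the failure probability of one step, for a random starting point `sol` of fixed
cardinality `m` that depends only on the noise of sets with at most `m` elements. -/
theorem real_badSelection_comp_le {D : Measure ℝ} [IsProbabilityMeasure D]
    (f : Finset (Fin n) → ℝ) {c : ℕ} (m : ℕ) {η δ : ℝ} (hc : 0 < c) (hδ : 0 ≤ δ)
    (sol : (Finset (Fin n) → ℝ) → Finset (Fin n))
    (hmeas : ∀ S, MeasurableSet {ξ | sol ξ = S}) (hcard : ∀ ξ, (sol ξ).card = m)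
    (hcongr : ∀ ξ ξ' : Finset (Fin n) → ℝ, (∀ T, T.card ≤ m → ξ T = ξ' T) → sol ξ = sol ξ')
    (hbad : ∀ S : Finset (Fin n), S.card = m → (noiseLaw D n).real
      (badSelection (bundles c S) (neighbors S) f (stepValue f c η S)) ≤ δ) :
    (noiseLaw D n).real {ξ | ξ ∈ badSelection (bundles c (sol ξ)) (neighbors (sol ξ)) f
      (stepValue f c η (sol ξ))} ≤ δ := by
  classical
  have : IsProbabilityMeasure (noiseLaw D n) := by unfold noiseLaw; infer_instance
  let X : Finset (Fin n) → Set (Finset (Fin n) → ℝ) := fun S => {ξ | sol ξ = S}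
  let Y : Finset (Fin n) → Set (Finset (Fin n) → ℝ) :=
    fun S => badSelection (bundles c S) (neighbors S) f (stepValue f c η S)
  let 𝒮 : Finset (Finset (Fin n)) := Finset.univ.filter fun S => S.card = m
  have hcover : {ξ | ξ ∈ badSelection (bundles c (sol ξ)) (neighbors (sol ξ)) f
      (stepValue f c η (sol ξ))} ⊆ ⋃ S ∈ 𝒮, X S ∩ Y S := by
    intro ξ hξ
    simp only [mem_iUnion, exists_prop]
    exact ⟨sol ξ, Finset.mem_filter.2 ⟨Finset.mem_univ _, hcard ξ⟩, rfl, hξ⟩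
  have hprod : ∀ S ∈ 𝒮, (noiseLaw D n).real (X S ∩ Y S) ≤ (noiseLaw D n).real (X S) * δ := by
    intro S hS
    have hcard : S.card = m := (Finset.mem_filter.1 hS).2
    have hind : (noiseLaw D n).real (X S ∩ Y S) =
        (noiseLaw D n).real (X S) * (noiseLaw D n).real (Y S) := by
      -- The event `sol ξ = S` depends on sets with at most `m` elements, the failure from `S` on
      -- sets with `m + c > m`; hence they are independent.
      refine pi_real_inter_eq_mul (Finset.univ.filter fun T : Finset (Fin n) => T.card ≤ m)
        (hmeas S) (measurableSet_badSelection _ _ _ _) (fun ξ ξ' h hξ => ?_)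
        (fun ξ ξ' h hξ => ?_)
      · have := hcongr ξ' ξ fun T hT =>
          (h T (Finset.mem_filter.2 ⟨Finset.mem_univ _, hT⟩)).symm
        exact this.trans hξ
      · refine badSelection_congr (fun A hA T hT => h T fun hmem => ?_) hξ
        have h1 := card_of_mem_neighbors hA hT
        have h2 := (Finset.mem_filter.1 hmem).2
        omega
    rw [hind]
    exact mul_le_mul_of_nonneg_left (hbad S hcard) measureReal_nonneg
  have hone : ∑ S ∈ 𝒮, (noiseLaw D n).real (X S) ≤ 1 := by
    rw [← measureReal_biUnion_finset _ fun S _ => hmeas S]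
    · exact measureReal_le_one
    · intro S _ S' _ hne
      exact Set.disjoint_left.2 fun ξ h1 h2 => hne (h1.symm.trans h2)
  calc _ ≤ (noiseLaw D n).real (⋃ S ∈ 𝒮, X S ∩ Y S) :=
        measureReal_mono hcover (measure_ne_top _ _)
    _ ≤ ∑ S ∈ 𝒮, (noiseLaw D n).real (X S) * δ :=
        (measureReal_biUnion_finset_le _ _).trans (Finset.sum_le_sum hprod)
    _ ≤ 1 * δ := by
        rw [← Finset.sum_mul]
        exact mul_le_mul_of_nonneg_right hone hδ
    _ = δ := one_mul δ

/-- Noise vectors for which the iteration of SM-Greedy after the first `t` ones fails. -/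
def stepFailure (τ : TieBreak n) (f : Finset (Fin n) → ℝ) (c : ℕ) (η : ℝ) (t : ℕ) :
    Set (Finset (Fin n) → ℝ) :=
  {ξ | ξ ∈ badSelection (bundles c ((stepSol τ (noisyOracle f ξ) c)^[t] ∅))
    (neighbors ((stepSol τ (noisyOracle f ξ) c)^[t] ∅)) f
    (stepValue f c η ((stepSol τ (noisyOracle f ξ) c)^[t] ∅))}

theorem real_stepFailure_le {D : Measure ℝ} [IsProbabilityMeasure D] (τ : TieBreak n)
    (f : Finset (Fin n) → ℝ) {c : ℕ} (hc : 0 < c) {η δ : ℝ} (hδ : 0 ≤ δ) {t : ℕ}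
    (ht : t * c < n)
    (hbad : ∀ S : Finset (Fin n), S.card = t * c → (noiseLaw D n).real
      (badSelection (bundles c S) (neighbors S) f (stepValue f c η S)) ≤ δ) :
    (noiseLaw D n).real (stepFailure τ f c η t) ≤ δ := by
  have hmeas := measurableSet_iterate_stepSol_eq
    (g := fun ξ : Finset (Fin n) → ℝ => noisyOracle f ξ) τ
    (fun T => (measurable_pi_apply T).mul_const _) c t
  have hcard := fun ξ : Finset (Fin n) → ℝ => card_iterate_stepSol τ (noisyOracle f ξ) hc t ht
  have hcongr : ∀ ξ ξ' : Finset (Fin n) → ℝ, (∀ T, T.card ≤ t * c → ξ T = ξ' T) →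
      (stepSol τ (noisyOracle f ξ) c)^[t] ∅ = (stepSol τ (noisyOracle f ξ') c)^[t] ∅ :=
    fun ξ ξ' h => iterate_stepSol_congr τ hc t ht fun T hT => by
      simp only [noisyOracle, h T hT]
  exact real_badSelection_comp_le f (t * c) hc hδ
    (fun ξ => (stepSol τ (noisyOracle f ξ) c)^[t] ∅) hmeas hcard hcongr hbad

theorem le_smGreedy_of_notMem_stepFailure (τ : TieBreak n) {f ξ : Finset (Fin n) → ℝ}
    (hf : Submodular f) (hm : Monotone f) (h0 : 0 ≤ f ∅) {c k : ℕ} (hc : 2 ≤ c) (hk : 2 * k ≤ n)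
    (hn : 0 < n) {η β : ℝ} (hη : 0 ≤ η)
    (hβ : (1 - ((c : ℝ) - 2) / k) ^ (k / c) + 6 * η * (k / c : ℕ) ≤ β)
    (hξ : ∀ t < k / c, ξ ∉ stepFailure τ f c η t) :
    (1 - β) * optValue f k ≤ f (smGreedy τ (noisyOracle f ξ) c k).sol := by
  have hr : k / c * c ≤ k := Nat.div_mul_le_self k c
  have hO : 0 ≤ optValue f k := h0.trans (le_optValue f (by simp))
  have hs0 : (stepSol τ (noisyOracle f ξ) c)^[0] ∅ = ∅ := by
    simp only [Function.iterate_zero, id]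
  have hlt : ∀ t ≤ k / c, t * c < n := fun t ht => by
    have := Nat.mul_le_mul_right c ht
    omega
  have hstep : ∀ t < k / c, t * c + c ≤ k := fun t ht => by
    have h1 : (t + 1) * c ≤ k / c * c := Nat.mul_le_mul_right c ht
    rw [Nat.succ_mul] at h1
    omega
  have hcard : ∀ t ≤ k / c, ((stepSol τ (noisyOracle f ξ) c)^[t] ∅).card = t * c := fun t ht =>
    card_iterate_stepSol τ _ (by omega) t (hlt t ht)
  have hval : ∀ t < k / c, stepValue f c η ((stepSol τ (noisyOracle f ξ) c)^[t] ∅) ≤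
      f ((stepSol τ (noisyOracle f ξ) c)^[t + 1] ∅) := fun t ht => by
    have h1 := hstep t ht
    have h2 := hcard t ht.le
    have h3 := hξ t ht
    rw [Function.iterate_succ_apply']
    rw [stepFailure, mem_ofPred_eq] at h3
    generalize (stepSol τ (noisyOracle f ξ) c)^[t] ∅ = S at h2 h3 ⊢
    exact le_stepSol_of_notMem_badSelection τ (by omega) (by omega) h3
  have hsol : (smGreedy τ (noisyOracle f ξ) c k).sol =
      (stepSol τ (noisyOracle f ξ) c)^[k / c] ∅ := by
    rw [smGreedy, smStep_iterate_sol]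
  rw [hsol]
  have h3 := mul_le_mul_of_nonneg_right hβ hO
  obtain ⟨s, hs⟩ : ∃ s : ℕ → Finset (Fin n), ∀ t, (stepSol τ (noisyOracle f ξ) c)^[t] ∅ = s t :=
    ⟨_, fun _ => rfl⟩
  simp only [hs] at hs0 hcard hval ⊢
  have key := hf.optValue_sub_iterate_le hm h0 hc hr (by omega) hη s hs0 hcard hval
  linarith

theorem Submodular.one_sub_le_real_smGreedy {D : Measure ℝ} [IsProbabilityMeasure D]
    (τ : TieBreak n) {f : Finset (Fin n) → ℝ} (hf : Submodular f) (hm : Monotone f) (h0 : 0 ≤ f ∅)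
    {c k : ℕ} (hc : 2 ≤ c) (hk : 2 * k ≤ n) (hn : 0 < n) {η δ β : ℝ} (hη : 0 ≤ η) (hδ : 0 ≤ δ)
    (hβ : (1 - ((c : ℝ) - 2) / k) ^ (k / c) + 6 * η * (k / c : ℕ) ≤ β)
    (hbad : ∀ S : Finset (Fin n), 2 * (S.card + c) ≤ n → (noiseLaw D n).real
      (badSelection (bundles c S) (neighbors S) f (stepValue f c η S)) ≤ δ) :
    1 - k * δ ≤ (noiseLaw D n).real {ξ : Finset (Fin n) → ℝ |
      (1 - β) * optValue f k ≤ f (smGreedy τ (noisyOracle f ξ) c k).sol} := by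
  have : IsProbabilityMeasure (noiseLaw D n) := by unfold noiseLaw; infer_instance
  set P := noiseLaw D n
  set r := k / c
  have hr : r * c ≤ k := Nat.div_mul_le_self k c
  have hstep : ∀ t < r, t * c + c ≤ k := fun t ht => by
    have h1 : (t + 1) * c ≤ r * c := Nat.mul_le_mul_right c ht
    rw [Nat.succ_mul] at h1
    omega
  set F : Set (Finset (Fin n) → ℝ) := ⋃ t ∈ Finset.range r, stepFailure τ f c η t
  have hF : P.real F ≤ k * δ := by
    calc _ ≤ ∑ t ∈ Finset.range r, P.real (stepFailure τ f c η t) :=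
          measureReal_biUnion_finset_le _ _
      _ ≤ (Finset.range r).card • δ := by
          refine Finset.sum_le_card_nsmul _ _ _ fun t ht => ?_
          have := hstep t (Finset.mem_range.1 ht)
          exact real_stepFailure_le τ f (by omega) hδ (by omega)
            fun S hS => hbad S (by omega)
      _ ≤ k * δ := by
          rw [Finset.card_range, nsmul_eq_mul]
          have : (r : ℝ) ≤ k := by exact_mod_cast Nat.div_le_self k c
          exact mul_le_mul_of_nonneg_right this hδ
  have hcover : (univ : Set (Finset (Fin n) → ℝ)) ⊆ {ξ : Finset (Fin n) → ℝ |
      (1 - β) * optValue f k ≤ f (smGreedy τ (noisyOracle f ξ) c k).sol} ∪ F := by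
    intro ξ _
    by_cases hξ : ξ ∈ F
    · exact Or.inr hξ
    left
    simp only [F, mem_iUnion, exists_prop, not_exists, not_and, Finset.mem_range] at hξ
    exact le_smGreedy_of_notMem_stepFailure τ hf hm h0 hc hk hn hη hβ hξ
  have h1 : (1 : ℝ) ≤ P.real _ := (probReal_univ (μ := P)).symm.le.trans
    (measureReal_mono hcover (measure_ne_top _ _))
  have h2 := h1.trans (measureReal_union_le _ _)
  linarith

end Failure

/-! ### Assembly of the theorem. -/

theorem mainTheorem2 :
    ∃ C₁ : ℝ, 0 < C₁ ∧
      ∀ ε : ℝ, 0 < ε →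
        ∃ d : ℕ,
          ∀ (C₂ : ℝ) (D : MeasureTheory.Measure ℝ) [MeasureTheory.IsProbabilityMeasure D],
            HasGeneralizedExponentialTail D →
            (∀ p : ℕ, MeasureTheory.Integrable (fun x : ℝ => |x| ^ p) D) →
            0 < ∫ x, x ∂D →
            ∃ n₀ : ℕ, ∀ n : ℕ, n₀ ≤ n → ∀ k : ℕ,
              C₁ / ε ≤ (k : ℝ) → (k : ℝ) ≤ C₂ * Real.log (Real.log n) →
              ∀ τ : TieBreak n,
                (∀ g : Finset (Fin n) → ℝ,
                  (smGreedy τ g (bundleSize ε k) k).sol.card ≤ k ∧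
                  (smGreedy τ g (bundleSize ε k) k).evals ≤ n ^ d) ∧
                ∀ f : Finset (Fin n) → ℝ, Monotone f → Submodular f → 0 ≤ f ∅ →
                  ENNReal.ofReal (1 - 4 / Real.logb 2 n) ≤
                    noiseLaw D n {ξ : Finset (Fin n) → ℝ |
                      (1 - 1 / Real.exp 1 - ε) * optValue f k ≤
                        f (smGreedy τ (noisyOracle f ξ) (bundleSize ε k) k).sol} := by
  -- For `ε < 1` this makes `k > 16`, hence every bundle size that occurs is at least `16`.
  refine ⟨16, by norm_num, fun ε hε => ?_⟩
  set cmax := ⌈400 / ε ^ 2⌉₊ + ⌈80 / ε⌉₊ with hcmax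
  refine ⟨cmax + 4, fun C₂ D _ hD hint hmean => ?_⟩
  have hlog : Filter.Tendsto (fun n : ℕ => Real.log n) Filter.atTop Filter.atTop :=
    Real.tendsto_log_atTop.comp tendsto_natCast_atTop_atTop
  -- Only finitely many bundle sizes occur for a given `ε`, so one `n₀` serves all `k`.
  have hstep : ∀ᶠ n : ℕ in Filter.atTop, ∀ c ∈ Finset.Icc 16 cmax,
      ∀ f : Finset (Fin n) → ℝ, Monotone f → Submodular f → 0 ≤ f ∅ →
      ∀ S : Finset (Fin n), 2 * (S.card + c) ≤ n →
        (noiseLaw D n).real (badSelection (bundles c S) (neighbors S) f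
          (stepValue f c (1 / Real.log (Real.log n) ^ 2) S)) ≤ 1 / Real.log n ^ 2 :=
    (Filter.eventually_all_finset _).2 fun c hc =>
      hD.eventually_real_badSelection_le hint hmean (Finset.mem_Icc.1 hc).1
  have hk1 := hlog.eventually (eventually_log_pow_le_mul one_pos 1 C₂)
  have hk2 := (Real.tendsto_log_atTop.comp hlog).eventually
    (Filter.eventually_ge_atTop (12 * C₂ / ε))
  have hk3 := (Real.tendsto_log_atTop.comp hlog).eventually (Filter.eventually_ge_atTop 1)
  have hk4 := tendsto_natCast_atTop_atTop.eventually
    (eventually_log_pow_le_mul (c := 1 / 2) (by norm_num) 1 1)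
  have hall := (hstep.and (hk1.and (hk2.and (hk3.and hk4)))).and (Filter.eventually_ge_atTop 2)
  obtain ⟨n₀, hn₀⟩ := Filter.eventually_atTop.1 hall
  refine ⟨n₀, fun n hn k hkl hku τ => ?_⟩
  obtain ⟨⟨hstep, hC2, hη, hl1, hlogn⟩, hn2⟩ := hn₀ n hn
  simp only [Function.comp_apply, pow_one, one_mul] at hC2 hη hl1 hlogn
  set L := Real.log n
  set l := Real.log L
  set c := bundleSize ε k
  have hc0 : 0 < c := bundleSize_pos hε hkl
  have hcle : c ≤ cmax := bundleSize_le ε k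
  have hk2 : 2 * k ≤ n := by
    have : (2 : ℝ) * k ≤ n := by linarith
    exact_mod_cast this
  -- If `L = 0`, the convention `Real.log 0 = 0` would contradict `1 ≤ l`.
  have hL0 : 0 < L := by
    by_contra! h
    have hL : L = 0 := le_antisymm h (Real.log_natCast_nonneg n)
    simp only [l, hL, Real.log_zero] at hl1
    linarith
  refine ⟨fun g => ?_, fun f hm hf h0 => ?_⟩
  · obtain ⟨h1, h2⟩ := smGreedy_card_evals_le τ g hc0 hn2 (by omega : k < n)
    exact ⟨h1, h2.trans (Nat.pow_le_pow_right (by omega) (by omega))⟩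
  have hP : IsProbabilityMeasure (noiseLaw D n) := by unfold noiseLaw; infer_instance
  refine (ENNReal.ofReal_le_iff_le_toReal (measure_ne_top _ _)).2 ?_
  change _ ≤ (noiseLaw D n).real _
  have hlogb : 4 / Real.logb 2 n = 4 * Real.log 2 / L := by
    rw [Real.logb, div_div_eq_mul_div]
  have hlog2 : 0 < Real.log 2 := Real.log_pos (by norm_num)
  rcases lt_or_ge ε 1 with hε1 | hε1
  · obtain ⟨hc16, hpow⟩ := one_sub_pow_le hε hε1 hkl
    have hkr : ((k / c : ℕ) : ℝ) ≤ C₂ * l :=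
      le_trans (by exact_mod_cast Nat.div_le_self k c) hku
    have hβ : (1 - ((c : ℝ) - 2) / k) ^ (k / c) + 6 * (1 / l ^ 2) * (k / c : ℕ) ≤
        1 / Real.exp 1 + ε := by
      have h1 : 6 * (1 / l ^ 2) * (k / c : ℕ) ≤ 6 * (1 / l ^ 2) * (C₂ * l) :=
        mul_le_mul_of_nonneg_left hkr (by positivity)
      have h2 : 6 * (1 / l ^ 2) * (C₂ * l) = 6 * C₂ / l := by
        have : l ≠ 0 := by linarith
        field_simp
      -- Since `η` is `1 / l ^ 2` and there are at most `C₂ * l` iterations, the accumulated error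
      -- vanishes.
      have h3 : 6 * C₂ / l ≤ ε / 2 := by
        rw [div_le_iff₀ hε] at hη
        rw [div_le_iff₀ (by linarith)]
        linarith
      linarith
    have key := hf.one_sub_le_real_smGreedy (D := D) τ hm h0 (c := c) (k := k) (by omega) hk2
      (by omega) (η := 1 / l ^ 2) (δ := 1 / L ^ 2) (by positivity) (by positivity) hβ
      (hstep c (Finset.mem_Icc.2 ⟨hc16, hcle⟩) f hm hf h0)
    have hkL : k * (1 / L ^ 2) ≤ 4 / Real.logb 2 n := by
      rw [hlogb, mul_one_div, div_le_div_iff₀ (by positivity) hL0]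
      have h1 : (k : ℝ) ≤ 4 * Real.log 2 * L := by
        have : L ≤ 4 * Real.log 2 * L :=
          le_mul_of_one_le_left hL0.le (by linarith [Real.log_two_gt_d9])
        linarith
      have := mul_le_mul_of_nonneg_right h1 hL0.le
      linarith
    rw [← sub_sub] at key
    linarith
  -- For `ε ≥ 1` the guaranteed ratio is negative, and nonnegativity of `f` suffices.
  · have huniv : {ξ : Finset (Fin n) → ℝ | (1 - 1 / Real.exp 1 - ε) * optValue f k ≤
        f (smGreedy τ (noisyOracle f ξ) c k).sol} = univ := by
      refine eq_univ_of_forall fun ξ => ?_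
      have h1 : 0 ≤ optValue f k := h0.trans (le_optValue f (by simp))
      have h2 : 0 < 1 / Real.exp 1 := by positivity
      exact (mul_nonpos_of_nonpos_of_nonneg (by linarith) h1).trans
        (h0.trans (hm (Finset.empty_subset _)))
    rw [huniv, probReal_univ, hlogb]
    have : 0 ≤ 4 * Real.log 2 / L := by positivity
    linarith
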